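/- Let $n,m\ge 0$. An orientation $\varphi$ of the $n$-cube (vertices: the subsets of $[n]$; edges: pairs of sets whose symmetric difference has one element) is a unique sink orientation (USO) if every subcube $\{w: a\subseteq w\subseteq b\}$, $a\subseteq b\subseteq[n]$, has exactly one sink. Its outmap $s:2^{[n]}\to 2^{[n]}$ sends a vertex to the set of directions of its outgoing edges. A unitary $U$ on $(\mathbb C^2)^{\otimes m}\otimes(\mathbb C^2)^{\otimes n}\otimes(\mathbb C^2)^{\otimes n}$, with basis $|k,u,v\rangle$, $k\in\{0,\dots,2^m-1\}$, $u,v\in 2^{[n]}$, calculates the powers of $s$ if $U|k,u,v\rangle=|k,u,v\oplus s^k(u)\rangle$ for all $k,u,v$, where $s^k$ is the $k$-fold composition and $\oplus$ the symmetric difference. Theorem. There are constants $Q\in\mathbb N$ and $\delta>0$, a polynomial $p$, and a computable family of quantum circuits $C_{m,n}$ that act on the $m+2n$ qubits of $|k,u,v\rangle$ and at most $p(m+n)$ work qubits and consist of at most $p(m+n)$ gates (Hadamard, phase gates $\mathrm{diag}(1,e^{\pm 2\pi i/2^j})$, CNOT, Toffoli, and oracle gates $U$ on the three registers), at most $Q$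 of which are oracle gates, such that for all $m,n$ and every USO of the $n$-cube with outmap $s$ the following hold. Let $l$ be the period of $\varnothing$ under $s$. Then $1\le l\le 2^n$, and $s^{l-1}(\varnothing)$ is the unique sink of the cube. Moreover, if $m\ge 2n$, or more generally $l^2\le 2^m$, then for every unitary $U$ that calculates the powers of $s$, running $C_{m,n}$ with oracle $U$ on the all-zero state and measuring in the computational basis gives, with probability at least $\delta$, the value $l-1$ in the first register and the unique sink $s^{l-1}(\varnothing)$ in the third. In particular (take $m=2n$), a circuit of size $\mathrm{poly}(n)$, which depends on $n$ only, finds the period $l$ and the unique sink of every USO of the $n$-cube with constant probability and $O(1)$ queries to $U$. -/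

import Mathlib

/-! ### The combinatorial cube, orientations, outmaps -/

/-- The `n`-dimensional cube: vertices are the subsets of the ground set `Fin n`,
and two vertices are adjacent when their symmetric difference has exactly one element. -/
def cubeGraph (n : ℕ) : SimpleGraph (Finset (Fin n)) where
  Adj u v := (symmDiff u v).card = 1
  symm := ⟨fun u v h => by rw [symmDiff_comm]; exact h⟩
  loopless := ⟨fun u h => by simp at h⟩

/-- Flipping membership of the direction `i` leads to an adjacent vertex. -/
theorem cubeGraph_adj_flip {n : ℕ} (v : Finset (Fin n)) (i : Fin n) :
    s(v, symmDiff v {i}) ∈ (cubeGraph n).edgeSet := by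
  rw [SimpleGraph.mem_edgeSet]
  change (symmDiff v (symmDiff v {i})).card = 1
  rw [symmDiff_symmDiff_cancel_left, Finset.card_singleton]

/-- An orientation of a graph: every edge is sent to one of its two end points,
the one that it points to. -/
structure GraphOrientation {V : Type*} (G : SimpleGraph V) where
  head : G.edgeSet → V
  head_mem : ∀ e : G.edgeSet, head e ∈ (e : Sym2 V)

namespace GraphOrientation

variable {n : ℕ}

open Classical in
/-- The outmap: the set of the directions of the outgoing edges of a vertex. -/
noncomputable def outmap (φ : GraphOrientation (cubeGraph n)) (v : Finset (Fin n)) :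
    Finset (Fin n) :=
  Finset.univ.filter fun i => φ.head ⟨s(v, symmDiff v {i}), cubeGraph_adj_flip v i⟩ ≠ v

/-- `w` is a sink of the subcube with vertex set `{w | a ⊆ w ⊆ b}`: it is a vertex of the
subcube without outgoing edges along the directions `b \ a` of the subcube. -/
def IsSinkOfFace (φ : GraphOrientation (cubeGraph n)) (a b w : Finset (Fin n)) : Prop :=
  a ⊆ w ∧ w ⊆ b ∧ ∀ i ∈ b \ a, i ∉ φ.outmap w

/-- Unique sink orientation: every subcube has exactly one sink. -/
def IsUSO (φ : GraphOrientation (cubeGraph n)) : Prop :=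
  ∀ a b : Finset (Fin n), a ⊆ b → ∃! w, φ.IsSinkOfFace a b w

/-- A sink of the whole cube. -/
def IsSink (φ : GraphOrientation (cubeGraph n)) (w : Finset (Fin n)) : Prop :=
  φ.IsSinkOfFace ∅ Finset.univ w

end GraphOrientation

/-! ### The oracle -/

/-- The qubits of the three registers of `|k, u, v⟩`: `m` qubits for the number `k` and
`n` qubits for each of the sets `u` and `v`. -/
abbrev OracleWire (m n : ℕ) : Type := Fin m ⊕ (Fin n ⊕ Fin n)

/-- The bit string of the basis state `|k, u, v⟩`, for `k < 2 ^ m`. -/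
def ketBits (m : ℕ) {n : ℕ} (k : ℕ) (u v : Finset (Fin n)) : OracleWire m n → Bool :=
  Sum.elim (fun i => k.testBit i)
    (Sum.elim (fun i => decide (i ∈ u)) (fun i => decide (i ∈ v)))

/-- `U |k, u, v⟩ = |k, u, v ⊕ s^k(u)⟩` for all `k ∈ {0, …, 2 ^ m - 1}` and all `u`, `v`. -/
def CalculatesPowers {m n : ℕ}
    (U : Matrix (OracleWire m n → Bool) (OracleWire m n → Bool) ℂ)
    (s : Finset (Fin n) → Finset (Fin n)) : Prop :=
  ∀ k < 2 ^ m, ∀ u v : Finset (Fin n),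
    U.mulVec (Pi.single (ketBits m k u v) 1) = Pi.single (ketBits m k u (symmDiff v (s^[k] u))) 1

/-! ### Quantum circuits with oracle gates -/

/-- The qubits of a circuit: the oracle's registers and `a` further work qubits. -/
abbrev CircuitWire (m n a : ℕ) : Type := OracleWire m n ⊕ Fin a

/-- A (not necessarily normalised) state vector, given by its amplitudes. -/
abbrev QState (m n a : ℕ) : Type := (CircuitWire m n a → Bool) → ℂ

/-- The elementary gates: Hadamard gates, the phase gates `diag(1, exp(2πi / 2^j))` and their
inverses, controlled-NOT and Toffoli gates on distinct qubits, and the oracle gate,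
which acts on the three oracle registers. -/
inductive QGate (m n a : ℕ) : Type
  | hadamard (q : CircuitWire m n a)
  | phase (j : ℕ) (q : CircuitWire m n a)
  | phaseInv (j : ℕ) (q : CircuitWire m n a)
  | cnot (c t : CircuitWire m n a) (h : c ≠ t)
  | toffoli (c₁ c₂ t : CircuitWire m n a) (h : c₁ ≠ c₂) (h₁ : c₁ ≠ t) (h₂ : c₂ ≠ t)
  | oracle

/-- A circuit is a list of gates, applied from left to right. -/
abbrev QCircuit (m n a : ℕ) : Type := List (QGate m n a)

namespace QGate

variable {m n a : ℕ}

/-- The action of a gate on state vectors, when the oracle gate stands for the matrix `U`. -/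
noncomputable def apply (U : Matrix (OracleWire m n → Bool) (OracleWire m n → Bool) ℂ) :
    QGate m n a → QState m n a → QState m n a
  | hadamard q, ψ => fun x =>
      (ψ (Function.update x q false) +
        (if x q then -1 else 1) * ψ (Function.update x q true)) / (Real.sqrt 2 : ℂ)
  | phase j q, ψ => fun x =>
      (if x q then Complex.exp (2 * Real.pi * Complex.I / 2 ^ j) else 1) * ψ x
  | phaseInv j q, ψ => fun x =>
      (if x q then Complex.exp (-(2 * Real.pi * Complex.I / 2 ^ j)) else 1) * ψ x
  | cnot c t _, ψ => fun x => ψ (Function.update x t (xor (x t) (x c)))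
  | toffoli c₁ c₂ t _ _ _, ψ => fun x => ψ (Function.update x t (xor (x t) (x c₁ && x c₂)))
  | oracle, ψ => fun x =>
      ∑ y : OracleWire m n → Bool,
        U (fun i => x (Sum.inl i)) y * ψ (Sum.elim y fun i => x (Sum.inr i))

/-- Is the gate a query to the oracle? -/
def isQuery : QGate m n a → Bool
  | oracle => true
  | _ => false

/-- A qubit, written as the number of its register and its position there. -/
def wireCode : CircuitWire m n a → ℕ × ℕ
  | Sum.inl (Sum.inl i) => (0, i)
  | Sum.inl (Sum.inr (Sum.inl i)) => (1, i)
  | Sum.inl (Sum.inr (Sum.inr i)) => (2, i)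
  | Sum.inr i => (3, i)

/-- A gate, written as an operation code, a parameter and a list of qubits. -/
def code : QGate m n a → ℕ × ℕ × List (ℕ × ℕ)
  | hadamard q => (0, 0, [wireCode q])
  | phase j q => (1, j, [wireCode q])
  | phaseInv j q => (2, j, [wireCode q])
  | cnot c t _ => (3, 0, [wireCode c, wireCode t])
  | toffoli c₁ c₂ t _ _ _ => (4, 0, [wireCode c₁, wireCode c₂, wireCode t])
  | oracle => (5, 0, [])

end QGate

namespace QCircuit

variable {m n a : ℕ}

/-- The number of oracle queries of a circuit. -/
def queries (C : QCircuit m n a) : ℕ := C.countP QGate.isQuery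

/-- The final state of a circuit that is started with every qubit in the state `|0⟩`. -/
noncomputable def run (C : QCircuit m n a)
    (U : Matrix (OracleWire m n → Bool) (OracleWire m n → Bool) ℂ) : QState m n a :=
  C.foldl (fun ψ g => g.apply U ψ) (Pi.single (fun _ => false) 1)

/-- The description of a circuit as finite data. -/
def code (C : QCircuit m n a) : List (ℕ × ℕ × List (ℕ × ℕ)) := C.map QGate.code

open Classical in
/-- The probability that measuring every qubit of the final state in the computational basis
shows the number `k` in the first register and the set `v` in the third one. -/
noncomputable def outputProb (C : QCircuit m n a)
    (U : Matrix (OracleWire m n → Bool) (OracleWire m n → Bool) ℂ)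
    (k : ℕ) (v : Finset (Fin n)) : ℝ :=
  ∑ x : CircuitWire m n a → Bool,
    if ∃ (u : Finset (Fin n)) (r : Fin a → Bool), x = Sum.elim (ketBits m k u v) r
    then ‖C.run U x‖ ^ 2 else 0

end QCircuit

/-!
The outmap `s` of a unique sink orientation is a bijection: reversing all edges of some directions
preserves the unique sink property, so for every set `d` there is exactly one vertex whose set of
outgoing directions is `d` (`HasUniqueSinks.injective`). Hence `∅` lies on a cycle of `s`, of some
length `l ≤ 2 ^ n`, and the unique sink, the only vertex with outmap `∅`, is the predecessor
`s^(l - 1)(∅)` of `∅` on this cycle. It remains to find `l`, which is quantum period finding for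
the injective sequence `s^0(∅), …, s^(l - 1)(∅)`.

A sampling step applies the Fourier transform to the first register, queries the oracle, and
applies the Fourier transform again. The amplitude of the frequency `y` together with the orbit
element `s^t(∅)` is a geometric sum (`QCircuit.sampleAmp`). If `y` is nearest to `j 2 ^ m / l` and
`l² ≤ 2 ^ m`, its terms nearly agree, and summing over `t` gives `y` a probability of at least
`1 / (4 π² l)` (`sum_norm_sampleAmp_sq_ge`). The circuit takes two samples and moves each of them,
with its orbit element, to fresh work qubits, so that the amplitudes of the two are multiplied. Two
samples suffice because a quarter of all pairs `(j₁, j₂)` have no common divisor with `l`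
(`card_coprime_pairs_ge`), and then the denominators of the reduced fractions `j₁ / l` and `j₂ / l`
have the least common multiple `l`. Altogether the success probability is at least
`l² / 4 · (1 / (4 π² l))² = 1 / (64 π⁴)`.

The denominators are recovered by Euclid's algorithm with cofactors, stopped as soon as the
cofactor exceeds twice the remainder (`EuclidState.t₁_eq_of_approx`). The same iteration with other
initial values computes the least common multiple (`EuclidState.t₁_iterate_eq_lcm`), and one of its
subtractions computes `l - 1`. So the classical part of the circuit consists of copies of a single
block, one conditional shifted subtraction followed by a conditional exchange. Its bits satisfy
local equations of the form `x_t = x_a ⊕ (x_b ∧ x_c)` (`BlockEqns`), and each becomes two gates that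
write to a fresh work qubit. The result `l - 1` is added to the first register, which is zero by
then, and a third query writes `s^(l - 1)(∅)` to the third register. The work qubits are never
cleared: the probability of the output is a sum over their values.

All gates and qubits are given by arithmetic of their indices, so the list of gates is a primitive
recursive function of `m` and `n`.
-/

/-! ### Outmaps of unique sink orientations are bijective -/

/-- Every subcube has exactly one vertex whose value under `s` avoids the directions of the
subcube: the unique sink property, stated for the outmap alone. -/
def HasUniqueSinks {α : Type*} [DecidableEq α] (s : Finset α → Finset α) : Prop :=
  ∀ a b : Finset α, a ⊆ b → ∃! w, a ⊆ w ∧ w ⊆ b ∧ ∀ i ∈ b \ a, i ∉ s w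

/-- Reversing all edges of one direction preserves the unique sink property: in a subcube that
contains the direction, exactly one of the sinks of the two facets is a sink, and the reversal
exchanges their roles. -/
theorem HasUniqueSinks.flip {α : Type*} [DecidableEq α] {s : Finset α → Finset α}
    (hs : HasUniqueSinks s) (i : α) : HasUniqueSinks fun w => symmDiff (s w) {i} := by
  intro a b hab
  by_cases hi : i ∈ b \ a
  · have hib := (Finset.mem_sdiff.1 hi).1
    have hia := (Finset.mem_sdiff.1 hi).2
    obtain ⟨w0, ⟨h01, h02, h03⟩, u0⟩ := hs a (b.erase i)
      (fun x hx => Finset.mem_erase.2 ⟨fun h => hia (h ▸ hx), hab hx⟩)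
    obtain ⟨w1, ⟨h11, h12, h13⟩, u1⟩ := hs (insert i a) b
      (Finset.insert_subset hib hab)
    obtain ⟨w, ⟨hw1, hw2, hw3⟩, u⟩ := hs a b hab
    have hw0i : i ∉ w0 := fun h => (Finset.mem_erase.1 (h02 h)).1 rfl
    have hw1i : i ∈ w1 := h11 (Finset.mem_insert_self _ _)
    have hne : w0 ≠ w1 := fun h => hw0i (h ▸ hw1i)
    have sub0 : ∀ w', a ⊆ w' → w' ⊆ b → (∀ j ∈ b \ a, j ≠ i → j ∉ s w') → i ∉ w' → w' = w0 := by
      intro w' h1 h2 h3 h4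
      refine u0 w' ⟨h1, fun x hx => Finset.mem_erase.2 ⟨fun h => h4 (h ▸ hx), h2 hx⟩, ?_⟩
      intro j hj
      simp only [Finset.mem_sdiff, Finset.mem_erase] at hj
      exact h3 j (Finset.mem_sdiff.2 ⟨hj.1.2, hj.2⟩) hj.1.1
    have sub1 : ∀ w', a ⊆ w' → w' ⊆ b → (∀ j ∈ b \ a, j ≠ i → j ∉ s w') → i ∈ w' → w' = w1 := by
      intro w' h1 h2 h3 h4
      refine u1 w' ⟨Finset.insert_subset h4 h1, h2, ?_⟩
      intro j hj
      simp only [Finset.mem_sdiff, Finset.mem_insert, not_or] at hj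
      exact h3 j (Finset.mem_sdiff.2 ⟨hj.1, hj.2.2⟩) hj.2.1
    have key0 : ∀ j ∈ b \ a, j ≠ i → j ∉ s w0 := by
      intro j hj hji
      simp only [Finset.mem_sdiff] at hj
      exact h03 j (by simp [hj.1, hj.2, hji])
    have key1 : ∀ j ∈ b \ a, j ≠ i → j ∉ s w1 := by
      intro j hj hji
      simp only [Finset.mem_sdiff] at hj
      exact h13 j (by simp [hj.1, hj.2, hji])
    have sub0b : w0 ⊆ b := h02.trans (Finset.erase_subset _ _)
    have sup1a : a ⊆ w1 := (Finset.subset_insert _ _).trans h11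
    have mem_flip : ∀ w' j, j ∈ symmDiff (s w') {i} ↔ if j = i then i ∉ s w' else j ∈ s w' := by
      intro w' j
      by_cases hj : j = i <;> simp [Finset.mem_symmDiff, hj]
    -- exactly one of `w0`, `w1` is the sink `w` of the subcube
    have hor : w = w0 ∨ w = w1 := by
      by_cases hiw : i ∈ w
      · exact Or.inr (sub1 w hw1 hw2 (fun j hj _ => hw3 j hj) hiw)
      · exact Or.inl (sub0 w hw1 hw2 (fun j hj _ => hw3 j hj) hiw)
    have c0 : i ∉ s w0 → w0 = w := fun h => u w0 ⟨h01, sub0b, fun j hj => by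
      by_cases hji : j = i
      · exact hji ▸ h
      · exact key0 j hj hji⟩
    have c1 : i ∉ s w1 → w1 = w := fun h => u w1 ⟨sup1a, h12, fun j hj => by
      by_cases hji : j = i
      · exact hji ▸ h
      · exact key1 j hj hji⟩
    rcases hor with h | h
    · have hi1 : i ∈ s w1 := by
        by_contra hc; exact hne (h ▸ (c1 hc).symm)
      refine ⟨w1, ⟨sup1a, h12, fun j hj => ?_⟩, ?_⟩
      · rw [mem_flip]; split_ifs with hji
        · simpa using hi1
        · exact key1 j hj hji
      · rintro w' ⟨h1, h2, h3⟩
        have h3' : ∀ j ∈ b \ a, j ≠ i → j ∉ s w' := fun j hj hji => by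
          have := h3 j hj; rw [mem_flip, if_neg hji] at this; exact this
        by_cases hiw : i ∈ w'
        · exact sub1 w' h1 h2 h3' hiw
        · have e := sub0 w' h1 h2 h3' hiw
          have := h3 i hi
          rw [mem_flip, if_pos rfl, e, ← h] at this
          exact absurd (hw3 i hi) this
    · have hi0 : i ∈ s w0 := by
        by_contra hc; exact hne (h ▸ c0 hc)
      refine ⟨w0, ⟨h01, sub0b, fun j hj => ?_⟩, ?_⟩
      · rw [mem_flip]; split_ifs with hji
        · simpa using hi0
        · exact key0 j hj hji
      · rintro w' ⟨h1, h2, h3⟩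
        have h3' : ∀ j ∈ b \ a, j ≠ i → j ∉ s w' := fun j hj hji => by
          have := h3 j hj; rw [mem_flip, if_neg hji] at this; exact this
        by_cases hiw : i ∈ w'
        · have e := sub1 w' h1 h2 h3' hiw
          have := h3 i hi
          rw [mem_flip, if_pos rfl, e, ← h] at this
          exact absurd (hw3 i hi) this
        · exact sub0 w' h1 h2 h3' hiw
  · have : ∀ w, (∀ j ∈ b \ a, j ∉ symmDiff (s w) {i}) ↔ ∀ j ∈ b \ a, j ∉ s w := by
      refine fun w => forall₂_congr fun j hj => ?_
      have hji : j ≠ i := fun h => hi (h ▸ hj)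
      simp [Finset.mem_symmDiff, hji]
    simpa only [this] using hs a b hab

theorem HasUniqueSinks.flip_set {α : Type*} [DecidableEq α] {s : Finset α → Finset α}
    (hs : HasUniqueSinks s) (d : Finset α) : HasUniqueSinks fun w => symmDiff (s w) d := by
  induction d using Finset.induction_on with
  | empty =>
    have : (fun w => symmDiff (s w) ∅) = s := funext fun w => symmDiff_bot _
    rwa [this]
  | insert i d hi ih =>
    have := ih.flip i
    have e : insert i d = symmDiff d {i} := by
      ext j; by_cases hj : j = i <;> simp [Finset.mem_symmDiff, hj, hi]
    simpa only [symmDiff_assoc, ← e] using this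

/-- A vertex with value `d` is a sink of the whole cube after the directions in `d` are
reversed, so there is exactly one. -/
theorem HasUniqueSinks.injective {α : Type*} [DecidableEq α] [Fintype α]
    {s : Finset α → Finset α} (hs : HasUniqueSinks s) : Function.Injective s := by
  intro u v huv
  obtain ⟨w, -, uw⟩ := hs.flip_set (s u) ∅ Finset.univ (Finset.subset_univ _)
  rw [uw u ⟨Finset.empty_subset _, Finset.subset_univ _, by simp⟩,
    uw v ⟨Finset.empty_subset _, Finset.subset_univ _, by simp [huv]⟩]

namespace GraphOrientation

variable {n : ℕ} {φ : GraphOrientation (cubeGraph n)}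

theorem IsUSO.injective_outmap (h : φ.IsUSO) : Function.Injective φ.outmap :=
  HasUniqueSinks.injective h

theorem IsUSO.minimalPeriod_pos (h : φ.IsUSO) (v : Finset (Fin n)) :
    0 < Function.minimalPeriod φ.outmap v :=
  Function.minimalPeriod_pos_of_mem_periodicPts (h.injective_outmap.mem_periodicPts v)

theorem minimalPeriod_outmap_le (φ : GraphOrientation (cubeGraph n)) (v : Finset (Fin n)) :
    Function.minimalPeriod φ.outmap v ≤ 2 ^ n := by
  have h1 := Finset.card_le_card_of_injOn (s := Finset.range (Function.minimalPeriod φ.outmap v))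
    (t := (Finset.univ : Finset (Finset (Fin n)))) (fun k => φ.outmap^[k] v) (by simp)
    (by simpa [Set.InjOn] using Function.iterate_injOn_Iio_minimalPeriod (f := φ.outmap) (x := v))
  simpa using h1

theorem isSink_iff (φ : GraphOrientation (cubeGraph n)) (w : Finset (Fin n)) :
    φ.IsSink w ↔ φ.outmap w = ∅ := by
  simp [IsSink, IsSinkOfFace, Finset.eq_empty_iff_forall_notMem]

/-- The unique sink is the predecessor of `∅` on its cycle under the outmap. -/
theorem IsUSO.isSink_iff_eq_iterate (h : φ.IsUSO) (w : Finset (Fin n)) :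
    φ.IsSink w ↔ w = φ.outmap^[Function.minimalPeriod φ.outmap ∅ - 1] ∅ := by
  have hp := h.minimalPeriod_pos ∅
  have e : φ.outmap (φ.outmap^[Function.minimalPeriod φ.outmap ∅ - 1] ∅) = ∅ := by
    rw [← Function.iterate_succ_apply' φ.outmap, Nat.succ_eq_add_one, Nat.sub_add_cancel hp,
      Function.iterate_minimalPeriod]
  rw [isSink_iff]
  exact ⟨fun hw => h.injective_outmap (hw.trans e.symm), fun hw => hw ▸ e⟩

end GraphOrientation

/-! ### Euclid's algorithm with cofactors -/

/-- The state of Euclid's algorithm: two consecutive remainders `r₀`, `r₁` and the absolute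
values `t₀`, `t₁` of their cofactors. -/
structure EuclidState where
  r₀ : ℕ
  r₁ : ℕ
  t₀ : ℕ
  t₁ : ℕ

namespace EuclidState

/-- The algorithm goes on as long as `2 r₁ > t₁`. -/
def Active (S : EuclidState) : Prop := S.t₁ < 2 * S.r₁

instance (S : EuclidState) : Decidable S.Active := inferInstanceAs (Decidable (_ < _))

/-- One division with remainder. A state that is not active does not change any more. -/
def next (S : EuclidState) : EuclidState :=
  if S.Active then ⟨S.r₁, S.r₀ % S.r₁, S.t₁, S.t₀ + S.r₀ / S.r₁ * S.t₁⟩ else S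

theorem next_of_not_active {S : EuclidState} (h : ¬ S.Active) : S.next = S := if_neg h

theorem iterate_next_of_not_active {S : EuclidState} (h : ¬ S.Active) (k : ℕ) :
    next^[k] S = S := by
  induction k with
  | zero => rfl
  | succ k ih => rw [Function.iterate_succ_apply, next_of_not_active h, ih]

/-- Two divisions at least halve the remainder. -/
theorem not_active_iterate (k : ℕ) : ∀ S : EuclidState, S.r₁ < 2 ^ k →
    ¬ (next^[2 * k] S).Active := by
  induction k with
  | zero =>
    intro S h
    have : S.r₁ = 0 := by simpa using h
    simp [Active, this]
  | succ k ih =>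
    intro S h
    by_cases h0 : S.Active
    · rw [show 2 * (k + 1) = 2 * k + 1 + 1 by ring, Function.iterate_succ_apply]
      by_cases h1 : S.next.Active
      · rw [Function.iterate_succ_apply]
        apply ih
        rw [next, if_pos h1]
        rw [next, if_pos h0] at h1 ⊢
        simp only [Active] at h0 h1 ⊢
        have hx : 0 < S.r₀ % S.r₁ := by omega
        have hlt : S.r₀ % S.r₁ < S.r₁ := Nat.mod_lt _ (by omega)
        generalize S.r₀ % S.r₁ = x at *
        have h2 := Nat.mod_lt S.r₁ hx
        have h3 := Nat.div_add_mod S.r₁ x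
        have h4 : 1 ≤ S.r₁ / x := (Nat.one_le_div_iff hx).2 hlt.le
        have h5 : x * 1 ≤ x * (S.r₁ / x) := Nat.mul_le_mul_left _ h4
        rw [pow_succ] at h
        omega
      · rw [iterate_next_of_not_active h1]; exact h1
    · rw [iterate_next_of_not_active h0]; exact h0

/-- Rational reconstruction: if `t₀`, `t₁` are the cofactors of the remainders `r₀`, `r₁` in
Euclid's algorithm for `M` and `y`, at the first state with `2 r₁ ≤ t₁`, then `t₁` is the
denominator of the reduced fraction `p / q` with `q² ≤ M` that is within `1 / (2 M)` of
`y / M`. The vector `(q, q y - p M)` is an integral combination of `(t₀, ∓r₀)` and `(t₁, ±r₁)`,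
and its coefficients are controlled by the determinants, which are multiples of `M`. -/
theorem t₁_eq_of_approx {M y : ℤ} {q p r₀ r₁ t₀ t₁ s₀ s₁ σ : ℤ} (hσ : σ * σ = 1)
    (hr₀ : 0 ≤ r₀) (hr₁ : 0 ≤ r₁) (ht₀ : 0 ≤ t₀) (ht₁ : 0 ≤ t₁)
    (e₀ : t₀ * y - s₀ * M = -(σ * r₀)) (e₁ : t₁ * y - s₁ * M = σ * r₁)
    (hdet : r₀ * t₁ + r₁ * t₀ = M) (hM : 0 < M)
    (hact : t₀ < 2 * r₀) (hhalt : 2 * r₁ ≤ t₁)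
    (hq : 0 < q) (hqM : q ^ 2 ≤ M) (hpq : IsCoprime p q)
    (happ : 2 * |q * y - p * M| ≤ q) : t₁ = q := by
  obtain ⟨e, he⟩ : ∃ e, e = σ * (q * y - p * M) := ⟨_, rfl⟩
  have hσ' : σ = 1 ∨ σ = -1 := by
    have : (σ - 1) * (σ + 1) = 0 := by linear_combination hσ
    rcases mul_eq_zero.1 this with h | h
    · left; linarith
    · right; linarith
  have habs : |e| = |q * y - p * M| := by
    rcases hσ' with h | h <;> simp [he, h, abs_sub_comm]
  rw [← habs] at happ
  obtain ⟨he1, he2⟩ := abs_le.1 (show |e| ≤ q / 2 by omega)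
  have he1 : -q ≤ 2 * e := by omega
  have he2 : 2 * e ≤ q := by omega
  obtain ⟨a, ha⟩ : ∃ a, a = σ * (p * t₁ - q * s₁) := ⟨_, rfl⟩
  obtain ⟨b, hb⟩ : ∃ b, b = σ * (q * s₀ - p * t₀) := ⟨_, rfl⟩
  have hA : a * M = q * r₁ - t₁ * e := by
    rw [ha, he]; linear_combination (q * σ) * e₁ + q * r₁ * hσ
  have hB : b * M = q * r₀ + t₀ * e := by
    rw [hb, he]; linear_combination (-q * σ) * e₀ + q * r₀ * hσ
  have hq' : q = a * t₀ + b * t₁ := by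
    have : M * q = M * (a * t₀ + b * t₁) := by
      linear_combination (-q) * hdet - t₀ * hA - t₁ * hB
    exact mul_left_cancel₀ hM.ne' this
  have he' : e = b * r₁ - a * r₀ := by
    have : M * e = M * (b * r₁ - a * r₀) := by
      linear_combination (-e) * hdet + r₀ * hA - r₁ * hB
    exact mul_left_cancel₀ hM.ne' this
  by_cases hqt : t₁ ≤ q
  · by_cases ha0 : a = 0
    · -- `(q, p)` is then the multiple `b` of `(t₁, s₁)`
      rw [ha0] at hq' he' ha
      have hps : p * t₁ = q * s₁ := by
        rcases hσ' with h | h <;> rw [h] at ha <;> linarith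
      have ht : t₁ ≠ 0 := by rintro rfl; simp at hq'; omega
      have hbq : b ∣ q := ⟨t₁, by rw [hq']; ring⟩
      have hbp : b ∣ p := ⟨s₁, mul_right_cancel₀ ht (by rw [hps, hq']; ring)⟩
      have hu := hpq.isUnit_of_dvd' hbp hbq
      rcases Int.isUnit_iff.1 hu with h | h
      · rw [hq', h]; ring
      · rw [h] at hq'; omega
    · have h1 : M ≤ q * t₁ := by
        have h2 : |a * M| ≤ q * t₁ := by
          have h3 := mul_nonneg ht₁ (show 0 ≤ q - 2 * e by omega)
          have h4 := mul_nonneg ht₁ (show 0 ≤ q + 2 * e by omega)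
          have h5 := mul_nonneg hq.le (show 0 ≤ t₁ - 2 * r₁ by omega)
          have h6 := mul_nonneg hq.le hr₁
          rw [hA, abs_le]; constructor <;> linarith
        rw [abs_mul, abs_of_pos hM] at h2
        linarith [mul_le_mul_of_nonneg_right (Int.one_le_abs ha0) hM.le]
      have : q ≤ t₁ := by
        by_contra hc
        linarith [mul_lt_mul_of_pos_left (not_le.1 hc) hq, sq q]
      omega
  · exfalso
    push Not at hqt
    have hb0 : b ≠ 0 := by
      rintro rfl
      rw [zero_mul, add_zero] at hq'
      rw [zero_mul, zero_sub] at he'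
      have h1 : 0 < a := by
        by_contra hc
        linarith [mul_nonneg ht₀ (neg_nonneg.2 (not_lt.1 hc))]
      linarith [mul_lt_mul_of_pos_left hact h1]
    have key : r₀ ≤ |e| := by
      rcases lt_or_gt_of_ne hb0 with h | h
      · have h2 := mul_nonneg ht₁ (neg_nonneg.2 h.le)
        have h1 : 0 < a := by
          by_contra hc
          linarith [mul_nonneg ht₀ (neg_nonneg.2 (not_lt.1 hc))]
        have h3 := mul_le_mul_of_nonneg_right (Int.add_one_le_iff.2 h1) hr₀
        have : r₀ ≤ -e := by linarith [mul_nonneg hr₁ (neg_nonneg.2 h.le)]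
        exact this.trans (neg_le_abs e)
      · have h2 := mul_le_mul_of_nonneg_right (Int.add_one_le_iff.2 h) ht₁
        have h1 : a < 0 := by
          by_contra hc
          linarith [mul_nonneg ht₀ (not_lt.1 hc)]
        have h3 := mul_le_mul_of_nonneg_right (Int.add_one_le_iff.2 h1) hr₀
        have : r₀ ≤ e := by linarith [mul_nonneg hr₁ h.le]
        exact this.trans (le_abs_self e)
    have h2 : |b * M| < q * q := by
      have h3 : |b * M| ≤ q * r₀ + t₀ * |e| := by
        rw [hB]
        refine (abs_add_le _ _).trans ?_
        rw [abs_mul t₀, abs_of_nonneg ht₀, abs_of_nonneg (mul_nonneg hq.le hr₀)]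
      have h4 := mul_le_mul_of_nonneg_left (key.trans (show |e| ≤ q / 2 by omega)) hq.le
      have h5 := mul_le_mul_of_nonneg_left happ ht₀
      have h6 : t₀ * q < q * q := mul_lt_mul_of_pos_right (by omega) hq
      have h7 : 2 * (q * (q / 2)) ≤ q * q := by
        have := mul_le_mul_of_nonneg_left (show 2 * (q / 2) ≤ q by omega) hq.le
        linarith
      linarith
    rw [abs_mul, abs_of_pos hM] at h2
    have := mul_le_mul_of_nonneg_right (Int.one_le_abs hb0) hM.le
    linarith [sq q]

theorem t₁_iterate_of_approx {M y q p k : ℕ} (hM : 0 < M) (hy : y < 2 ^ k) (hq : 0 < q)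
    (hqM : q ^ 2 ≤ M) (hpq : Nat.Coprime p q) (happ : 2 * |(q : ℤ) * y - p * M| ≤ q) :
    (next^[2 * k] ⟨M, y, 0, 1⟩).t₁ = q := by
  have inv : ∀ j, ∃ s₀ s₁ σ : ℤ, σ * σ = 1 ∧
      ((next^[j] ⟨M, y, 0, 1⟩).t₀ * y - s₀ * M = -(σ * (next^[j] ⟨M, y, 0, 1⟩).r₀)) ∧
      ((next^[j] ⟨M, y, 0, 1⟩).t₁ * y - s₁ * M = σ * (next^[j] ⟨M, y, 0, 1⟩).r₁) ∧
      ((next^[j] ⟨M, y, 0, 1⟩).r₀ * (next^[j] ⟨M, y, 0, 1⟩).t₁ +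
        (next^[j] ⟨M, y, 0, 1⟩).r₁ * (next^[j] ⟨M, y, 0, 1⟩).t₀ = (M : ℤ)) ∧
      (next^[j] ⟨M, y, 0, 1⟩).t₀ < 2 * (next^[j] ⟨M, y, 0, 1⟩).r₀ := by
    intro j
    induction j with
    | zero => exact ⟨1, 0, 1, by simp [hM]⟩
    | succ j ih =>
      rw [Function.iterate_succ_apply']
      generalize next^[j] ⟨M, y, 0, 1⟩ = S at *
      obtain ⟨s₀, s₁, σ, h1, h2, h3, h4, h5⟩ := ih
      by_cases hS : S.Active
      · rw [next, if_pos hS]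
        have hd : (S.r₁ : ℤ) * (S.r₀ / S.r₁ : ℕ) + (S.r₀ % S.r₁ : ℕ) = S.r₀ := by
          exact_mod_cast Nat.div_add_mod _ _
        generalize S.r₀ / S.r₁ = c at *
        generalize S.r₀ % S.r₁ = r at *
        refine ⟨s₁, s₀ + c * s₁, -σ, by linarith, ?_, ?_, ?_, hS⟩
        · push_cast; linarith
        · push_cast
          linear_combination h2 + c * h3 + σ * hd
        · push_cast
          linear_combination h4 + S.t₁ * hd
      · rw [next_of_not_active hS]
        exact ⟨s₀, s₁, σ, h1, h2, h3, h4, h5⟩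
  obtain ⟨s₀, s₁, σ, h1, h2, h3, h4, h5⟩ := inv (2 * k)
  have hhalt := not_active_iterate k ⟨M, y, 0, 1⟩ hy
  simp only [Active, not_lt] at hhalt
  have := t₁_eq_of_approx (q := q) (p := p) h1 (by positivity) (by positivity) (by positivity)
    (by positivity) h2 h3 h4 (by exact_mod_cast hM) (by exact_mod_cast h5)
    (by exact_mod_cast hhalt) (by exact_mod_cast hq) (by exact_mod_cast hqM)
    (Nat.isCoprime_iff_coprime.2 hpq) happ
  exact_mod_cast this

/-- With the initial cofactor `q₂` the algorithm computes the least common multiple. The factor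
`2 ^ m` of the remainders makes the states active until the remainder vanishes. -/
theorem t₁_iterate_eq_lcm {m q₁ q₂ k : ℕ} (hq₁ : 0 < q₁) (h : q₁ * q₂ ≤ 2 ^ m)
    (hk : q₂ * 2 ^ m < 2 ^ k) :
    (next^[2 * k] ⟨q₁ * 2 ^ m, q₂ * 2 ^ m, 0, q₂⟩).t₁ = Nat.lcm q₁ q₂ := by
  have inv : ∀ j, ∃ a b : ℕ, (next^[j] ⟨q₁ * 2 ^ m, q₂ * 2 ^ m, 0, q₂⟩).r₀ = a * 2 ^ m ∧
      (next^[j] ⟨q₁ * 2 ^ m, q₂ * 2 ^ m, 0, q₂⟩).r₁ = b * 2 ^ m ∧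
      Nat.gcd a b = Nat.gcd q₁ q₂ ∧ 0 < a ∧
      a * (next^[j] ⟨q₁ * 2 ^ m, q₂ * 2 ^ m, 0, q₂⟩).t₁ +
        b * (next^[j] ⟨q₁ * 2 ^ m, q₂ * 2 ^ m, 0, q₂⟩).t₀ = q₁ * q₂ := by
    intro j
    induction j with
    | zero => exact ⟨q₁, q₂, rfl, rfl, rfl, hq₁, by simp⟩
    | succ j ih =>
      rw [Function.iterate_succ_apply']
      generalize next^[j] ⟨q₁ * 2 ^ m, q₂ * 2 ^ m, 0, q₂⟩ = S at *
      obtain ⟨a, b, h1, h2, h3, h4, h5⟩ := ih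
      by_cases hS : S.Active
      · rw [next, if_pos hS]
        have hb : 0 < b := by
          rcases Nat.eq_zero_or_pos b with rfl | hb
          · simp [Active, h2] at hS
          · exact hb
        refine ⟨b, a % b, h2, ?_, ?_, hb, ?_⟩
        · simp only [h1, h2]
          rw [Nat.mul_mod_mul_right]
        · rw [← h3, Nat.gcd_comm a b, Nat.gcd_comm b (a % b)]
          exact (Nat.gcd_rec b a).symm
        · simp only [h1, h2]
          rw [Nat.mul_div_mul_right _ _ (by positivity), ← h5]
          conv_rhs => rw [← Nat.div_add_mod a b]
          ring
      · rw [next_of_not_active hS]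
        exact ⟨a, b, h1, h2, h3, h4, h5⟩
  obtain ⟨a, b, h1, h2, h3, h4, h5⟩ := inv (2 * k)
  have hhalt := not_active_iterate k ⟨q₁ * 2 ^ m, q₂ * 2 ^ m, 0, q₂⟩ hk
  simp only [Active, not_lt] at hhalt
  generalize next^[2 * k] ⟨q₁ * 2 ^ m, q₂ * 2 ^ m, 0, q₂⟩ = S at *
  have hb : b = 0 := by
    by_contra hb
    have e1 : 1 * 2 ^ m ≤ b * 2 ^ m := Nat.mul_le_mul_right _ (Nat.one_le_iff_ne_zero.2 hb)
    have e2 : 1 * S.t₁ ≤ a * S.t₁ := Nat.mul_le_mul_right _ h4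
    have : 0 < 2 ^ m := by positivity
    rw [h2] at hhalt
    omega
  subst hb
  rw [Nat.gcd_zero_right] at h3
  rw [zero_mul, add_zero] at h5
  rw [Nat.lcm, ← h5, h3, Nat.mul_div_cancel_left _ (h3 ▸ h4)]

/-! ### Division by conditional subtractions -/

/-- One step of the schoolbook division in base two. -/
def sub (i : ℕ) (S : EuclidState) : EuclidState :=
  if S.Active ∧ S.r₁ * 2 ^ i ≤ S.r₀ then
    ⟨S.r₀ - S.r₁ * 2 ^ i, S.r₁, S.t₀ + S.t₁ * 2 ^ i, S.t₁⟩ else S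

/-- Exchange the two remainders and the two cofactors of an active state. -/
def swap (S : EuclidState) : EuclidState := if S.Active then ⟨S.r₁, S.r₀, S.t₁, S.t₀⟩ else S

/-- One block of the computation: the step of the division for the shift `i`, and the exchange
after the last step `i = 0`. -/
def block (i : ℕ) (S : EuclidState) : EuclidState := if i = 0 then (S.sub i).swap else S.sub i

/-- The state after `b` blocks, whose shifts run cyclically through `W - 1, …, 0`. -/
def blocks (W : ℕ) (S : EuclidState) : ℕ → EuclidState
  | 0 => S
  | b + 1 => (blocks W S b).block (W - 1 - b % W)

theorem sub_active (i : ℕ) (S : EuclidState) : (S.sub i).Active ↔ S.Active := by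
  unfold sub; split_ifs <;> rfl

theorem sub_of_not_active {S : EuclidState} (h : ¬ S.Active) (i : ℕ) : S.sub i = S :=
  if_neg fun h' => h h'.1

/-- One step of the division, on the state that the steps with larger shifts leave behind. -/
theorem sub_mod_div {S : EuclidState} (hS : S.Active) (i : ℕ) :
    sub i ⟨S.r₀ % (S.r₁ * 2 ^ (i + 1)), S.r₁,
        S.t₀ + S.r₀ / (S.r₁ * 2 ^ (i + 1)) * 2 ^ (i + 1) * S.t₁, S.t₁⟩ =
      ⟨S.r₀ % (S.r₁ * 2 ^ i), S.r₁, S.t₀ + S.r₀ / (S.r₁ * 2 ^ i) * 2 ^ i * S.t₁, S.t₁⟩ := by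
  have hr : 0 < S.r₁ := by unfold Active at hS; omega
  have hact : Active ⟨S.r₀ % (S.r₁ * 2 ^ (i + 1)), S.r₁,
        S.t₀ + S.r₀ / (S.r₁ * 2 ^ (i + 1)) * 2 ^ (i + 1) * S.t₁, S.t₁⟩ := hS
  rw [sub]
  simp only [hact, true_and]
  have e : S.r₁ * 2 ^ (i + 1) = S.r₁ * 2 ^ i * 2 := by ring
  rw [e, pow_succ]
  have hR : 0 < S.r₁ * 2 ^ i := by positivity
  generalize hRR : S.r₁ * 2 ^ i = R at *
  have h1 : S.r₀ / (R * 2) = S.r₀ / R / 2 := (Nat.div_div_eq_div_mul _ _ _).symm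
  have h2 : S.r₀ % (R * 2) = S.r₀ % R + R * (S.r₀ / R % 2) := Nat.mod_mul
  have h3 := Nat.mod_lt S.r₀ hR
  rw [h1, h2]
  generalize S.r₀ / R = c at *
  have h4 := Nat.div_add_mod c 2
  rcases Nat.mod_two_eq_zero_or_one c with h | h
  · rw [h, if_neg (by omega)]
    rw [h] at h4
    congr 2
    conv_rhs => rw [← h4]
    ring
  · rw [h, if_pos (by omega)]
    rw [h] at h4
    congr 1
    · omega
    · conv_rhs => rw [← h4]
      ring

theorem blocks_add_mul (W h : ℕ) (S : EuclidState) (b : ℕ) :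
    blocks W S (W * h + b) = blocks W (blocks W S (W * h)) b := by
  induction b with
  | zero => rfl
  | succ b ih => rw [← add_assoc, blocks, ih, blocks, Nat.mul_add_mod]

/-- `W` blocks perform one division with remainder. -/
theorem blocks_self {W : ℕ} (hW : 0 < W) {S : EuclidState} (hr : S.r₀ < 2 ^ W) :
    blocks W S W = S.next := by
  have shift : ∀ b < W, W - 1 - b % W = W - 1 - b := fun b hb => by rw [Nat.mod_eq_of_lt hb]
  by_cases hS : S.Active
  · have key : ∀ b < W, blocks W S b = ⟨S.r₀ % (S.r₁ * 2 ^ (W - b)), S.r₁,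
        S.t₀ + S.r₀ / (S.r₁ * 2 ^ (W - b)) * 2 ^ (W - b) * S.t₁, S.t₁⟩ := by
      intro b
      induction b with
      | zero =>
        intro _
        have h1 : 0 < S.r₁ := by unfold Active at hS; omega
        have h2 : S.r₀ < S.r₁ * 2 ^ W := by nlinarith
        simp [blocks, Nat.mod_eq_of_lt h2, Nat.div_eq_of_lt h2]
      | succ b ih =>
        intro hb
        rw [blocks, ih (by omega), shift b (by omega), block, if_neg (by omega),
          show W - b = W - 1 - b + 1 by omega, sub_mod_div hS,
          show W - 1 - b = W - (b + 1) by omega]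
    obtain ⟨V, rfl⟩ : ∃ V, W = V + 1 := ⟨W - 1, by omega⟩
    rw [blocks, key V (by omega), shift V (by omega), show V + 1 - 1 - V = 0 by omega,
      show V + 1 - V = 0 + 1 by omega, block, if_pos rfl, sub_mod_div hS, swap, if_pos, next,
      if_pos hS]
    · simp
    · exact hS
  · have key : ∀ b, blocks W S b = S := by
      intro b
      induction b with
      | zero => rfl
      | succ b ih =>
        rw [blocks, ih, block, sub_of_not_active hS, swap, if_neg hS, ite_self]
    rw [key, next_of_not_active hS]

/-- The size of the numbers of a state: they are below `2 ^ W`, and so is the invariant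
`r₀ t₁ + r₁ t₀`. -/
structure Bounded (W : ℕ) (S : EuclidState) : Prop where
  r₀_lt : S.r₀ < 2 ^ W
  r₁_lt : S.r₁ < 2 ^ W
  t₀_lt : S.t₀ < 2 ^ W
  t₁_lt : S.t₁ < 2 ^ W
  det_lt : S.r₀ * S.t₁ + S.r₁ * S.t₀ < 2 ^ W

theorem Bounded.sub {W : ℕ} {S : EuclidState} (h : S.Bounded W) (i : ℕ) :
    (S.sub i).Bounded W := by
  rw [EuclidState.sub]
  split_ifs with hc
  · have hd : (S.r₀ - S.r₁ * 2 ^ i) * S.t₁ + S.r₁ * (S.t₀ + S.t₁ * 2 ^ i) =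
        S.r₀ * S.t₁ + S.r₁ * S.t₀ := by
      obtain ⟨x, hx⟩ := Nat.exists_eq_add_of_le hc.2
      rw [hx, Nat.add_sub_cancel_left]; ring
    refine ⟨(Nat.sub_le _ _).trans_lt h.r₀_lt, h.r₁_lt, ?_, h.t₁_lt, hd ▸ h.det_lt⟩
    have hr : 1 ≤ S.r₁ := by have := hc.1; unfold Active at this; omega
    have h1 := h.det_lt
    rw [← hd] at h1
    have h2 := Nat.mul_le_mul_right (S.t₀ + S.t₁ * 2 ^ i) hr
    change S.t₀ + S.t₁ * 2 ^ i < 2 ^ W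
    omega
  · exact h

theorem Bounded.block {W : ℕ} {S : EuclidState} (h : S.Bounded W) (i : ℕ) :
    (S.block i).Bounded W := by
  rw [EuclidState.block]
  split_ifs
  · have h' := h.sub i
    rw [swap]
    split_ifs
    · exact ⟨h'.r₁_lt, h'.r₀_lt, h'.t₁_lt, h'.t₀_lt, by
        have := h'.det_lt; rwa [add_comm] at this⟩
    · exact h'
  · exact h.sub i

theorem Bounded.blocks {W : ℕ} {S : EuclidState} (h : S.Bounded W) (b : ℕ) :
    (blocks W S b).Bounded W := by
  induction b with
  | zero => exact h
  | succ b ih => exact ih.block _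

theorem blocks_mul {W : ℕ} (hW : 0 < W) {S : EuclidState} (hS : S.Bounded W) (h : ℕ) :
    blocks W S (W * h) = next^[h] S := by
  induction h with
  | zero => rfl
  | succ h ih =>
    rw [Function.iterate_succ_apply', ← ih, ← blocks_self hW (hS.blocks _).r₀_lt,
      ← blocks_add_mul, mul_add, mul_one]

end EuclidState

/-! ### Arithmetic with rows of bits -/

/-- The number with the binary digits `f 0, …, f (V - 1)`. -/
def bitVal (f : ℕ → Bool) (V : ℕ) : ℕ := ∑ p ∈ Finset.range V, (f p).toNat * 2 ^ p

theorem bitVal_succ (f : ℕ → Bool) (V : ℕ) :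
    bitVal f (V + 1) = bitVal f V + (f V).toNat * 2 ^ V := Finset.sum_range_succ _ _

theorem bitVal_congr {f g : ℕ → Bool} {V : ℕ} (h : ∀ p < V, f p = g p) :
    bitVal f V = bitVal g V :=
  Finset.sum_congr rfl fun p hp => by rw [h p (Finset.mem_range.1 hp)]

theorem bitVal_lt (f : ℕ → Bool) (V : ℕ) : bitVal f V < 2 ^ V := by
  induction V with
  | zero => simp [bitVal]
  | succ V ih =>
    have h := Bool.toNat_le (f V)
    rw [bitVal_succ, pow_succ]
    nlinarith

theorem bitVal_testBit (x V : ℕ) : bitVal x.testBit V = x % 2 ^ V := by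
  induction V with
  | zero => simp [bitVal, Nat.mod_one]
  | succ V ih =>
    rw [bitVal_succ, ih, pow_succ, Nat.mod_mul, Nat.toNat_testBit]
    ring

theorem testBit_bitVal (f : ℕ → Bool) {V p : ℕ} (hp : p < V) :
    (bitVal f V).testBit p = f p := by
  induction V with
  | zero => omega
  | succ V ih =>
    rw [bitVal_succ, add_comm, mul_comm, Nat.testBit_two_pow_mul_add _ (bitVal_lt f V)]
    split_ifs with h
    · exact ih h
    · obtain rfl : p = V := by omega
      cases f p <;> simp

theorem bitVal_false (V : ℕ) : bitVal (fun _ => false) V = 0 := by simp [bitVal]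

theorem bitVal_not (f : ℕ → Bool) (V : ℕ) :
    bitVal (fun p => !f p) V + bitVal f V + 1 = 2 ^ V := by
  induction V with
  | zero => simp [bitVal]
  | succ V ih =>
    rw [bitVal_succ, bitVal_succ, pow_succ]
    cases f V <;> simp <;> omega

theorem bitVal_and (c : Bool) (f : ℕ → Bool) (V : ℕ) :
    bitVal (fun p => c && f p) V = if c then bitVal f V else 0 := by
  cases c <;> simp [bitVal_false]

/-- The row `f`, moved up by `i` positions. -/
def shiftUp (i : ℕ) (f : ℕ → Bool) (p : ℕ) : Bool := if p < i then false else f (p - i)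

theorem bitVal_shiftUp (i : ℕ) (f : ℕ → Bool) (V : ℕ) :
    bitVal (shiftUp i f) V = bitVal f V * 2 ^ i % 2 ^ V := by
  rw [← bitVal_testBit]
  refine bitVal_congr fun p hp => ?_
  rw [Nat.testBit_mul_two_pow, shiftUp]
  split_ifs with h
  · simp [h]
  · rw [testBit_bitVal f (by omega)]
    simp [not_lt.1 h]

theorem bitVal_shiftUp_of_lt {i V : ℕ} {f : ℕ → Bool} (h : bitVal f V * 2 ^ i < 2 ^ V) :
    bitVal (shiftUp i f) V = bitVal f V * 2 ^ i := by
  rw [bitVal_shiftUp, Nat.mod_eq_of_lt h]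

/-- The carry bits `c` of the ripple-carry addition of `f` and `g`. -/
def IsCarry (V : ℕ) (f g c : ℕ → Bool) : Prop :=
  ∀ p < V, c p = xor (f p && g p) (xor (f p) (g p) && shiftUp 1 c p)

theorem IsCarry.bitVal_add {V : ℕ} {f g c : ℕ → Bool} (h : IsCarry V f g c) (j : ℕ) (hj : j ≤ V) :
    bitVal (fun p => xor (xor (f p) (g p)) (shiftUp 1 c p)) j +
      (shiftUp 1 c j).toNat * 2 ^ j = bitVal f j + bitVal g j := by
  induction j with
  | zero => simp [bitVal, shiftUp]
  | succ j ih =>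
    have ih := ih (by omega)
    have e : shiftUp 1 c (j + 1) = c j := by simp [shiftUp]
    rw [bitVal_succ, bitVal_succ, bitVal_succ, e, h j (by omega), pow_succ]
    have hb : ∀ x y z : Bool, (xor (xor x y) z).toNat +
        (xor (x && y) (xor x y && z)).toNat * 2 = x.toNat + y.toNat + z.toNat := by decide
    have := congrArg (· * 2 ^ j) (hb (f j) (g j) (shiftUp 1 c j))
    simp only [add_mul] at this
    linarith

/-- The last carry decides whether the sum overflows. -/
theorem IsCarry.last {V : ℕ} (hV : 0 < V) {f g c : ℕ → Bool} (h : IsCarry V f g c) :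
    c (V - 1) = true ↔ 2 ^ V ≤ bitVal f V + bitVal g V := by
  have h1 := h.bitVal_add V le_rfl
  have h2 := bitVal_lt (fun p => xor (xor (f p) (g p)) (shiftUp 1 c p)) V
  have e : shiftUp 1 c V = c (V - 1) := by simp [shiftUp]; omega
  rw [e] at h1
  cases hc : c (V - 1) <;> rw [hc] at h1
  · simp only [Bool.toNat_false, zero_mul, add_zero] at h1
    simpa [← h1] using h2
  · simp only [Bool.toNat_true, one_mul] at h1
    simp [← h1]

theorem IsCarry.bitVal_sum {V : ℕ} (hV : 0 < V) {f g c : ℕ → Bool} (h : IsCarry V f g c)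
    (hlt : bitVal f V + bitVal g V < 2 ^ V) :
    bitVal (fun p => xor (xor (f p) (g p)) (shiftUp 1 c p)) V = bitVal f V + bitVal g V := by
  have h1 := h.bitVal_add V le_rfl
  have e : shiftUp 1 c V = c (V - 1) := by simp [shiftUp]; omega
  have h2 := h.last hV
  rw [e] at h1
  cases hc : c (V - 1)
  · rw [hc] at h1; simpa using h1
  · rw [hc] at h2; simp at h2; omega

/-- Comparison: the last carry of `¬ f + g` tells whether `f < g`. -/
theorem IsCarry.last_not {V : ℕ} (hV : 0 < V) {f g c : ℕ → Bool}
    (h : IsCarry V (fun p => !f p) g c) : c (V - 1) = true ↔ bitVal f V < bitVal g V := by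
  have := bitVal_not f V
  rw [h.last hV]; omega

/-- Subtraction: `f - g` is the complement of `¬ f + g`. -/
theorem IsCarry.bitVal_diff {V : ℕ} (hV : 0 < V) {f g c : ℕ → Bool}
    (h : IsCarry V (fun p => !f p) g c) (hle : bitVal g V ≤ bitVal f V) :
    bitVal (fun p => !xor (xor (!f p) (g p)) (shiftUp 1 c p)) V = bitVal f V - bitVal g V := by
  have h1 := bitVal_not f V
  have h2 := h.bitVal_sum hV (by omega)
  have h3 := bitVal_not (fun p => xor (xor (!f p) (g p)) (shiftUp 1 c p)) V
  omega

/-- The local equations between the bits `row k p` of one block of the computation and the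
bits of the state `r₀`, `r₁`, `t₀`, `t₁` before it: rows `0` to `3` compare `t₁` with `2 r₁`, rows
`4` to `11` compare and subtract, rows `12` to `16` add, and rows `17` to `23` exchange. -/
structure BlockEqns (V i : ℕ) (r₀ r₁ t₀ t₁ : ℕ → Bool) (row : ℕ → ℕ → Bool) : Prop where
  e0 : ∀ p < V, row 0 p = !t₁ p
  e1 : ∀ p < V, row 1 p = (row 0 p && shiftUp 1 r₁ p)
  e2 : ∀ p < V, row 2 p = xor (row 0 p) (shiftUp 1 r₁ p)
  e3 : ∀ p < V, row 3 p = xor (row 1 p) (row 2 p && shiftUp 1 (row 3) p)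
  e4 : ∀ p < V, row 4 p = !r₀ p
  e5 : ∀ p < V, row 5 p = (row 4 p && shiftUp i r₁ p)
  e6 : ∀ p < V, row 6 p = xor (row 4 p) (shiftUp i r₁ p)
  e7 : ∀ p < V, row 7 p = xor (row 5 p) (row 6 p && shiftUp 1 (row 7) p)
  e8 : ∀ p < V, row 8 p = xor (row 6 p) (shiftUp 1 (row 7) p)
  e9 : ∀ p < V, row 9 p = xor (row 3 (V - 1)) (row 3 (V - 1) && row 7 (V - 1))
  e10 : ∀ p < V, row 10 p = xor (row 4 p) (row 8 p)
  e11 : ∀ p < V, row 11 p = xor (r₀ p) (row 9 p && row 10 p)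
  e12 : ∀ p < V, row 12 p = (row 9 p && shiftUp i t₁ p)
  e13 : ∀ p < V, row 13 p = (t₀ p && row 12 p)
  e14 : ∀ p < V, row 14 p = xor (t₀ p) (row 12 p)
  e15 : ∀ p < V, row 15 p = xor (row 13 p) (row 14 p && shiftUp 1 (row 15) p)
  e16 : ∀ p < V, row 16 p = xor (row 14 p) (shiftUp 1 (row 15) p)
  e17 : ∀ p < V, row 17 p = (row 3 (V - 1) && decide (i = 0))
  e18 : ∀ p < V, row 18 p = xor (row 11 p) (r₁ p)
  e19 : ∀ p < V, row 19 p = xor (row 16 p) (t₁ p)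
  e20 : ∀ p < V, row 20 p = xor (row 11 p) (row 17 p && row 18 p)
  e21 : ∀ p < V, row 21 p = xor (r₁ p) (row 17 p && row 18 p)
  e22 : ∀ p < V, row 22 p = xor (row 16 p) (row 17 p && row 19 p)
  e23 : ∀ p < V, row 23 p = xor (t₁ p) (row 17 p && row 19 p)

/-- The state that four rows of bits encode. -/
def stateVal (V : ℕ) (r₀ r₁ t₀ t₁ : ℕ → Bool) : EuclidState :=
  ⟨bitVal r₀ V, bitVal r₁ V, bitVal t₀ V, bitVal t₁ V⟩

/-- A block of bits that satisfies the local equations performs one block of the division. -/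
theorem BlockEqns.stateVal_eq {V i : ℕ} {r₀ r₁ t₀ t₁ : ℕ → Bool} {row : ℕ → ℕ → Bool}
    (h : BlockEqns V i r₀ r₁ t₀ t₁ row) (hV : 0 < V)
    (h1 : bitVal r₁ V * 2 < 2 ^ V) (h2 : bitVal r₁ V * 2 ^ i < 2 ^ V)
    (h3 : bitVal t₁ V * 2 ^ i < 2 ^ V) (h4 : bitVal t₀ V + bitVal t₁ V * 2 ^ i < 2 ^ V) :
    stateVal V (row 20) (row 21) (row 22) (row 23) =
      EuclidState.block i (stateVal V r₀ r₁ t₀ t₁) := by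
  have c3 : IsCarry V (fun p => !t₁ p) (shiftUp 1 r₁) (row 3) := fun p hp => by
    rw [h.e3 p hp, h.e1 p hp, h.e2 p hp, h.e0 p hp]
  have c7 : IsCarry V (fun p => !r₀ p) (shiftUp i r₁) (row 7) := fun p hp => by
    rw [h.e7 p hp, h.e5 p hp, h.e6 p hp, h.e4 p hp]
  have c15 : IsCarry V t₀ (row 12) (row 15) := fun p hp => by
    rw [h.e15 p hp, h.e13 p hp, h.e14 p hp]
  have g3 : row 3 (V - 1) = true ↔ (stateVal V r₀ r₁ t₀ t₁).Active := by
    rw [c3.last_not hV, bitVal_shiftUp_of_lt (by simpa using h1)]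
    simp [EuclidState.Active, stateVal, mul_comm]
  have g7 : row 7 (V - 1) = true ↔ bitVal r₀ V < bitVal r₁ V * 2 ^ i := by
    rw [c7.last_not hV, bitVal_shiftUp_of_lt h2]
  obtain ⟨c, hc⟩ : ∃ c, c = xor (row 3 (V - 1)) (row 3 (V - 1) && row 7 (V - 1)) := ⟨_, rfl⟩
  have gc : c = true ↔ (stateVal V r₀ r₁ t₀ t₁).Active ∧
      (stateVal V r₀ r₁ t₀ t₁).r₁ * 2 ^ i ≤ (stateVal V r₀ r₁ t₀ t₁).r₀ := by
    change _ ↔ _ ∧ bitVal r₁ V * 2 ^ i ≤ bitVal r₀ V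
    rw [← g3, ← not_lt, ← g7, hc]
    cases row 3 (V - 1) <;> cases row 7 (V - 1) <;> simp
  have v11 : bitVal (row 11) V =
      if c then bitVal r₀ V - bitVal r₁ V * 2 ^ i else bitVal r₀ V := by
    split_ifs with hcc
    · rw [← bitVal_shiftUp_of_lt h2,
        ← c7.bitVal_diff hV (by rw [bitVal_shiftUp_of_lt h2]; exact (gc.1 hcc).2)]
      refine bitVal_congr fun p hp => ?_
      rw [h.e11 p hp, h.e9 p hp, ← hc, hcc, h.e10 p hp, h.e8 p hp, h.e6 p hp, h.e4 p hp]
      cases r₀ p <;> simp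
    · refine bitVal_congr fun p hp => ?_
      rw [h.e11 p hp, h.e9 p hp, ← hc]
      simp [hcc]
  have v12 : bitVal (row 12) V = if c then bitVal t₁ V * 2 ^ i else 0 := by
    rw [← bitVal_shiftUp_of_lt h3, ← bitVal_and]
    exact bitVal_congr fun p hp => by rw [h.e12 p hp, h.e9 p hp, hc]
  have v16 : bitVal (row 16) V =
      if c then bitVal t₀ V + bitVal t₁ V * 2 ^ i else bitVal t₀ V := by
    have := c15.bitVal_sum hV (by rw [v12]; split_ifs <;> omega)
    rw [v12] at this
    rw [bitVal_congr (g := fun p => xor (xor (t₀ p) (row 12 p)) (shiftUp 1 (row 15) p))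
      (fun p hp => by rw [h.e16 p hp, h.e14 p hp]), this]
    split_ifs <;> simp
  have hsub : stateVal V (row 11) r₁ (row 16) t₁ =
      EuclidState.sub i (stateVal V r₀ r₁ t₀ t₁) := by
    rw [EuclidState.sub]
    by_cases hcc : c = true
    · rw [if_pos (gc.1 hcc)]
      simp [stateVal, v11, v16, hcc]
    · rw [if_neg (fun h' => hcc (gc.2 h'))]
      simp [stateVal, v11, v16, hcc]
  have g3' : row 3 (V - 1) = true ↔ (stateVal V (row 11) r₁ (row 16) t₁).Active := by
    rw [hsub, EuclidState.sub_active, g3]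
  rw [EuclidState.block, ← hsub, EuclidState.swap]
  by_cases hi : i = 0 ∧ row 3 (V - 1) = true
  · rw [if_pos hi.1, if_pos (g3'.1 hi.2)]
    have e17 : ∀ p < V, row 17 p = true := fun p hp => by simp [h.e17 p hp, hi.1, hi.2]
    simp only [stateVal, EuclidState.mk.injEq]
    refine ⟨bitVal_congr fun p hp => ?_, bitVal_congr fun p hp => ?_,
      bitVal_congr fun p hp => ?_, bitVal_congr fun p hp => ?_⟩
    · rw [h.e20 p hp, e17 p hp, h.e18 p hp]; simp
    · rw [h.e21 p hp, e17 p hp, h.e18 p hp]; cases r₁ p <;> simp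
    · rw [h.e22 p hp, e17 p hp, h.e19 p hp]; simp
    · rw [h.e23 p hp, e17 p hp, h.e19 p hp]; cases t₁ p <;> simp
  · have e17 : ∀ p < V, row 17 p = false := fun p hp => by
      rw [h.e17 p hp]; rw [not_and] at hi
      by_cases h0 : i = 0
      · simp [hi h0]
      · simp [h0]
    have : ∀ S : EuclidState, (if i = 0 then
        if (stateVal V (row 11) r₁ (row 16) t₁).Active then S
        else stateVal V (row 11) r₁ (row 16) t₁
        else stateVal V (row 11) r₁ (row 16) t₁) = stateVal V (row 11) r₁ (row 16) t₁ := by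
      intro S
      split_ifs with h5 h6
      · exact absurd ⟨h5, g3'.2 h6⟩ hi
      · rfl
      · rfl
    rw [this]
    simp only [stateVal, EuclidState.mk.injEq]
    refine ⟨bitVal_congr fun p hp => ?_, bitVal_congr fun p hp => ?_,
      bitVal_congr fun p hp => ?_, bitVal_congr fun p hp => ?_⟩
    · rw [h.e20 p hp, e17 p hp]; simp
    · rw [h.e21 p hp, e17 p hp]; simp
    · rw [h.e22 p hp, e17 p hp]; simp
    · rw [h.e23 p hp, e17 p hp]; simp

/-! ### Circuits over numbered qubits -/

section Wires

variable {m n a : ℕ}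

/-- The qubit with a given number, the inverse of `QGate.wireCode`. -/
def toWire (m n a : ℕ) : ℕ × ℕ → Option (CircuitWire m n a)
  | (0, i) => if h : i < m then some (Sum.inl (Sum.inl ⟨i, h⟩)) else none
  | (1, i) => if h : i < n then some (Sum.inl (Sum.inr (Sum.inl ⟨i, h⟩))) else none
  | (2, i) => if h : i < n then some (Sum.inl (Sum.inr (Sum.inr ⟨i, h⟩))) else none
  | (3, i) => if h : i < a then some (Sum.inr ⟨i, h⟩) else none
  | _ => none

theorem toWire_wireCode (q : CircuitWire m n a) : toWire m n a (QGate.wireCode q) = some q := by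
  rcases q with (i | i | i) | i <;> simp [QGate.wireCode, toWire]

theorem wireCode_of_toWire {w : ℕ × ℕ} {q : CircuitWire m n a} (h : toWire m n a w = some q) :
    QGate.wireCode q = w := by
  unfold toWire at h
  split at h
  all_goals first
    | (split at h <;> simp at h; subst h; rfl)
    | simp at h

theorem wireCode_injective : Function.Injective (QGate.wireCode : CircuitWire m n a → ℕ × ℕ) :=
  fun p q h => Option.some_injective _ (by rw [← toWire_wireCode p, h, toWire_wireCode])

/-- `w` is the number of a qubit: the registers are numbered `0`, `1`, `2`, and the work qubits
form the register `3`. -/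
def IsWire (m n a : ℕ) (w : ℕ × ℕ) : Prop :=
  w.2 < [m, n, n, a].getD w.1 0

instance (m n a : ℕ) (w : ℕ × ℕ) : Decidable (IsWire m n a w) :=
  inferInstanceAs (Decidable (_ < _))

theorem isWire_iff {w : ℕ × ℕ} : IsWire m n a w ↔ ∃ q, toWire m n a w = some q := by
  obtain ⟨r, i⟩ := w
  rcases r with _ | _ | _ | _ | r <;> simp [IsWire, toWire]

/-- The value of the qubit with number `w` in a basis state, `false` if there is no such qubit. -/
def readWire (x : CircuitWire m n a → Bool) (w : ℕ × ℕ) : Bool :=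
  ((toWire m n a w).map x).getD false

theorem readWire_wireCode (x : CircuitWire m n a → Bool) (q : CircuitWire m n a) :
    readWire x (QGate.wireCode q) = x q := by simp [readWire, toWire_wireCode]

theorem readWire_of_toWire (x : CircuitWire m n a → Bool) {w : ℕ × ℕ} {q : CircuitWire m n a}
    (h : toWire m n a w = some q) : readWire x w = x q := by simp [readWire, h]

theorem readWire_of_not_isWire (x : CircuitWire m n a → Bool) {w : ℕ × ℕ}
    (h : ¬ IsWire m n a w) : readWire x w = false := by
  rw [isWire_iff] at h
  cases hq : toWire m n a w with
  | none => simp [readWire, hq]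
  | some q => exact absurd ⟨q, hq⟩ h

theorem readWire_injective :
    Function.Injective (readWire : (CircuitWire m n a → Bool) → ℕ × ℕ → Bool) := by
  intro x y h
  funext q
  rw [← readWire_wireCode x, h, readWire_wireCode]

theorem readWire_update {w : ℕ × ℕ} {q : CircuitWire m n a} (h : toWire m n a w = some q)
    (x : CircuitWire m n a → Bool) (b : Bool) :
    readWire (Function.update x q b) = Function.update (readWire x) w b := by
  funext w'
  by_cases hw : w' = w
  · subst hw; simp [readWire_of_toWire _ h]
  · rw [Function.update_of_ne hw]
    cases hq : toWire m n a w' with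
    | none => simp [readWire, hq]
    | some q' =>
      have : q' ≠ q := by
        rintro rfl; exact hw (by rw [← wireCode_of_toWire hq, wireCode_of_toWire h])
      rw [readWire_of_toWire _ hq, readWire_of_toWire _ hq, Function.update_of_ne this]

end Wires

namespace QCircuit

variable {m n a : ℕ}

/-- The action of a circuit on state vectors. -/
noncomputable def applyTo (C : QCircuit m n a)
    (U : Matrix (OracleWire m n → Bool) (OracleWire m n → Bool) ℂ) (ψ : QState m n a) :
    QState m n a :=
  C.foldl (fun ψ g => g.apply U ψ) ψ

variable (U : Matrix (OracleWire m n → Bool) (OracleWire m n → Bool) ℂ)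

theorem applyTo_append (C D : QCircuit m n a) (ψ : QState m n a) :
    applyTo (C ++ D) U ψ = applyTo D U (applyTo C U ψ) := List.foldl_append

/-- A Hadamard gate on the qubit with number `w`; no gate if there is no such qubit. -/
def hGate (m n a : ℕ) (w : ℕ × ℕ) : QCircuit m n a :=
  ((toWire m n a w).map QGate.hadamard).toList

/-- A phase gate on the qubit with number `w`; no gate if there is no such qubit. -/
def phaseGate (m n a : ℕ) (j : ℕ) (w : ℕ × ℕ) : QCircuit m n a :=
  ((toWire m n a w).map (QGate.phase j)).toList

/-- An inverse phase gate on the qubit with number `w`; no gate if there is no such qubit. -/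
def phaseInvGate (m n a : ℕ) (j : ℕ) (w : ℕ × ℕ) : QCircuit m n a :=
  ((toWire m n a w).map (QGate.phaseInv j)).toList

/-- A controlled-NOT gate on numbered qubits; no gate if the numbers are not those of two
distinct qubits. -/
def cnotGate (m n a : ℕ) (c t : ℕ × ℕ) : QCircuit m n a :=
  match toWire m n a c, toWire m n a t with
  | some c, some t => if h : c ≠ t then [QGate.cnot c t h] else []
  | _, _ => []

/-- A Toffoli gate on numbered qubits; no gate if the numbers are not those of three
distinct qubits. -/
def toffoliGate (m n a : ℕ) (c d t : ℕ × ℕ) : QCircuit m n a :=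
  match toWire m n a c, toWire m n a d, toWire m n a t with
  | some c, some d, some t =>
    if h : c ≠ d ∧ c ≠ t ∧ d ≠ t then [QGate.toffoli c d t h.1 h.2.1 h.2.2] else []
  | _, _, _ => []

theorem applyTo_hGate {w : ℕ × ℕ} {q : CircuitWire m n a} (h : toWire m n a w = some q)
    (ψ : QState m n a) (x : CircuitWire m n a → Bool) :
    applyTo (hGate m n a w) U ψ x = (ψ (Function.update x q false) +
      (if readWire x w then -1 else 1) * ψ (Function.update x q true)) / (Real.sqrt 2 : ℂ) := by
  simp [hGate, h, applyTo, QGate.apply, readWire]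

theorem applyTo_phaseGate {w : ℕ × ℕ} (h : IsWire m n a w) (j : ℕ)
    (ψ : QState m n a) (x : CircuitWire m n a → Bool) :
    applyTo (phaseGate m n a j w) U ψ x =
      (if readWire x w then Complex.exp (2 * Real.pi * Complex.I / 2 ^ j) else 1) * ψ x := by
  obtain ⟨q, h⟩ := isWire_iff.1 h
  simp [phaseGate, h, applyTo, QGate.apply, readWire]

theorem applyTo_phaseInvGate {w : ℕ × ℕ} (h : IsWire m n a w) (j : ℕ)
    (ψ : QState m n a) (x : CircuitWire m n a → Bool) :
    applyTo (phaseInvGate m n a j w) U ψ x =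
      (if readWire x w then Complex.exp (-(2 * Real.pi * Complex.I / 2 ^ j)) else 1) * ψ x := by
  obtain ⟨q, h⟩ := isWire_iff.1 h
  simp [phaseInvGate, h, applyTo, QGate.apply, readWire]

/-- The circuit acts on basis states as the map `g` on the values of the qubits: the amplitude of
a basis state becomes the amplitude of its image. -/
def Computes (C : QCircuit m n a) (g : (ℕ × ℕ → Bool) → ℕ × ℕ → Bool) : Prop :=
  ∃ F : (CircuitWire m n a → Bool) → CircuitWire m n a → Bool,
    (∀ x, readWire (F x) = g (readWire x)) ∧ ∀ ψ x, applyTo C U ψ (F x) = ψ x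

variable {U}

theorem Computes.nil : Computes (m := m) (n := n) (a := a) U [] id :=
  ⟨id, by simp, by simp [applyTo]⟩

theorem Computes.append {C D : QCircuit m n a} {f g : (ℕ × ℕ → Bool) → ℕ × ℕ → Bool}
    (hC : Computes U C f) (hD : Computes U D g) : Computes U (C ++ D) (g ∘ f) := by
  obtain ⟨F, hF, hF'⟩ := hC
  obtain ⟨G, hG, hG'⟩ := hD
  exact ⟨G ∘ F, fun x => by simp [hF, hG], fun ψ x => by
    rw [applyTo_append, Function.comp_apply, hG', hF']⟩

theorem computes_cnotGate {c t : ℕ × ℕ} (hc : IsWire m n a c) (ht : IsWire m n a t)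
    (hct : c ≠ t) : Computes U (cnotGate m n a c t)
      fun f => Function.update f t (xor (f t) (f c)) := by
  obtain ⟨c', hc⟩ := isWire_iff.1 hc
  obtain ⟨t', ht⟩ := isWire_iff.1 ht
  have hne : c' ≠ t' := fun h => hct (by
    rw [← wireCode_of_toWire hc, ← wireCode_of_toWire ht, h])
  refine ⟨fun x => Function.update x t' (xor (x t') (x c')), fun x => ?_, fun ψ x => ?_⟩
  · simp only [readWire_update ht, readWire_of_toWire _ hc, readWire_of_toWire _ ht]
  · simp [cnotGate, hc, ht, hne, applyTo, QGate.apply]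

theorem computes_toffoliGate {c d t : ℕ × ℕ} (hc : IsWire m n a c) (hd : IsWire m n a d)
    (ht : IsWire m n a t) (hcd : c ≠ d) (hct : c ≠ t) (hdt : d ≠ t) :
    Computes U (toffoliGate m n a c d t)
      fun f => Function.update f t (xor (f t) (f c && f d)) := by
  obtain ⟨c', hc⟩ := isWire_iff.1 hc
  obtain ⟨d', hd⟩ := isWire_iff.1 hd
  obtain ⟨t', ht⟩ := isWire_iff.1 ht
  have h1 : c' ≠ d' := fun h => hcd (by
    rw [← wireCode_of_toWire hc, ← wireCode_of_toWire hd, h])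
  have h2 : c' ≠ t' := fun h => hct (by
    rw [← wireCode_of_toWire hc, ← wireCode_of_toWire ht, h])
  have h3 : d' ≠ t' := fun h => hdt (by
    rw [← wireCode_of_toWire hd, ← wireCode_of_toWire ht, h])
  refine ⟨fun x => Function.update x t' (xor (x t') (x c' && x d')), fun x => ?_, fun ψ x => ?_⟩
  · simp only [readWire_update ht, readWire_of_toWire _ hc, readWire_of_toWire _ hd,
      readWire_of_toWire _ ht]
  · simp [toffoliGate, hc, hd, ht, h1, h2, h3, applyTo, QGate.apply]

/-- A NOT gate, as a conjugate of `diag(1, -1)` by Hadamard gates. -/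
def notGate (m n a : ℕ) (w : ℕ × ℕ) : QCircuit m n a :=
  hGate m n a w ++ phaseGate m n a 1 w ++ hGate m n a w

theorem computes_notGate {w : ℕ × ℕ} (hw : IsWire m n a w) :
    Computes U (notGate m n a w) fun f => Function.update f w (!f w) := by
  have hw' := hw
  obtain ⟨q, hq⟩ := isWire_iff.1 hw
  refine ⟨fun x => Function.update x q (!x q), fun x => ?_, fun ψ x => ?_⟩
  · simp only [readWire_update hq, readWire_of_toWire _ hq]
  · have hs : (Real.sqrt 2 : ℂ) * (Real.sqrt 2 : ℂ) = 2 := by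
      rw [← Complex.ofReal_mul, Real.mul_self_sqrt (by norm_num)]; norm_num
    have hs0 : (Real.sqrt 2 : ℂ) ≠ 0 := by
      intro h; rw [h] at hs; norm_num at hs
    have he : Complex.exp (2 * Real.pi * Complex.I / 2 ^ 1) = -1 := by
      rw [← Complex.exp_pi_mul_I]; congr 1; ring
    have hxf : x q = false → Function.update x q false = x := fun h => by
      rw [← h, Function.update_eq_self]
    have hxt : x q = true → Function.update x q true = x := fun h => by
      rw [← h, Function.update_eq_self]
    rw [notGate, applyTo_append, applyTo_append, applyTo_hGate U hq, applyTo_phaseGate U hw',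
      applyTo_phaseGate U hw', applyTo_hGate U hq, applyTo_hGate U hq]
    simp only [he, readWire_of_toWire _ hq, Function.update_self, Function.update_idem]
    cases hx : x q
    · rw [hxf hx]
      simp only [Bool.not_false, if_true, Bool.false_eq_true, if_false]
      field_simp
      linear_combination (-ψ x) * hs
    · rw [hxt hx]
      simp only [Bool.not_true, if_true, Bool.false_eq_true, if_false]
      field_simp
      linear_combination (-ψ x) * hs

/-- A controlled phase gate: `1/2^j = b/2^(j+1) + c/2^(j+1) - (b ⊕ c)/2^(j+1)` for `b = c = 1`. -/
def cphase (m n a : ℕ) (j : ℕ) (c t : ℕ × ℕ) : QCircuit m n a :=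
  phaseGate m n a (j + 1) c ++ phaseGate m n a (j + 1) t ++ cnotGate m n a c t ++
    phaseInvGate m n a (j + 1) t ++ cnotGate m n a c t

/-- The controlled phase gate multiplies the amplitude by the phase if both qubits are set. -/
theorem applyTo_cphase {c t : ℕ × ℕ} (hc : IsWire m n a c) (ht : IsWire m n a t)
    (hct : c ≠ t) (j : ℕ) (ψ : QState m n a) (x : CircuitWire m n a → Bool) :
    applyTo (cphase m n a j c t) U ψ x =
      (if readWire x c && readWire x t then Complex.exp (2 * Real.pi * Complex.I / 2 ^ j) else 1) *
        ψ x := by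
  obtain ⟨F, hF, hF'⟩ := computes_cnotGate (U := U) hc ht hct
  have hFF : F (F x) = x := readWire_injective (by
    rw [hF, hF]; funext w
    by_cases hw : w = t
    · subst hw; simp [Function.update_of_ne hct]
    · simp [Function.update_of_ne hw])
  rw [cphase, applyTo_append, applyTo_append, applyTo_append, applyTo_append]
  conv_lhs => rw [← hFF]
  rw [hF', applyTo_phaseInvGate U ht, hF', applyTo_phaseGate U ht, applyTo_phaseGate U hc, hF]
  have e1 : Complex.exp (2 * Real.pi * Complex.I / 2 ^ (j + 1)) *
      Complex.exp (2 * Real.pi * Complex.I / 2 ^ (j + 1)) =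
      Complex.exp (2 * Real.pi * Complex.I / 2 ^ j) := by
    rw [← Complex.exp_add]; congr 1; rw [pow_succ]; field_simp; ring
  have e2 : Complex.exp (-(2 * Real.pi * Complex.I / 2 ^ (j + 1))) *
      Complex.exp (2 * Real.pi * Complex.I / 2 ^ (j + 1)) = 1 := by
    rw [← Complex.exp_add]; simp
  simp only [Function.update_self]
  cases readWire x c <;> cases readWire x t <;> simp [← mul_assoc, e1, e2]

end QCircuit

/-! ### The quantum Fourier transform -/

/-- The complex number `exp (2 π i t)`. -/
noncomputable def unitPhase (t : ℝ) : ℂ := Complex.exp (2 * Real.pi * Complex.I * t)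

theorem unitPhase_add (s t : ℝ) : unitPhase (s + t) = unitPhase s * unitPhase t := by
  rw [unitPhase, unitPhase, unitPhase, ← Complex.exp_add]; congr 1; push_cast; ring

theorem unitPhase_zero : unitPhase 0 = 1 := by simp [unitPhase]

theorem unitPhase_natCast (k : ℕ) : unitPhase k = 1 := by
  rw [unitPhase, Complex.exp_eq_one_iff]
  exact ⟨k, by push_cast; ring⟩

theorem unitPhase_half : unitPhase (1 / 2) = -1 := by
  rw [unitPhase, ← Complex.exp_pi_mul_I]; congr 1; push_cast; ring

/-- The number whose binary digits, from the highest to the lowest, are `f 0, …, f (s - 1)`. -/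
def revVal (f : ℕ → Bool) : ℕ → ℕ
  | 0 => 0
  | s + 1 => 2 * revVal f s + (f s).toNat

theorem revVal_congr {f g : ℕ → Bool} {s : ℕ} (h : ∀ i < s, f i = g i) :
    revVal f s = revVal g s := by
  induction s with
  | zero => rfl
  | succ s ih => rw [revVal, revVal, ih fun i hi => h i (by omega), h s (by omega)]

theorem testBit_revVal (f : ℕ → Bool) {s p : ℕ} (hp : p < s) :
    (revVal f s).testBit p = f (s - 1 - p) := by
  induction s generalizing p with
  | zero => omega
  | succ s ih =>
    rw [revVal]
    rcases p with _ | p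
    · rw [Nat.testBit_zero]
      cases hf : f s <;> simp [Nat.add_mod, hf]
    · have : (2 * revVal f s + (f s).toNat) / 2 = revVal f s := by
        have := Bool.toNat_le (f s); omega
      rw [Nat.testBit_succ, this, ih (by omega)]
      congr 1; omega

theorem revVal_lt (f : ℕ → Bool) (s : ℕ) : revVal f s < 2 ^ s := by
  induction s with
  | zero => simp [revVal]
  | succ s ih =>
    have := Bool.toNat_le (f s)
    rw [revVal, pow_succ]; omega

theorem revVal_revVal {y m : ℕ} (hy : y < 2 ^ m) :
    revVal (revVal y.testBit m).testBit m = y := by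
  refine Nat.eq_of_testBit_eq fun p => ?_
  by_cases hp : p < m
  · rw [testBit_revVal _ hp, testBit_revVal _ (by omega)]
    congr 1; omega
  · have h1 := Nat.pow_le_pow_right (n := 2) (by norm_num) (not_lt.1 hp)
    rw [Nat.testBit_lt_two_pow (hy.trans_le h1),
      Nat.testBit_lt_two_pow ((revVal_lt _ _).trans_le h1)]

namespace QCircuit

variable {m n a : ℕ} {U : Matrix (OracleWire m n → Bool) (OracleWire m n → Bool) ℂ}

/-- The first `r` of the controlled phase gates that follow the Hadamard gate on the qubit `s` of
the first register in the quantum Fourier transform. -/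
def qftPhases (m n a s r : ℕ) : QCircuit m n a :=
  (List.range r).flatMap fun i => cphase m n a (s + 1 - i) (0, s) (0, i)

/-- The quantum Fourier transform on the low `s` qubits of the first register, up to the
order of the qubits of the result. -/
def qft (m n a s : ℕ) : QCircuit m n a :=
  (List.range s).reverse.flatMap fun i => hGate m n a (0, i) ++ qftPhases m n a i i

theorem qft_succ (m n a s : ℕ) :
    qft m n a (s + 1) = hGate m n a (0, s) ++ qftPhases m n a s s ++ qft m n a s := by
  simp [qft, List.range_succ]

theorem isWire_first {i : ℕ} (h : i < m) : IsWire m n a (0, i) := by simpa [IsWire] using h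

theorem applyTo_qftPhases {s r : ℕ} (hs : s < m) (hr : r ≤ s) (ψ : QState m n a)
    (x : CircuitWire m n a → Bool) :
    applyTo (qftPhases m n a s r) U ψ x =
      unitPhase ((readWire x (0, s)).toNat * bitVal (fun i => readWire x (0, i)) r /
        2 ^ (s + 1)) * ψ x := by
  induction r with
  | zero => simp [qftPhases, applyTo, bitVal, unitPhase_zero]
  | succ r ih =>
    have h : qftPhases m n a s (r + 1) =
        qftPhases m n a s r ++ cphase m n a (s + 1 - r) (0, s) (0, r) := by
      simp [qftPhases, List.range_succ]
    rw [h, applyTo_append, applyTo_cphase (isWire_first hs) (isWire_first (by omega))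
      (by simp; omega), ih (by omega), ← mul_assoc, bitVal_succ]
    congr 1
    have hpow : (2 : ℝ) ^ (s + 1) = 2 ^ (s + 1 - r) * 2 ^ r := by
      rw [← pow_add]; congr 1; omega
    have e1 : Complex.exp (2 * Real.pi * Complex.I / 2 ^ (s + 1 - r)) =
        unitPhase (2 ^ r / 2 ^ (s + 1)) := by
      rw [unitPhase]; congr 1
      rw [hpow]; push_cast
      field_simp
    cases readWire x (0, s) <;> cases readWire x (0, r) <;>
      simp [unitPhase_zero, e1, ← unitPhase_add]
    congr 1; ring

/-- The basis state `x` with the low `s` qubits of the first register replaced by those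
of `z`. -/
def lowRegister (s z : ℕ) (x : CircuitWire m n a → Bool) : CircuitWire m n a → Bool
  | Sum.inl (Sum.inl i) => if (i : ℕ) < s then z.testBit i else x (Sum.inl (Sum.inl i))
  | q => x q

theorem readWire_lowRegister {s i : ℕ} (hi : i < m) (z : ℕ) (x : CircuitWire m n a → Bool) :
    readWire (lowRegister s z x) (0, i) = if i < s then z.testBit i else readWire x (0, i) := by
  simp [readWire, toWire, hi, lowRegister]

theorem lowRegister_update {s z : ℕ} (hs : s < m) (hz : z < 2 ^ s) (b : Bool)
    (x : CircuitWire m n a → Bool) :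
    Function.update (lowRegister s z x) (Sum.inl (Sum.inl ⟨s, hs⟩)) b =
      lowRegister (s + 1) (b.toNat * 2 ^ s + z) x := by
  funext q
  rcases q with (i | i) | i
  · by_cases h : i = ⟨s, hs⟩
    · subst h
      simp only [Function.update_self, lowRegister, Nat.lt_succ_self, if_true]
      rw [mul_comm, Nat.testBit_two_pow_mul_add _ hz]
      cases b <;> simp
    · rw [Function.update_of_ne (by simpa using h)]
      have h' : (i : ℕ) ≠ s := fun h' => h (Fin.ext h')
      simp only [lowRegister, mul_comm b.toNat]
      rw [Nat.testBit_two_pow_mul_add _ hz]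
      split_ifs <;> first | rfl | omega
  · simp [lowRegister]
  · simp [lowRegister]

/-- The amplitudes of the Fourier transform. The frequency is read off with its binary digits in
the reverse order, so no exchange of qubits is needed. -/
theorem applyTo_qft {s : ℕ} (hs : s ≤ m) (ψ : QState m n a) (x : CircuitWire m n a → Bool) :
    applyTo (qft m n a s) U ψ x = ((Real.sqrt 2 : ℂ) ^ s)⁻¹ *
      ∑ z ∈ Finset.range (2 ^ s), ψ (lowRegister s z x) *
        unitPhase (z * revVal (fun i => readWire x (0, i)) s / 2 ^ s) := by
  induction s generalizing ψ with
  | zero =>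
    have : lowRegister 0 0 x = x := by
      funext q; rcases q with (i | i) | i <;> simp [lowRegister]
    simp [qft, applyTo, revVal, unitPhase_zero, this]
  | succ s ih =>
    have hs' : s < m := by omega
    have hq : toWire m n a (0, s) = some (Sum.inl (Sum.inl ⟨s, hs'⟩)) := by simp [toWire, hs']
    rw [qft_succ, applyTo_append, applyTo_append, ih (by omega), pow_succ 2 s, mul_two,
      Finset.sum_range_add, ← Finset.sum_add_distrib, Finset.mul_sum, Finset.mul_sum]
    refine Finset.sum_congr rfl fun z hz => ?_
    have hz := Finset.mem_range.1 hz
    have hbv : bitVal (fun i => readWire (lowRegister s z x) (0, i)) s = z := by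
      rw [bitVal_congr (g := z.testBit) fun i hi => by
        rw [readWire_lowRegister (by omega), if_pos hi], bitVal_testBit, Nat.mod_eq_of_lt hz]
    rw [applyTo_qftPhases hs' le_rfl, hbv, applyTo_hGate U hq, lowRegister_update hs' hz,
      lowRegister_update hs' hz, readWire_lowRegister hs', if_neg (lt_irrefl s), revVal]
    simp only [Bool.toNat_false, zero_mul, zero_add, Bool.toNat_true, one_mul]
    -- both phases are products of the phases for the parts of the two factors
    generalize ψ (lowRegister (s + 1) z x) = A
    generalize ψ (lowRegister (s + 1) (2 ^ s + z) x) = B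
    generalize revVal (fun i => readWire x (0, i)) s = R
    have hP : unitPhase (z * ((2 * R + (readWire x (0, s)).toNat : ℕ) : ℝ) / 2 ^ (s + 1)) =
        unitPhase (z * R / 2 ^ s) *
          unitPhase ((readWire x (0, s)).toNat * z / 2 ^ (s + 1)) := by
      rw [← unitPhase_add]; congr 1; push_cast; field_simp; ring
    have hQ : unitPhase (((2 ^ s + z : ℕ) : ℝ) *
        ((2 * R + (readWire x (0, s)).toNat : ℕ) : ℝ) / 2 ^ (s + 1)) =
        (if readWire x (0, s) then -1 else 1) * (unitPhase (z * R / 2 ^ s) *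
          unitPhase ((readWire x (0, s)).toNat * z / 2 ^ (s + 1))) := by
      have e : (if readWire x (0, s) then -1 else 1 : ℂ) =
          unitPhase (R + (readWire x (0, s)).toNat / 2) := by
        rw [unitPhase_add, unitPhase_natCast, one_mul]
        cases readWire x (0, s)
        · simp [unitPhase_zero]
        · simp only [if_true, Bool.toNat_true, Nat.cast_one]; exact unitPhase_half.symm
      rw [e, ← unitPhase_add, ← unitPhase_add]; congr 1; push_cast; field_simp; ring
    rw [hP, hQ, pow_succ (Real.sqrt 2 : ℂ), mul_inv]
    ring

end QCircuit

/-! ### Basis states and the oracle -/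

namespace QCircuit

variable {m n a : ℕ} {U : Matrix (OracleWire m n → Bool) (OracleWire m n → Bool) ℂ}
  {s : Finset (Fin n) → Finset (Fin n)}

/-- The basis state `|k, u, v⟩|r⟩`. -/
def ket (m : ℕ) {n a : ℕ} (k : ℕ) (u v : Finset (Fin n)) (r : Fin a → Bool) :
    CircuitWire m n a → Bool := Sum.elim (ketBits m k u v) r

theorem exists_ketBits (b : OracleWire m n → Bool) :
    ∃ k < 2 ^ m, ∃ u v : Finset (Fin n), b = ketBits m k u v := by
  refine ⟨Nat.ofBits fun i => b (Sum.inl i), Nat.ofBits_lt_two_pow _,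
    Finset.univ.filter fun i => b (Sum.inr (Sum.inl i)),
    Finset.univ.filter fun i => b (Sum.inr (Sum.inr i)), ?_⟩
  funext q
  rcases q with i | i | i <;> simp [ketBits]

theorem exists_ket (x : CircuitWire m n a → Bool) :
    ∃ k < 2 ^ m, ∃ u v, ∃ r : Fin a → Bool, x = ket m k u v r := by
  obtain ⟨k, hk, u, v, h⟩ := exists_ketBits fun i => x (Sum.inl i)
  refine ⟨k, hk, u, v, fun i => x (Sum.inr i), ?_⟩
  rw [ket, ← h]
  funext q; rcases q with q | q <;> rfl

theorem ketBits_inj {k k' : ℕ} (hk : k < 2 ^ m) (hk' : k' < 2 ^ m) {u u' v v' : Finset (Fin n)}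
    (h : ketBits m k u v = ketBits m k' u' v') : k = k' ∧ u = u' ∧ v = v' := by
  refine ⟨Nat.eq_of_testBit_eq fun i => ?_, ?_, ?_⟩
  · by_cases hi : i < m
    · simpa [ketBits] using congrFun h (Sum.inl ⟨i, hi⟩)
    · have := Nat.pow_le_pow_right (n := 2) (by norm_num) (not_lt.1 hi)
      rw [Nat.testBit_lt_two_pow (hk.trans_le this), Nat.testBit_lt_two_pow (hk'.trans_le this)]
  · ext i; simpa [ketBits] using congrFun h (Sum.inr (Sum.inl i))
  · ext i; simpa [ketBits] using congrFun h (Sum.inr (Sum.inr i))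

theorem ket_inj {k k' : ℕ} (hk : k < 2 ^ m) (hk' : k' < 2 ^ m) {u u' v v' : Finset (Fin n)}
    {r r' : Fin a → Bool} (h : ket m k u v r = ket m k' u' v' r') :
    k = k' ∧ u = u' ∧ v = v' ∧ r = r' := by
  obtain ⟨h1, h2, h3⟩ := ketBits_inj hk hk' (funext fun q => congrFun h (Sum.inl q))
  exact ⟨h1, h2, h3, funext fun q => congrFun h (Sum.inr q)⟩

theorem lowRegister_ket (z k : ℕ) (u v : Finset (Fin n)) (r : Fin a → Bool) :
    lowRegister m z (ket m k u v r) = ket m z u v r := by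
  funext q
  rcases q with (i | i) | i <;> simp [lowRegister, ket, ketBits]

theorem readWire_ket_first {i : ℕ} (hi : i < m) (k : ℕ) (u v : Finset (Fin n)) (r : Fin a → Bool) :
    readWire (ket m k u v r) (0, i) = k.testBit i := by
  simp [readWire, toWire, hi, ket, ketBits]

theorem readWire_ket_third {i : ℕ} (hi : i < n) (k : ℕ) (u v : Finset (Fin n))
    (r : Fin a → Bool) : readWire (ket m k u v r) (2, i) = decide (⟨i, hi⟩ ∈ v) := by
  simp [readWire, toWire, hi, ket, ketBits]

theorem readWire_ket_second {i : ℕ} (hi : i < n) (k : ℕ) (u v : Finset (Fin n))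
    (r : Fin a → Bool) : readWire (ket m k u v r) (1, i) = decide (⟨i, hi⟩ ∈ u) := by
  simp [readWire, toWire, hi, ket, ketBits]

theorem readWire_ket_work {i : ℕ} (hi : i < a) (k : ℕ) (u v : Finset (Fin n))
    (r : Fin a → Bool) : readWire (ket m k u v r) (3, i) = r ⟨i, hi⟩ := by
  simp [readWire, toWire, hi, ket]

theorem _root_.CalculatesPowers.apply (hU : CalculatesPowers U s) {k : ℕ} (hk : k < 2 ^ m)
    (u v : Finset (Fin n)) (i : OracleWire m n → Bool) :
    U i (ketBits m k u v) = if i = ketBits m k u (symmDiff v (s^[k] u)) then 1 else 0 := by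
  have := congrFun (hU k hk u v) i
  rw [Matrix.mulVec_single_one, Pi.single_apply] at this
  exact this

/-- The oracle permutes the basis states. -/
theorem applyTo_oracle (hU : CalculatesPowers U s) {k : ℕ} (hk : k < 2 ^ m)
    (u v : Finset (Fin n)) (r : Fin a → Bool) (ψ : QState m n a) :
    applyTo [QGate.oracle] U ψ (ket m k u v r) = ψ (ket m k u (symmDiff v (s^[k] u)) r) := by
  have h : applyTo [QGate.oracle] U ψ (ket m k u v r) =
      ∑ y : OracleWire m n → Bool, U (ketBits m k u v) y * ψ (Sum.elim y r) := rfl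
  rw [h, Finset.sum_eq_single (ketBits m k u (symmDiff v (s^[k] u)))]
  · rw [hU.apply hk, symmDiff_symmDiff_cancel_right, if_pos rfl, one_mul]; rfl
  · intro y _ hy
    obtain ⟨k', hk', u', v', rfl⟩ := exists_ketBits y
    rw [hU.apply hk', if_neg, zero_mul]
    intro he
    obtain ⟨rfl, rfl, rfl⟩ := ketBits_inj hk hk' he
    rw [symmDiff_symmDiff_cancel_right] at hy
    exact hy rfl
  · simp

/-! ### Sampling from the Fourier spectrum of the orbit -/

/-- Fourier transform, query, Fourier transform: the sampling step of period finding. -/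
def fourierSample (m n a : ℕ) : QCircuit m n a :=
  qft m n a m ++ [QGate.oracle] ++ qft m n a m

theorem applyTo_fourierSample (hU : CalculatesPowers U s) (ψ : QState m n a) (k : ℕ)
    (u v : Finset (Fin n)) (r : Fin a → Bool) :
    applyTo (fourierSample m n a) U ψ (ket m k u v r) = ((2 : ℂ) ^ m)⁻¹ *
      ∑ z ∈ Finset.range (2 ^ m), (∑ z' ∈ Finset.range (2 ^ m),
        ψ (ket m z' u (symmDiff v (s^[z] u)) r) *
          unitPhase (z' * revVal z.testBit m / 2 ^ m)) *
        unitPhase (z * revVal k.testBit m / 2 ^ m) := by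
  have hs : ((2 : ℂ) ^ m)⁻¹ = ((Real.sqrt 2 : ℂ) ^ m)⁻¹ * ((Real.sqrt 2 : ℂ) ^ m)⁻¹ := by
    rw [← mul_inv, ← mul_pow, ← Complex.ofReal_mul, Real.mul_self_sqrt (by norm_num)]; norm_num
  have hrev : ∀ k v, revVal (fun i => readWire (ket m k u v r) (0, i)) m = revVal k.testBit m :=
    fun k v => revVal_congr fun i hi => readWire_ket_first hi _ _ _ _
  rw [fourierSample, applyTo_append, applyTo_append, applyTo_qft le_rfl, hrev, hs, mul_assoc]
  congr 1
  rw [Finset.mul_sum]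
  refine Finset.sum_congr rfl fun z hz => ?_
  rw [lowRegister_ket, applyTo_oracle hU (Finset.mem_range.1 hz), applyTo_qft le_rfl, hrev,
    mul_assoc]
  simp only [lowRegister_ket]

/-- The amplitude of the Fourier coefficient `y` together with the orbit element `v`: the sum of
the phases of the exponents `z < 2 ^ m` with `s^z(∅) = v`. -/
noncomputable def sampleAmp (m : ℕ) {n : ℕ} (s : Finset (Fin n) → Finset (Fin n)) (y : ℕ)
    (v : Finset (Fin n)) : ℂ :=
  ((2 : ℂ) ^ m)⁻¹ *
    ∑ z ∈ (Finset.range (2 ^ m)).filter fun z => s^[z] ∅ = v, unitPhase (z * y / 2 ^ m)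

/-- Sampling with zero first and third registers. The second register holds `∅`, and the work
qubits, which the sampling does not touch, hold `r`. -/
theorem applyTo_fourierSample_of_support (hU : CalculatesPowers U s) {ψ : QState m n a}
    {r : Fin a → Bool} (hψ : ∀ k < 2 ^ m, ∀ v, (k, v) ≠ (0, ∅) → ψ (ket m k ∅ v r) = 0) (k : ℕ)
    (v : Finset (Fin n)) :
    applyTo (fourierSample m n a) U ψ (ket m k ∅ v r) =
      sampleAmp m s (revVal k.testBit m) v * ψ (ket m 0 ∅ ∅ r) := by
  rw [applyTo_fourierSample hU, sampleAmp, mul_assoc, Finset.sum_mul, Finset.sum_filter]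
  congr 1
  refine Finset.sum_congr rfl fun z hz => ?_
  rw [Finset.sum_eq_single 0]
  · split_ifs with h
    · rw [h, symmDiff_self]; simp [unitPhase_zero, mul_comm]
    · rw [hψ 0 (by positivity)]
      · simp
      · exact fun he => h (symmDiff_eq_bot.1 (Prod.mk.inj he).2).symm
  · intro z' hz' h0
    rw [hψ z' (Finset.mem_range.1 hz') _ (by simp [h0]), zero_mul]
  · intro h; exact absurd (Finset.mem_range.2 (by positivity)) h

theorem applyTo_fourierSample_eq_zero (hU : CalculatesPowers U s) {ψ : QState m n a}
    {r : Fin a → Bool} (hψ : ∀ k u v, ψ (ket m k u v r) = 0) (k : ℕ) (u v : Finset (Fin n)) :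
    applyTo (fourierSample m n a) U ψ (ket m k u v r) = 0 := by
  simp [applyTo_fourierSample hU, hψ]

end QCircuit

/-! ### Classical computations on basis states -/

namespace QCircuit

variable {m n a : ℕ} {U : Matrix (OracleWire m n → Bool) (OracleWire m n → Bool) ℂ}

theorem Computes.congr {C : QCircuit m n a} {f g : (ℕ × ℕ → Bool) → ℕ × ℕ → Bool}
    (hC : Computes U C f) (h : f = g) : Computes U C g := h ▸ hC

/-- Move the first `s` qubits of the register `ρ` to the work qubits from `Y` on. -/
def moveGates (m n a ρ Y s : ℕ) : QCircuit m n a :=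
  (List.range s).flatMap fun i =>
    cnotGate m n a (ρ, i) (3, Y + i) ++ cnotGate m n a (3, Y + i) (ρ, i)

/-- The action of `moveGates`; if the work qubits are `false`, they take the values of the
qubits of the register, which become `false`. -/
def moved (ρ Y s : ℕ) (f : ℕ × ℕ → Bool) (w : ℕ × ℕ) : Bool :=
  if w.1 = ρ ∧ w.2 < s then f (3, Y + w.2)
  else if w.1 = 3 ∧ Y ≤ w.2 ∧ w.2 < Y + s then xor (f w) (f (ρ, w.2 - Y)) else f w

theorem computes_moveGates {ρ Y s : ℕ} (hρ : ρ ≠ 3) (h1 : ∀ i < s, IsWire m n a (ρ, i))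
    (h2 : Y + s ≤ a) : Computes U (moveGates m n a ρ Y s) (moved ρ Y s) := by
  induction s with
  | zero =>
    refine Computes.nil.congr ?_
    funext f w
    rw [moved, if_neg (by omega), if_neg (by omega)]; rfl
  | succ s ih =>
    have hw1 := h1 s (by omega)
    have hw2 : IsWire m n a (3, Y + s) := show Y + s < a by omega
    have hne : ((ρ, s) : ℕ × ℕ) ≠ (3, Y + s) := by simp [hρ]
    have e : moveGates m n a ρ Y (s + 1) = moveGates m n a ρ Y s ++
        (cnotGate m n a (ρ, s) (3, Y + s) ++ cnotGate m n a (3, Y + s) (ρ, s)) := by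
      simp [moveGates, List.range_succ]
    rw [e]
    refine ((ih (fun i hi => h1 i (by omega)) (by omega)).append
      ((computes_cnotGate hw1 hw2 hne).append (computes_cnotGate hw2 hw1 hne.symm))).congr ?_
    funext f w
    obtain ⟨c, i⟩ := w
    have g1 : moved ρ Y s f (ρ, s) = f (ρ, s) := by
      rw [moved, if_neg (by simp), if_neg (by simp [hρ])]
    have g2 : moved ρ Y s f (3, Y + s) = f (3, Y + s) := by
      rw [moved, if_neg (by simp [hρ.symm]), if_neg (by simp)]
    simp only [Function.comp_apply, Function.update_self, Function.update_of_ne hne, g1, g2]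
    by_cases hc : ((c, i) : ℕ × ℕ) = (ρ, s)
    · rw [hc, Function.update_self, moved, if_pos (by simp)]
      cases f (ρ, s) <;> simp
    · rw [Function.update_of_ne hc]
      by_cases hd : ((c, i) : ℕ × ℕ) = (3, Y + s)
      · rw [hd, Function.update_self, moved, if_neg (by simp [hρ.symm]), if_pos (by simp)]
        simp
      · rw [Function.update_of_ne hd]
        simp only [Prod.mk.injEq, not_and] at hc hd
        simp only [moved]
        by_cases hcρ : c = ρ
        · have := hc hcρ
          subst hcρ
          have : (i < s + 1) = (i < s) := by rw [eq_iff_iff]; omega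
          simp [hρ, this]
        · by_cases hc3 : c = 3
          · have := hd hc3
            have : (i < Y + (s + 1)) = (i < Y + s) := by rw [eq_iff_iff]; omega
            simp [hρ.symm, hc3, this]
          · simp [hcρ, hc3]

/-- The gates for `x_t := x_t ⊕ x_a ⊕ (x_b ∧ x_c)` on work qubits, where `o = (a, b, c)`. For
`b = c` the conjunction is `x_b`, and a controlled-NOT gate replaces the Toffoli gate. -/
def opGates (m n A t : ℕ) (o : ℕ × ℕ × ℕ) : QCircuit m n A :=
  cnotGate m n A (3, o.1) (3, t) ++
    if o.2.1 = o.2.2 then cnotGate m n A (3, o.2.1) (3, t)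
    else toffoliGate m n A (3, o.2.1) (3, o.2.2) (3, t)

theorem computes_opGates {A t : ℕ} (ht : t < A) {o : ℕ × ℕ × ℕ} (h1 : o.1 < t) (h2 : o.2.1 < t)
    (h3 : o.2.2 < t) : Computes U (opGates m n A t o) fun f =>
      Function.update f (3, t)
        (xor (f (3, t)) (xor (f (3, o.1)) (f (3, o.2.1) && f (3, o.2.2)))) := by
  have w : ∀ {i}, i ≤ t → IsWire m n A (3, i) := fun {i} hi => show i < A by omega
  have ne : ∀ {i}, i < t → ((3, i) : ℕ × ℕ) ≠ (3, t) := fun {i} hi => by simp; omega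
  have c1 := computes_cnotGate (U := U) (w h1.le) (w le_rfl) (ne h1)
  by_cases h : o.2.1 = o.2.2
  · rw [opGates, if_pos h]
    refine (c1.append (computes_cnotGate (w h2.le) (w le_rfl) (ne h2))).congr ?_
    funext f
    simp [Function.update_of_ne (ne h2), ← h, Function.comp]
  · rw [opGates, if_neg h]
    refine (c1.append (computes_toffoliGate (w h2.le) (w h3.le) (w le_rfl) (by simpa using h)
      (ne h2) (ne h3))).congr ?_
    funext f
    simp [Function.update_of_ne (ne h2), Function.update_of_ne (ne h3), Function.comp]

/-- A straight-line program: the work qubit `base + i` is computed from earlier work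
qubits by the operation `op i`. -/
def program (m n A base : ℕ) (op : ℕ → ℕ × ℕ × ℕ) (N : ℕ) : QCircuit m n A :=
  (List.range N).flatMap fun i => opGates m n A (base + i) (op i)

/-- On work qubits that are `false` from `base` on, a straight-line program produces values
that satisfy all its equations. -/
theorem computes_program {A base N : ℕ} {op : ℕ → ℕ × ℕ × ℕ} (hA : base + N ≤ A)
    (hop : ∀ i < N, (op i).1 < base + i ∧ (op i).2.1 < base + i ∧ (op i).2.2 < base + i) :
    ∃ g, Computes U (program m n A base op N) g ∧ ∀ f, (∀ t, base ≤ t → f (3, t) = false) →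
      (∀ w : ℕ × ℕ, ¬ (w.1 = 3 ∧ base ≤ w.2 ∧ w.2 < base + N) → g f w = f w) ∧
      ∀ i < N, g f (3, base + i) =
        xor (g f (3, (op i).1)) (g f (3, (op i).2.1) && g f (3, (op i).2.2)) := by
  induction N with
  | zero => exact ⟨id, Computes.nil, fun f _ => ⟨fun _ _ => rfl, by omega⟩⟩
  | succ N ih =>
    obtain ⟨g, hg, hg'⟩ := ih (by omega) fun i hi => hop i (by omega)
    obtain ⟨o1, o2, o3⟩ := hop N (by omega)
    have e : program m n A base op (N + 1) =
        program m n A base op N ++ opGates m n A (base + N) (op N) := by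
      simp [program, List.range_succ]
    refine ⟨_, e ▸ hg.append (computes_opGates (by omega) o1 o2 o3), fun f hf => ?_⟩
    obtain ⟨k1, k2⟩ := hg' f hf
    have ne : ∀ {i}, i < base + N → ((3, i) : ℕ × ℕ) ≠ (3, base + N) :=
      fun {i} hi => by simp; omega
    refine ⟨fun w hw => ?_, fun i hi => ?_⟩
    · simp only [Function.comp_apply]
      rw [Function.update_of_ne, k1 w (by omega)]
      rintro rfl
      simp at hw
    · simp only [Function.comp_apply]
      rcases Nat.lt_succ_iff_lt_or_eq.1 hi with hi' | rfl
      · obtain ⟨p1, p2, p3⟩ := hop i hi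
        rw [Function.update_of_ne (ne (by omega)), Function.update_of_ne (ne (by omega)),
          Function.update_of_ne (ne (by omega)), Function.update_of_ne (ne (by omega)), k2 i hi']
      · rw [Function.update_self, Function.update_of_ne (ne o1), Function.update_of_ne (ne o2),
          Function.update_of_ne (ne o3), k1 (3, base + i) (by simp), hf _ (by omega)]
        simp

/-- Add the work qubits `R 0, …, R (s - 1)` to the first register. -/
def copyGates (m n a : ℕ) (R : ℕ → ℕ) (s : ℕ) : QCircuit m n a :=
  (List.range s).flatMap fun i => cnotGate m n a (3, R i) (0, i)

theorem computes_copyGates {R : ℕ → ℕ} {s : ℕ} (hs : s ≤ m) (hR : ∀ i < s, R i < a) :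
    Computes U (copyGates m n a R s) fun f w =>
      if w.1 = 0 ∧ w.2 < s then xor (f w) (f (3, R w.2)) else f w := by
  induction s with
  | zero => exact Computes.nil.congr (by funext f w; simp)
  | succ s ih =>
    have e : copyGates m n a R (s + 1) =
        copyGates m n a R s ++ cnotGate m n a (3, R s) (0, s) := by
      simp [copyGates, List.range_succ]
    rw [e]
    refine ((ih (by omega) fun i hi => hR i (by omega)).append
      (computes_cnotGate (c := (3, R s)) (hR s (by omega)) (isWire_first (by omega))
        (by simp))).congr ?_
    funext f w
    obtain ⟨c, i⟩ := w
    simp only [Function.comp_apply]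
    by_cases hc : ((c, i) : ℕ × ℕ) = (0, s)
    · obtain ⟨rfl, rfl⟩ := Prod.mk.inj hc
      rw [Function.update_self]; simp
    · rw [Function.update_of_ne hc]
      simp only [Prod.mk.injEq, not_and] at hc
      by_cases h0 : c = 0
      · have := hc h0
        have : (i < s + 1) = (i < s) := by rw [eq_iff_iff]; omega
        simp [this]
      · simp [h0]

end QCircuit

/-! ### The straight-line program of the classical post-processing -/

namespace PostProcess

/-- The number of shifts of a division: all remainders and cofactors are below
`2 ^ width m`. -/
def width (m : ℕ) : ℕ := 2 * m + 2

/-- The length of a row of bits, enough for a number below `2 ^ width m` and its shifts. -/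
def cols (m : ℕ) : ℕ := 2 * width m

/-- The number of blocks of one run of Euclid's algorithm, with `2 * width m` divisions. -/
def phaseLen (m : ℕ) : ℕ := width m * (2 * width m)

/-- The number of the first work qubit of the program. Before it lie the constants `false` and
`true`, two samples of `m` bits and two copies of the third register. -/
def base (m n : ℕ) : ℕ := 2 + 2 * m + 2 * n

/-- The position of the bit `p` in the row `k` of the block `b`, relative to `base m n`. -/
def cellIdx (m b k p : ℕ) : ℕ := (24 * b + k) * cols m + p

/-- The work qubit for the bit `p` in the row `k` of the block `b`. -/
def cell (m n b k p : ℕ) : ℕ := base m n + cellIdx m b k p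

/-- Shift a row of qubits up by `i` positions; the work qubit `0` is the constant `false`. -/
def up (i : ℕ) (w : ℕ → ℕ) (p : ℕ) : ℕ := if p < i then 0 else w (p - i)

/-- The initial values of the state in the four phases, one row for each of `r₀`, `r₁`, `t₀`,
`t₁`: `(2 ^ m, y₁, 0, 1)` and `(2 ^ m, y₂, 0, 1)` for the samples `y₁`, `y₂`, then
`(q₁ 2 ^ m, q₂ 2 ^ m, 0, q₂)` with the denominators `q₁`, `q₂` found, and finally
`(l 2 ^ (W - 1), 1, 0, 0)` with their least common multiple `l`, which makes one subtraction. -/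
def initial (m n ph r p : ℕ) : ℕ :=
  [if p = m then 1 else 0, if p < m then 2 + (m - 1 - p) else 0, 0, if p = 0 then 1 else 0,
    if p = m then 1 else 0, if p < m then 2 + m + (m - 1 - p) else 0, 0, if p = 0 then 1 else 0,
    up m (cell m n (phaseLen m - 1) 23) p, up m (cell m n (2 * phaseLen m - 1) 23) p, 0,
      cell m n (2 * phaseLen m - 1) 23 p,
    up (width m - 1) (cell m n (3 * phaseLen m - 1) 23) p, if p = 0 then 1 else 0, 0, 0].getD
    (4 * ph + r) 0

/-- The qubits of the state before the block `b`: the last four rows of the block before it, or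
the initial values of the next phase. -/
def stateCell (m n b r p : ℕ) : ℕ :=
  if b % phaseLen m = 0 then initial m n (b / phaseLen m) r p else cell m n (b - 1) (20 + r) p

/-- The shift of the block `b`. -/
def shiftAt (m b : ℕ) : ℕ := width m - 1 - b % width m

/-- The operation `(a, b, c)`, for `x_a ⊕ (x_b ∧ x_c)`, that computes the bit `p` in the row `k`
of the block `b`. The rows are those of `BlockEqns`. -/
def blockOp (m n b k p : ℕ) : ℕ × ℕ × ℕ :=
  [(1, stateCell m n b 3 p, 1),
    (0, cell m n b 0 p, up 1 (stateCell m n b 1) p),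
    (cell m n b 0 p, up 1 (stateCell m n b 1) p, 1),
    (cell m n b 1 p, cell m n b 2 p, up 1 (cell m n b 3) p),
    (1, stateCell m n b 0 p, 1),
    (0, cell m n b 4 p, up (shiftAt m b) (stateCell m n b 1) p),
    (cell m n b 4 p, up (shiftAt m b) (stateCell m n b 1) p, 1),
    (cell m n b 5 p, cell m n b 6 p, up 1 (cell m n b 7) p),
    (cell m n b 6 p, up 1 (cell m n b 7) p, 1),
    (cell m n b 3 (cols m - 1), cell m n b 3 (cols m - 1), cell m n b 7 (cols m - 1)),
    (cell m n b 4 p, cell m n b 8 p, 1),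
    (stateCell m n b 0 p, cell m n b 9 p, cell m n b 10 p),
    (0, cell m n b 9 p, up (shiftAt m b) (stateCell m n b 3) p),
    (0, stateCell m n b 2 p, cell m n b 12 p),
    (stateCell m n b 2 p, cell m n b 12 p, 1),
    (cell m n b 13 p, cell m n b 14 p, up 1 (cell m n b 15) p),
    (cell m n b 14 p, up 1 (cell m n b 15) p, 1),
    (0, cell m n b 3 (cols m - 1), if shiftAt m b = 0 then 1 else 0),
    (cell m n b 11 p, stateCell m n b 1 p, 1),
    (cell m n b 16 p, stateCell m n b 3 p, 1),
    (cell m n b 11 p, cell m n b 17 p, cell m n b 18 p),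
    (stateCell m n b 1 p, cell m n b 17 p, cell m n b 18 p),
    (cell m n b 16 p, cell m n b 17 p, cell m n b 19 p),
    (stateCell m n b 3 p, cell m n b 17 p, cell m n b 19 p)].getD k (0, 0, 0)

/-- The operations of the program in their order. -/
def op (m n i : ℕ) : ℕ × ℕ × ℕ :=
  blockOp m n (i / cols m / 24) (i / cols m % 24) (i % cols m)

/-- The number of blocks: three runs of Euclid's algorithm and one subtraction. -/
def numBlocks (m : ℕ) : ℕ := 3 * phaseLen m + 1

/-- The number of operations. -/
def size (m : ℕ) : ℕ := 24 * numBlocks m * cols m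

variable {m n : ℕ}

theorem width_pos : 0 < width m := by unfold width; omega

theorem cols_pos : 0 < cols m := by have := width_pos (m := m); unfold cols; omega

theorem phaseLen_pos : 0 < phaseLen m := by
  have := width_pos (m := m); unfold phaseLen; positivity

theorem op_cellIdx {b k p : ℕ} (hk : k < 24) (hp : p < cols m) :
    op m n (cellIdx m b k p) = blockOp m n b k p := by
  have h1 : cellIdx m b k p / cols m = 24 * b + k := by
    rw [cellIdx, mul_comm, Nat.mul_add_div cols_pos, Nat.div_eq_of_lt hp, add_zero]
  have h2 : cellIdx m b k p % cols m = p := by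
    rw [cellIdx, mul_comm, Nat.mul_add_mod, Nat.mod_eq_of_lt hp]
  rw [op, h1, h2]
  congr 1 <;> omega

theorem cell_lt_cell {b k p b' k' p' : ℕ} (hp : p < cols m) (h : 24 * b + k < 24 * b' + k') :
    cell m n b k p < cell m n b' k' p' := by
  have := Nat.mul_le_mul_right (cols m) (Nat.succ_le_of_lt h)
  rw [Nat.succ_mul] at this
  unfold cell cellIdx; omega

theorem base_le_cell (b k p : ℕ) : base m n ≤ cell m n b k p := Nat.le_add_right _ _

theorem cellIdx_lt_size {b k p : ℕ} (hb : b < numBlocks m) (hk : k < 24) (hp : p < cols m) :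
    cellIdx m b k p < size m := by
  have := Nat.mul_le_mul_right (cols m) (show 24 * b + k + 1 ≤ 24 * numBlocks m by omega)
  rw [Nat.succ_mul] at this
  unfold cellIdx size; omega

theorem up_lt {i p t : ℕ} {w : ℕ → ℕ} (ht : 0 < t) (h : i ≤ p → w (p - i) < t) : up i w p < t := by
  unfold up; split_ifs with hi
  · exact ht
  · exact h (not_lt.1 hi)

theorem stateCell_lt {b r p : ℕ} (hb : b < numBlocks m) (hr : r < 4) (hp : p < cols m) :
    stateCell m n b r p < cell m n b 0 0 := by
  have hbase := base_le_cell (m := m) (n := n) b 0 0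
  have hb2 : base m n = 2 + 2 * m + 2 * n := rfl
  have hl := phaseLen_pos (m := m)
  unfold stateCell
  split_ifs with h
  · obtain ⟨ph, rfl⟩ := Nat.dvd_of_mod_eq_zero h
    rw [Nat.mul_div_cancel_left _ hl]
    have hph : ph < 4 := by
      unfold numBlocks at hb
      by_contra hc
      have := Nat.mul_le_mul_left (phaseLen m) (not_lt.1 hc)
      omega
    have key : ∀ j p, 0 < j → j ≤ ph → p < cols m →
        cell m n (j * phaseLen m - 1) 23 p < cell m n (phaseLen m * ph) 0 0 := by
      intro j p hj hjp hp
      refine cell_lt_cell hp ?_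
      have h1 := Nat.mul_le_mul_right (phaseLen m) hj
      have h2 := Nat.mul_le_mul_right (phaseLen m) hjp
      rw [mul_comm ph] at h2
      omega
    have k1 := fun p => key 1 p one_pos
    have k2 := fun p => key 2 p two_pos
    have k3 := fun p => key 3 p three_pos
    rw [one_mul] at k1
    generalize cell m n (phaseLen m * ph) 0 0 = t at *
    have hu : ∀ i w, (∀ p < cols m, w p < t) → up i w p < t := fun i w hw =>
      up_lt (by omega) fun _ => hw _ (by omega)
    interval_cases ph <;> interval_cases r <;>
      simp only [initial, List.getD_cons_zero, List.getD_cons_succ, Nat.reduceMul, Nat.reduceAdd]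
    all_goals with_reducible first
      | exact k2 p (by omega) hp
      | exact hu _ _ fun p hp => k1 p (by omega) hp
      | exact hu _ _ fun p hp => k2 p (by omega) hp
      | exact hu _ _ fun p hp => k3 p (by omega) hp
      | (split_ifs <;> omega)
      | omega
  · have : b ≠ 0 := by rintro rfl; simp at h
    exact cell_lt_cell hp (by omega)

theorem blockOp_lt {b k p : ℕ} (hb : b < numBlocks m) (hk : k < 24) (hp : p < cols m) :
    (blockOp m n b k p).1 < cell m n b k p ∧ (blockOp m n b k p).2.1 < cell m n b k p ∧
      (blockOp m n b k p).2.2 < cell m n b k p := by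
  have h0 : 2 ≤ cell m n b k p := by
    have := base_le_cell (m := m) (n := n) b k p
    have hb2 : base m n = 2 + 2 * m + 2 * n := rfl
    omega
  have hs : ∀ r p', r < 4 → p' < cols m → stateCell m n b r p' < cell m n b k p := by
    intro r p' hr hp'
    refine (stateCell_lt hb hr hp').trans_le ?_
    have := Nat.mul_le_mul_right (cols m) (show 24 * b + 0 ≤ 24 * b + k by omega)
    unfold cell cellIdx; omega
  have hc : ∀ k' p', k' < k → p' < cols m → cell m n b k' p' < cell m n b k p :=
    fun k' p' hk' hp' => cell_lt_cell hp' (by omega)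
  have hu : ∀ i r, r < 4 → up i (stateCell m n b r) p < cell m n b k p :=
    fun i r hr => up_lt (by omega) fun _ => hs r _ hr (by omega)
  have hv : ∀ k', k' ≤ k → up 1 (cell m n b k') p < cell m n b k p := fun k' hk' =>
    up_lt (by omega) fun hp1 => by
      rcases hk'.lt_or_eq with h | rfl
      · exact hc k' _ h (by omega)
      · unfold cell cellIdx; omega
  have hl : cols m - 1 < cols m := by have := cols_pos (m := m); omega
  interval_cases k <;> simp only [blockOp, List.getD_cons_zero, List.getD_cons_succ] <;>
    refine ⟨?_, ?_, ?_⟩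
  all_goals with_reducible first
    | omega
    | exact hs _ _ (by omega) hp
    | exact hc _ _ (by omega) hp
    | exact hc _ _ (by omega) hl
    | exact hu _ _ (by omega)
    | exact hv _ (by omega)
    | (split_ifs <;> omega)

theorem op_lt (i : ℕ) (hi : i < size m) : (op m n i).1 < base m n + i ∧
    (op m n i).2.1 < base m n + i ∧ (op m n i).2.2 < base m n + i := by
  have hc := cols_pos (m := m)
  have e : i = cellIdx m (i / cols m / 24) (i / cols m % 24) (i % cols m) := by
    rw [cellIdx, Nat.div_add_mod, mul_comm, Nat.div_add_mod]
  have hb : i / cols m / 24 < numBlocks m := by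
    rw [Nat.div_lt_iff_lt_mul (by norm_num), Nat.div_lt_iff_lt_mul hc]
    unfold size at hi
    rwa [mul_comm _ 24]
  conv => rw [e]
  rw [op_cellIdx (Nat.mod_lt _ (by norm_num)) (Nat.mod_lt _ hc)]
  exact blockOp_lt hb (Nat.mod_lt _ (by norm_num)) (Nat.mod_lt _ hc)

/-! ### Correctness of the program -/

/-- The values `x` of the work qubits satisfy the equations of the program. -/
structure Solves (m n : ℕ) (x : ℕ → Bool) : Prop where
  zero : x 0 = false
  one : x 1 = true
  eqn : ∀ b < numBlocks m, ∀ k < 24, ∀ p < cols m, x (cell m n b k p) =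
    xor (x (blockOp m n b k p).1) (x (blockOp m n b k p).2.1 && x (blockOp m n b k p).2.2)

/-- The state before the block `b`. -/
def stateAt (m n : ℕ) (x : ℕ → Bool) (b : ℕ) : EuclidState :=
  stateVal (cols m) (fun p => x (stateCell m n b 0 p)) (fun p => x (stateCell m n b 1 p))
    (fun p => x (stateCell m n b 2 p)) (fun p => x (stateCell m n b 3 p))

/-- The state after the block `b`. -/
def outAt (m n : ℕ) (x : ℕ → Bool) (b : ℕ) : EuclidState :=
  stateVal (cols m) (fun p => x (cell m n b 20 p)) (fun p => x (cell m n b 21 p))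
    (fun p => x (cell m n b 22 p)) (fun p => x (cell m n b 23 p))

theorem stateAt_start (x : ℕ → Bool) (ph : ℕ) : stateAt m n x (phaseLen m * ph) =
    stateVal (cols m) (fun p => x (initial m n ph 0 p)) (fun p => x (initial m n ph 1 p))
      (fun p => x (initial m n ph 2 p)) (fun p => x (initial m n ph 3 p)) := by
  simp only [stateAt, stateCell, Nat.mul_mod_right, if_true,
    Nat.mul_div_cancel_left _ (phaseLen_pos (m := m))]

namespace Solves

variable {x : ℕ → Bool} (hx : Solves m n x)

include hx

theorem apply_up (i : ℕ) (w : ℕ → ℕ) (p : ℕ) : x (up i w p) = shiftUp i (fun p => x (w p)) p := by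
  unfold up shiftUp
  split_ifs
  · exact hx.zero
  · rfl

theorem blockEqns {b : ℕ} (hb : b < numBlocks m) :
    BlockEqns (cols m) (shiftAt m b) (fun p => x (stateCell m n b 0 p))
      (fun p => x (stateCell m n b 1 p)) (fun p => x (stateCell m n b 2 p))
      (fun p => x (stateCell m n b 3 p)) (fun k p => x (cell m n b k p)) := by
  have hone : x (if shiftAt m b = 0 then 1 else 0) = decide (shiftAt m b = 0) := by
    split_ifs with h <;> simp [h, hx.zero, hx.one]
  constructor <;> intro p hp <;> rw [hx.eqn b hb _ (by norm_num) p hp] <;>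
    simp only [blockOp, List.getD_cons_zero, List.getD_cons_succ, hx.zero, hx.one, hone,
      hx.apply_up, Bool.and_true, Bool.true_xor, Bool.false_xor]

/-- The block `b` of the program performs the block of the division with its shift. -/
theorem outAt_eq {b : ℕ} (hb : b < numBlocks m)
    (h1 : (stateAt m n x b).r₁ < 2 ^ width m) (h2 : (stateAt m n x b).t₀ < 2 ^ width m)
    (h3 : (stateAt m n x b).t₁ < 2 ^ width m) :
    outAt m n x b = (stateAt m n x b).block (shiftAt m b) := by
  have hW := width_pos (m := m)
  have hi : shiftAt m b ≤ width m - 1 := Nat.sub_le _ _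
  have hp : (2 : ℕ) ^ cols m = 2 ^ width m * 2 ^ (width m - 1) * 2 := by
    rw [mul_assoc, ← pow_succ, ← pow_add]; congr 1; unfold cols; omega
  have hA : ∀ y, y < 2 ^ width m → y * 2 ^ shiftAt m b < 2 ^ width m * 2 ^ (width m - 1) :=
    fun y hy => (Nat.mul_le_mul_left _ (Nat.pow_le_pow_right (by norm_num) hi)).trans_lt
      (Nat.mul_lt_mul_of_pos_right hy (by positivity))
  have hB : 2 ^ width m ≤ 2 ^ width m * 2 ^ (width m - 1) :=
    Nat.le_mul_of_pos_right _ (by positivity)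
  refine (hx.blockEqns hb).stateVal_eq cols_pos ?_ ?_ ?_ ?_
  · change (stateAt m n x b).r₁ * 2 < _; omega
  · have := hA _ h1; change (stateAt m n x b).r₁ * _ < _; omega
  · have := hA _ h3; change (stateAt m n x b).t₁ * _ < _; omega
  · have := hA _ h3
    change (stateAt m n x b).t₀ + (stateAt m n x b).t₁ * _ < _; omega

/-- One phase runs Euclid's algorithm on its initial state. -/
theorem outAt_phase {ph : ℕ} (hph : ph < 3)
    (hS : (stateAt m n x (phaseLen m * ph)).Bounded (width m)) :
    outAt m n x ((ph + 1) * phaseLen m - 1) =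
      EuclidState.next^[2 * width m] (stateAt m n x (phaseLen m * ph)) := by
  have hl := phaseLen_pos (m := m)
  have hnb : ∀ j < phaseLen m, phaseLen m * ph + j < numBlocks m := fun j hj => by
    have := Nat.mul_le_mul_left (phaseLen m) (show ph + 1 ≤ 3 by omega)
    unfold numBlocks; rw [mul_add] at this; omega
  have hshift : ∀ j, shiftAt m (phaseLen m * ph + j) = width m - 1 - j % width m := fun j => by
    unfold shiftAt phaseLen; rw [mul_assoc, Nat.mul_add_mod]
  have key : ∀ j < phaseLen m, stateAt m n x (phaseLen m * ph + j) =
      EuclidState.blocks (width m) (stateAt m n x (phaseLen m * ph)) j ∧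
      outAt m n x (phaseLen m * ph + j) =
      EuclidState.blocks (width m) (stateAt m n x (phaseLen m * ph)) (j + 1) := by
    have step : ∀ j < phaseLen m, stateAt m n x (phaseLen m * ph + j) =
        EuclidState.blocks (width m) (stateAt m n x (phaseLen m * ph)) j →
        outAt m n x (phaseLen m * ph + j) =
        EuclidState.blocks (width m) (stateAt m n x (phaseLen m * ph)) (j + 1) := by
      intro j hj h
      have hb := hS.blocks j
      rw [hx.outAt_eq (hnb j hj) (h ▸ hb.r₁_lt) (h ▸ hb.t₀_lt) (h ▸ hb.t₁_lt), hshift, h]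
      rfl
    intro j
    induction j with
    | zero => exact fun hj => ⟨rfl, step 0 hj rfl⟩
    | succ j ih =>
      intro hj
      have h1 : stateAt m n x (phaseLen m * ph + (j + 1)) =
          outAt m n x (phaseLen m * ph + j) := by
        have : (phaseLen m * ph + (j + 1)) % phaseLen m ≠ 0 := by
          rw [Nat.mul_add_mod, Nat.mod_eq_of_lt hj]; omega
        simp only [stateAt, outAt, stateCell, if_neg this]
        rfl
      have h2 := h1.trans (ih (by omega)).2
      exact ⟨h2, step _ hj h2⟩
  have e1 : (ph + 1) * phaseLen m - 1 = phaseLen m * ph + (phaseLen m - 1) := by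
    rw [add_mul, one_mul, mul_comm]; omega
  rw [e1, (key _ (by omega)).2, Nat.sub_add_cancel hl]
  exact EuclidState.blocks_mul width_pos hS _

theorem bitVal_unit {j : ℕ} (hj : j < cols m) :
    bitVal (fun p => x (if p = j then 1 else 0)) (cols m) = 2 ^ j := by
  rw [← Nat.mod_eq_of_lt (Nat.pow_lt_pow_right (by norm_num : 1 < 2) hj), ← bitVal_testBit]
  refine bitVal_congr fun p _ => ?_
  rw [Nat.testBit_two_pow]
  split_ifs with h
  · simp [hx.one, h]
  · simp [hx.zero, Ne.symm h]

theorem bitVal_zero : bitVal (fun _ => x 0) (cols m) = 0 := by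
  rw [hx.zero]; exact bitVal_false _

/-- Reading the bits of a sample in the reverse order. -/
theorem bitVal_sample {Y k : ℕ} (hY : ∀ i < m, x (Y + i) = k.testBit i) :
    bitVal (fun p => x (if p < m then Y + (m - 1 - p) else 0)) (cols m) =
      revVal k.testBit m := by
  have hlt := revVal_lt k.testBit m
  have hcm : m ≤ cols m := by unfold cols width; omega
  rw [← Nat.mod_eq_of_lt (hlt.trans_le (Nat.pow_le_pow_right (by norm_num) hcm)),
    ← bitVal_testBit]
  refine bitVal_congr fun p _ => ?_
  split_ifs with h
  · rw [hY _ (by omega), testBit_revVal _ h]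
  · rw [hx.zero, Nat.testBit_lt_two_pow]
    exact hlt.trans_le (Nat.pow_le_pow_right (by norm_num) (not_lt.1 h))

theorem bitVal_up {i : ℕ} {w : ℕ → ℕ}
    (h : bitVal (fun p => x (w p)) (cols m) * 2 ^ i < 2 ^ cols m) :
    bitVal (fun p => x (up i w p)) (cols m) = bitVal (fun p => x (w p)) (cols m) * 2 ^ i := by
  simp only [hx.apply_up]
  exact bitVal_shiftUp_of_lt h

/-- A phase that starts with a sample finds the denominator of the fraction next to it. -/
theorem t₁_sample_phase {ph Y k q p : ℕ} (hph : ph < 3)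
    (h0 : ∀ p, initial m n ph 0 p = if p = m then 1 else 0)
    (h1 : ∀ p, initial m n ph 1 p = if p < m then Y + (m - 1 - p) else 0)
    (h2 : ∀ p, initial m n ph 2 p = 0)
    (h3 : ∀ p, initial m n ph 3 p = if p = 0 then 1 else 0)
    (hY : ∀ i < m, x (Y + i) = k.testBit i) (hq : 0 < q) (hqM : q ^ 2 ≤ 2 ^ m)
    (hpq : Nat.Coprime p q)
    (happ : 2 * |(q : ℤ) * revVal k.testBit m - p * (2 ^ m : ℕ)| ≤ q) :
    (outAt m n x ((ph + 1) * phaseLen m - 1)).t₁ = q := by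
  have hW : m < width m := by unfold width; omega
  have hc : m < cols m := by unfold cols; omega
  have hS : stateAt m n x (phaseLen m * ph) = ⟨2 ^ m, revVal k.testBit m, 0, 1⟩ := by
    rw [stateAt_start]
    simp only [h0, h1, h2, h3, stateVal]
    rw [hx.bitVal_unit hc, hx.bitVal_sample hY, hx.bitVal_zero, hx.bitVal_unit cols_pos, pow_zero]
  have hlt := revVal_lt k.testBit m
  have hpow : (2 : ℕ) ^ m < 2 ^ width m := Nat.pow_lt_pow_right (by norm_num) hW
  have hone : 1 < 2 ^ width m := Nat.one_lt_two_pow width_pos.ne'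
  rw [hx.outAt_phase hph, hS]
  · exact EuclidState.t₁_iterate_of_approx (by positivity) (hlt.trans hpow) hq hqM hpq happ
  · rw [hS]
    exact ⟨hpow, hlt.trans hpow, by positivity, hone, by simpa using hpow⟩

/-- The program turns two good samples into the bits of `l - 1`. -/
theorem result {k₁ k₂ q₁ q₂ p₁ p₂ l : ℕ} (hk₁ : ∀ i < m, x (2 + i) = k₁.testBit i)
    (hk₂ : ∀ i < m, x (2 + m + i) = k₂.testBit i) (hl : 0 < l) (hlM : l ^ 2 ≤ 2 ^ m)
    (hlcm : Nat.lcm q₁ q₂ = l) (hpq₁ : Nat.Coprime p₁ q₁) (hpq₂ : Nat.Coprime p₂ q₂)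
    (happ₁ : 2 * |(q₁ : ℤ) * revVal k₁.testBit m - p₁ * (2 ^ m : ℕ)| ≤ q₁)
    (happ₂ : 2 * |(q₂ : ℤ) * revVal k₂.testBit m - p₂ * (2 ^ m : ℕ)| ≤ q₂) (i : ℕ) (hi : i < m) :
    x (cell m n (3 * phaseLen m) 20 (i + (width m - 1))) = (l - 1).testBit i := by
  have hq₁l : q₁ ≤ l := Nat.le_of_dvd hl (hlcm ▸ Nat.dvd_lcm_left _ _)
  have hq₂l : q₂ ≤ l := Nat.le_of_dvd hl (hlcm ▸ Nat.dvd_lcm_right _ _)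
  have hq₁ : 0 < q₁ := Nat.pos_of_ne_zero fun h => by simp [h] at hlcm; omega
  have hq₂ : 0 < q₂ := Nat.pos_of_ne_zero fun h => by simp [h] at hlcm; omega
  have hW : width m = m + m + 2 := by unfold width; ring
  have hWc : width m ≤ cols m := by unfold cols; omega
  have hqq : q₁ * q₂ ≤ 2 ^ m := (Nat.mul_le_mul hq₁l hq₂l).trans (by rwa [← sq])
  have hqm : ∀ q, q ≤ l → q ≤ 2 ^ m := fun q h =>
    h.trans ((Nat.le_self_pow two_ne_zero l).trans hlM)
  have hlW : ∀ y, y ≤ 2 ^ m * 2 ^ m → y < 2 ^ width m := fun y hy => by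
    rw [hW, pow_add, pow_add]
    have : 0 < 2 ^ m * 2 ^ m := by positivity
    omega
  have hlWc : ∀ y, y < 2 ^ width m → y < 2 ^ cols m := fun y hy =>
    hy.trans_le (Nat.pow_le_pow_right (by norm_num) hWc)
  have hq2 : q₂ < 2 ^ width m :=
    hlW _ ((hqm _ hq₂l).trans (Nat.le_mul_of_pos_right _ (by positivity)))
  -- the two denominators
  have o₁ : (outAt m n x (phaseLen m - 1)).t₁ = q₁ := by
    have := hx.t₁_sample_phase (ph := 0) (Y := 2) (by norm_num) (fun _ => rfl) (fun _ => rfl)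
      (fun _ => rfl) (fun _ => rfl) hk₁ hq₁ ((Nat.pow_le_pow_left hq₁l 2).trans hlM) hpq₁ happ₁
    rwa [zero_add, one_mul] at this
  have o₂ : (outAt m n x (2 * phaseLen m - 1)).t₁ = q₂ :=
    hx.t₁_sample_phase (ph := 1) (Y := 2 + m) (by norm_num) (fun _ => rfl) (fun _ => rfl)
      (fun _ => rfl) (fun _ => rfl) hk₂ hq₂ ((Nat.pow_le_pow_left hq₂l 2).trans hlM) hpq₂ happ₂
  have b₁ : bitVal (fun p => x (cell m n (phaseLen m - 1) 23 p)) (cols m) = q₁ := o₁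
  have b₂ : bitVal (fun p => x (cell m n (2 * phaseLen m - 1) 23 p)) (cols m) = q₂ := o₂
  have c₁ : q₁ * 2 ^ m < 2 ^ width m := hlW _ (Nat.mul_le_mul_right _ (hqm _ hq₁l))
  have c₂ : q₂ * 2 ^ m < 2 ^ width m := hlW _ (Nat.mul_le_mul_right _ (hqm _ hq₂l))
  -- their least common multiple
  have hS₂ : stateAt m n x (phaseLen m * 2) = ⟨q₁ * 2 ^ m, q₂ * 2 ^ m, 0, q₂⟩ := by
    rw [stateAt_start]
    change EuclidState.mk (bitVal (fun p => x (up m (cell m n (phaseLen m - 1) 23) p)) _)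
      (bitVal (fun p => x (up m (cell m n (2 * phaseLen m - 1) 23) p)) _)
      (bitVal (fun _ => x 0) _) (bitVal (fun p => x (cell m n (2 * phaseLen m - 1) 23 p)) _) = _
    rw [hx.bitVal_up (by rw [b₁]; exact hlWc _ c₁), hx.bitVal_up (by rw [b₂]; exact hlWc _ c₂),
      hx.bitVal_zero, b₁, b₂]
  have o₃ : (outAt m n x (3 * phaseLen m - 1)).t₁ = l := by
    rw [hx.outAt_phase (ph := 2) (by norm_num), hS₂, EuclidState.t₁_iterate_eq_lcm hq₁ hqq c₂, hlcm]
    rw [hS₂]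
    refine ⟨c₁, c₂, by positivity, hq2, ?_⟩
    simp only [mul_zero, add_zero]
    refine hlW _ ?_
    calc q₁ * 2 ^ m * q₂ = q₁ * q₂ * 2 ^ m := by ring
      _ ≤ _ := Nat.mul_le_mul_right _ hqq
  have b₃ : bitVal (fun p => x (cell m n (3 * phaseLen m - 1) 23 p)) (cols m) = l := o₃
  -- the last block subtracts `2 ^ (width m - 1)`, its largest shift of the number one, from
  -- `l 2 ^ (width m - 1)`; the cofactors zero make it active
  have hl2 : l < 2 ^ width m :=
    hlW _ ((hqm _ le_rfl).trans (Nat.le_mul_of_pos_right _ (by positivity)))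
  have c₃ : l * 2 ^ (width m - 1) < 2 ^ cols m := by
    have : (2 : ℕ) ^ cols m = 2 ^ width m * 2 ^ (width m - 1) * 2 := by
      rw [mul_assoc, ← pow_succ, ← pow_add]; congr 1; unfold cols; omega
    have := Nat.mul_lt_mul_of_pos_right hl2 (show 0 < 2 ^ (width m - 1) by positivity)
    omega
  have hS₃ : stateAt m n x (phaseLen m * 3) = ⟨l * 2 ^ (width m - 1), 1, 0, 0⟩ := by
    rw [stateAt_start]
    change EuclidState.mk
      (bitVal (fun p => x (up (width m - 1) (cell m n (3 * phaseLen m - 1) 23) p)) _)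
      (bitVal (fun p => x (if p = 0 then 1 else 0)) _)
      (bitVal (fun _ => x 0) _) (bitVal (fun _ => x 0) _) = _
    rw [hx.bitVal_up (by rw [b₃]; exact c₃), hx.bitVal_zero, b₃, hx.bitVal_unit cols_pos, pow_zero]
  have hsh : shiftAt m (phaseLen m * 3) = width m - 1 := by
    unfold shiftAt phaseLen; rw [mul_assoc, Nat.mul_mod_right, Nat.sub_zero]
  have hone : 1 < 2 ^ width m := Nat.one_lt_two_pow width_pos.ne'
  have o₄ := hx.outAt_eq (b := phaseLen m * 3) (by unfold numBlocks; omega)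
    (by rw [hS₃]; exact hone) (by rw [hS₃]; positivity) (by rw [hS₃]; positivity)
  have hle : 1 * 2 ^ (width m - 1) ≤ l * 2 ^ (width m - 1) := Nat.mul_le_mul_right _ hl
  rw [hS₃, hsh, EuclidState.block, if_neg (by omega), EuclidState.sub,
    if_pos ⟨show 0 < 2 * 1 by norm_num, hle⟩] at o₄
  have b₄ : bitVal (fun p => x (cell m n (3 * phaseLen m) 20 p)) (cols m) =
      2 ^ (width m - 1) * (l - 1) := by
    have := congrArg EuclidState.r₀ o₄
    rw [mul_comm (phaseLen m)] at this
    refine this.trans ?_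
    simp only [← Nat.sub_mul]
    exact mul_comm _ _
  have := testBit_bitVal (fun p => x (cell m n (3 * phaseLen m) 20 p)) (V := cols m)
    (p := i + (width m - 1)) (by unfold cols; omega)
  rw [← this, b₄, Nat.testBit_two_pow_mul]
  simp

end Solves

end PostProcess

/-! ### Lower bounds for the probabilities -/

/-- A geometric sum whose phases cover at most three quarters of a turn is large. -/
theorem norm_geom_sum_unitPhase_ge {K : ℕ} {ε : ℝ} (h : K * |ε| ≤ 3 / 4) :
    K / (2 * Real.pi) ≤ ‖∑ b ∈ Finset.range K, unitPhase (b * ε)‖ := by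
  have hpi := Real.pi_pos
  have hpi3 := Real.pi_gt_three
  rcases eq_or_ne ε 0 with rfl | hε
  · simp only [mul_zero, unitPhase_zero, Finset.sum_const, Finset.card_range, nsmul_eq_mul,
      mul_one, RCLike.norm_natCast]
    exact div_le_self (by positivity) (by linarith)
  have hw : ∀ t : ℝ, ‖unitPhase t - 1‖ = 2 * |Real.sin (Real.pi * t)| := fun t => by
    have e : unitPhase t = Complex.exp (Complex.I * ((2 * Real.pi * t : ℝ) : ℂ)) := by
      rw [unitPhase]; congr 1; push_cast; ring
    rw [e, Complex.norm_exp_I_mul_ofReal_sub_one, Real.norm_eq_abs, abs_mul, abs_two]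
    congr 3; ring
  have hpow : ∀ b : ℕ, unitPhase (b * ε) = unitPhase ε ^ b := fun b => by
    rw [unitPhase, unitPhase, ← Complex.exp_nat_mul]; congr 1; push_cast; ring
  have hgeom : ‖∑ b ∈ Finset.range K, unitPhase (b * ε)‖ * ‖unitPhase ε - 1‖ =
      ‖unitPhase (K * ε) - 1‖ := by
    simp only [hpow]
    rw [← norm_mul, geom_sum_mul]
  rw [hw, hw] at hgeom
  have hup : |Real.sin (Real.pi * ε)| ≤ Real.pi * |ε| := by
    refine Real.abs_sin_le_abs.trans ?_
    rw [abs_mul, abs_of_pos hpi]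
  have hlow : K * |ε| / 2 ≤ |Real.sin (Real.pi * (K * ε))| := by
    obtain ⟨x, hx⟩ : ∃ x, x = Real.pi * (K * |ε|) := ⟨_, rfl⟩
    have hx0 : 0 ≤ x := by rw [hx]; positivity
    have hx1 : x ≤ Real.pi * (3 / 4) := by rw [hx]; gcongr
    have h1 := Real.mul_le_sin (x := x / 2) (by linarith) (by linarith)
    have h2 := Real.one_sub_mul_le_cos (x := x / 2) (by linarith) (by linarith)
    have h3 : 2 / Real.pi * (x / 2) = K * |ε| := by rw [hx]; field_simp
    rw [h3] at h1 h2
    have h4 : K * |ε| / 2 ≤ Real.sin x := by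
      have e : Real.sin x = 2 * Real.sin (x / 2) * Real.cos (x / 2) := by
        rw [← Real.sin_two_mul]; congr 1; ring
      have h5 : 0 ≤ K * |ε| := by positivity
      have h6 : (1 : ℝ) / 4 ≤ Real.cos (x / 2) := by linarith
      rw [e]
      nlinarith
    have h7 : |Real.sin (Real.pi * (K * ε))| = |Real.sin x| := by
      rcases abs_choice ε with h' | h'
      · rw [hx, h']
      · rw [hx, h', show Real.pi * (K * -ε) = -(Real.pi * (K * ε)) by ring, Real.sin_neg, abs_neg]
    rw [h7]
    exact h4.trans (le_abs_self _)
  have hε' : 0 < |ε| := abs_pos.2 hε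
  have hfin : K * |ε| ≤ ‖∑ b ∈ Finset.range K, unitPhase (b * ε)‖ * (2 * (Real.pi * |ε|)) := by
    calc K * |ε| ≤ 2 * |Real.sin (Real.pi * (K * ε))| := by linarith
      _ = _ := hgeom.symm
      _ ≤ _ := by gcongr
  rw [div_le_iff₀ (by positivity)]
  refine le_of_mul_le_mul_right ?_ hε'
  linarith

theorem sum_filter_mod {β : Type*} [AddCommMonoid β] {M l t : ℕ} (ht : t < l) (htM : t < M)
    (f : ℕ → β) : ∑ z ∈ (Finset.range M).filter (fun z => z % l = t), f z =
      ∑ b ∈ Finset.range ((M - 1 - t) / l + 1), f (t + l * b) := by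
  have hl : 0 < l := by omega
  symm
  refine Finset.sum_bij (fun b _ => t + l * b) ?_ ?_ ?_ (fun _ _ => rfl)
  · intro b hb
    have hb := Nat.le_of_lt_succ (Finset.mem_range.1 hb)
    rw [Nat.le_div_iff_mul_le hl, mul_comm] at hb
    rw [Finset.mem_filter, Finset.mem_range, Nat.add_mul_mod_self_left, Nat.mod_eq_of_lt ht]
    exact ⟨by omega, rfl⟩
  · intro b _ b' _ h
    exact Nat.eq_of_mul_eq_mul_left hl (by omega)
  · intro z hz
    rw [Finset.mem_filter, Finset.mem_range] at hz
    have := Nat.mod_add_div z l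
    refine ⟨z / l, ?_, by omega⟩
    rw [Finset.mem_range, Nat.lt_succ_iff, Nat.le_div_iff_mul_le hl, mul_comm]
    omega

/-- The integer nearest to `j M / l`. -/
def nearest (M l j : ℕ) : ℕ := (2 * (j * M) + l) / (2 * l)

theorem nearest_approx {M l : ℕ} (hl : 0 < l) (j : ℕ) :
    2 * |(l : ℤ) * nearest M l j - j * M| ≤ l := by
  have h1 := Nat.div_add_mod (2 * (j * M) + l) (2 * l)
  have h2 := Nat.mod_lt (2 * (j * M) + l) (show 0 < 2 * l by omega)
  have h3 : 2 * l * nearest M l j + (2 * (j * M) + l) % (2 * l) = 2 * (j * M) + l := h1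
  generalize (2 * (j * M) + l) % (2 * l) = r at *
  have h4 : 2 * ((l : ℤ) * nearest M l j) + r = 2 * (j * M) + l := by
    rw [← mul_assoc]; exact_mod_cast h3
  generalize (l : ℤ) * nearest M l j = A at *
  generalize (j : ℤ) * M = B at *
  have : |A - B| ≤ (l : ℤ) / 2 := abs_le.2 ⟨by omega, by omega⟩
  omega

theorem nearest_lt {M l j : ℕ} (hj : j < l) (hlM : l ≤ M) : nearest M l j < M := by
  have := Nat.mul_le_mul_right M (Nat.succ_le_of_lt hj)
  rw [nearest, Nat.div_lt_iff_lt_mul (by omega)]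
  rw [Nat.succ_mul] at this
  have e : M * (2 * l) = 2 * (l * M) := by ring
  omega

theorem nearest_strictMono {M l : ℕ} (hl : 0 < l) (hlM : l ≤ M) : StrictMono (nearest M l) := by
  refine strictMono_nat_of_lt_succ fun j => ?_
  rw [nearest, nearest, Nat.lt_iff_add_one_le]
  have : (2 * (j * M) + l) / (2 * l) + 1 = (2 * (j * M) + l + 2 * l) / (2 * l) := by
    rw [Nat.add_div_right _ (by omega)]
  rw [this]
  refine Nat.div_le_div_right ?_
  rw [add_mul j 1, one_mul]; omega

section Orbit

variable {m n : ℕ} {s : Finset (Fin n) → Finset (Fin n)} {l : ℕ}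

theorem iterate_eq_iterate_iff_mod (hl : l = Function.minimalPeriod s ∅) (hpos : 0 < l) {t : ℕ}
    (ht : t < l) (z : ℕ) : s^[z] ∅ = s^[t] ∅ ↔ z % l = t := by
  rw [← Function.iterate_mod_minimalPeriod_eq (n := z), ← hl]
  constructor
  · intro h
    exact Function.iterate_injOn_Iio_minimalPeriod (f := s) (x := ∅)
      (by rw [Set.mem_Iio, ← hl]; exact Nat.mod_lt z hpos) (by rw [Set.mem_Iio, ← hl]; exact ht) h
  · rintro rfl; rfl

/-- The exponents `z < 2 ^ m` with `s^z(∅) = s^t(∅)` form an arithmetic progression with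
difference `l`. At a frequency next to `j 2 ^ m / l` their phases nearly agree, so the amplitude
is at least a constant times what it would be if they agreed. -/
theorem norm_sampleAmp_ge (hl : l = Function.minimalPeriod s ∅) (hlM : l ^ 2 ≤ 2 ^ m) {j t : ℕ}
    (hj : j < l) (ht : t < l) :
    (((Finset.range (2 ^ m)).filter fun z => z % l = t).card : ℝ) / (2 * Real.pi * 2 ^ m) ≤
      ‖QCircuit.sampleAmp m s (nearest (2 ^ m) l j) (s^[t] ∅)‖ := by
  have hpos : 0 < l := by omega
  have hlM' : l ≤ 2 ^ m := (Nat.le_self_pow two_ne_zero l).trans hlM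
  have htM : t < 2 ^ m := by omega
  obtain ⟨K, hK⟩ : ∃ K, K = (2 ^ m - 1 - t) / l + 1 := ⟨_, rfl⟩
  have hcard : ((Finset.range (2 ^ m)).filter fun z => z % l = t).card = K := by
    rw [Finset.card_eq_sum_ones, sum_filter_mod ht htM, hK]; simp
  have hKl : (K - 1) * l < 2 ^ m := by
    rw [hK, Nat.add_sub_cancel]
    have := Nat.div_mul_le_self (2 ^ m - 1 - t) l
    omega
  obtain ⟨y, hy⟩ : ∃ y, y = nearest (2 ^ m) l j := ⟨_, rfl⟩
  have happ := nearest_approx (M := 2 ^ m) hpos j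
  rw [← hy] at happ ⊢
  obtain ⟨ε, hε⟩ : ∃ ε : ℝ, ε = ((l : ℝ) * y - j * 2 ^ m) / 2 ^ m := ⟨_, rfl⟩
  have hM0 : (0 : ℝ) < 2 ^ m := by positivity
  have hε' : 2 * (|ε| * 2 ^ m) ≤ l := by
    rw [hε, abs_div, abs_of_pos hM0, div_mul_cancel₀ _ hM0.ne']
    exact_mod_cast happ
  -- the phases cover at most three quarters of a turn
  have hKε : K * |ε| ≤ 3 / 4 := by
    rcases Nat.lt_or_ge l 2 with h2 | h2
    · have hl1 : l = 1 := by omega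
      have : y = 0 := by
        rw [hy, nearest, hl1]; have : j = 0 := by omega
        subst this; simp
      have : ε = 0 := by
        rw [hε, this]; have : j = 0 := by omega
        subst this; simp
      rw [this]; norm_num
    · have h3 : 2 * l ≤ 2 ^ m := by nlinarith
      have h4 : (2 * l : ℝ) ≤ 2 ^ m := by exact_mod_cast h3
      have h5 : K * l ≤ 2 ^ m + l := by
        obtain ⟨K', rfl⟩ : ∃ K', K = K' + 1 := ⟨_, hK⟩
        rw [Nat.add_sub_cancel] at hKl
        rw [Nat.succ_mul]; omega
      have h6 : (K * l : ℝ) ≤ 2 ^ m + l := by exact_mod_cast h5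
      have h7 : 2 * (K * |ε|) * 2 ^ m ≤ 3 / 2 * 2 ^ m := by
        calc 2 * (K * |ε|) * 2 ^ m = K * (2 * (|ε| * 2 ^ m)) := by ring
          _ ≤ K * l := by gcongr
          _ ≤ _ := by linarith
      have := le_of_mul_le_mul_right h7 hM0
      linarith
  have hsum : ∑ z ∈ (Finset.range (2 ^ m)).filter (fun z => s^[z] ∅ = s^[t] ∅),
      unitPhase (z * y / 2 ^ m) =
      unitPhase (t * y / 2 ^ m) * ∑ b ∈ Finset.range K, unitPhase (b * ε) := by
    simp only [iterate_eq_iterate_iff_mod hl hpos ht]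
    rw [sum_filter_mod ht htM, ← hK, Finset.mul_sum]
    refine Finset.sum_congr rfl fun b _ => ?_
    have e : (((t + l * b : ℕ) : ℝ) * y / 2 ^ m) = t * y / 2 ^ m + b * ε + (j * b : ℕ) := by
      rw [hε]; push_cast; field_simp; ring
    rw [e, unitPhase_add, unitPhase_natCast, mul_one, unitPhase_add]
  have hnorm : ‖unitPhase (t * y / 2 ^ m)‖ = 1 := by
    rw [unitPhase, show 2 * Real.pi * Complex.I * ((t * y / 2 ^ m : ℝ) : ℂ) =
      ((2 * Real.pi * (t * y / 2 ^ m) : ℝ) : ℂ) * Complex.I by push_cast; ring,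
      Complex.norm_exp_ofReal_mul_I]
  rw [QCircuit.sampleAmp, hsum, norm_mul, norm_mul, hnorm, one_mul, norm_inv, norm_pow,
    Complex.norm_two, hcard, ← div_div, div_eq_inv_mul]
  exact mul_le_mul_of_nonneg_left (norm_geom_sum_unitPhase_ge hKε) (by positivity)

/-- The probability of the Fourier coefficient next to `j 2 ^ m / l` is at least a constant
fraction of `1 / l`. -/
theorem sum_norm_sampleAmp_sq_ge (hl : l = Function.minimalPeriod s ∅) (hlM : l ^ 2 ≤ 2 ^ m) {j : ℕ}
    (hj : j < l) : 1 / (4 * Real.pi ^ 2 * l) ≤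
      ∑ t ∈ Finset.range l, ‖QCircuit.sampleAmp m s (nearest (2 ^ m) l j) (s^[t] ∅)‖ ^ 2 := by
  have hpos : 0 < l := by omega
  have hpi := Real.pi_pos
  have hl0 : (0 : ℝ) < l := by exact_mod_cast hpos
  have hM0 : (0 : ℝ) < 2 ^ m := by positivity
  set c : ℕ → ℝ := fun t => (((Finset.range (2 ^ m)).filter fun z => z % l = t).card : ℝ) with hc
  have hsum : ∑ t ∈ Finset.range l, c t = 2 ^ m := by
    have := Finset.card_eq_sum_card_fiberwise (f := fun z => z % l) (s := Finset.range (2 ^ m))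
      (t := Finset.range l) (fun z _ => by simpa using Nat.mod_lt z hpos)
    rw [Finset.card_range] at this
    simp only [hc]
    exact_mod_cast this.symm
  -- Cauchy–Schwarz over the `l` residue classes
  have hcs := sq_sum_le_card_mul_sum_sq (s := Finset.range l) (f := c)
  rw [hsum, Finset.card_range] at hcs
  calc 1 / (4 * Real.pi ^ 2 * l) = (2 ^ m) ^ 2 / (l * (2 * Real.pi * 2 ^ m) ^ 2) := by
        field_simp; norm_num
    _ ≤ (l * ∑ t ∈ Finset.range l, c t ^ 2) / (l * (2 * Real.pi * 2 ^ m) ^ 2) := by gcongr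
    _ = ∑ t ∈ Finset.range l, (c t / (2 * Real.pi * 2 ^ m)) ^ 2 := by
        rw [mul_div_mul_left _ _ hl0.ne', Finset.sum_div]
        simp only [div_pow]
    _ ≤ _ := by
        refine Finset.sum_le_sum fun t ht => ?_
        have := norm_sampleAmp_ge hl hlM hj (Finset.mem_range.1 ht)
        gcongr

end Orbit

/-- At least a quarter of all pairs have no common divisor with `l`, as the pairs divisible by
`d` are a fraction of `1 / d²` of all and `∑_{d ≥ 2} 1 / d² < 3 / 4`. -/
theorem card_coprime_pairs_ge {l : ℕ} (hl : 0 < l) : (l : ℝ) ^ 2 / 4 ≤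
    (((Finset.range l ×ˢ Finset.range l).filter fun j =>
      Nat.gcd (Nat.gcd j.1 j.2) l = 1).card : ℝ) := by
  have hl0 : (0 : ℝ) < l := by exact_mod_cast hl
  set S := Finset.range l ×ˢ Finset.range l
  have hdiv : ∀ d ∈ Finset.Icc 2 l, (((S.filter fun j => d ∣ l ∧ d ∣ j.1 ∧ d ∣ j.2).card : ℕ) : ℝ) ≤
      l ^ 2 * ((d : ℝ) ^ 2)⁻¹ := by
    intro d hd
    have hd0 : 0 < d := by have := (Finset.mem_Icc.1 hd).1; omega
    by_cases hdl : d ∣ l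
    · obtain ⟨e, rfl⟩ := hdl
      have hsub : (S.filter fun j => d ∣ d * e ∧ d ∣ j.1 ∧ d ∣ j.2) ⊆
          (Finset.range e ×ˢ Finset.range e).image fun j => (d * j.1, d * j.2) := by
        rintro ⟨a, b⟩ hab
        simp only [S, Finset.mem_filter, Finset.mem_product, Finset.mem_range] at hab
        obtain ⟨⟨ha, hb⟩, -, ⟨a, rfl⟩, ⟨b, rfl⟩⟩ := hab
        exact Finset.mem_image.2 ⟨(a, b), by
          simpa using ⟨lt_of_mul_lt_mul_left ha hd0.le, lt_of_mul_lt_mul_left hb hd0.le⟩, rfl⟩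
      have := (Finset.card_le_card hsub).trans Finset.card_image_le
      rw [Finset.card_product, Finset.card_range] at this
      have hd0' : (d : ℝ) ≠ 0 := by exact_mod_cast hd0.ne'
      calc _ ≤ ((e * e : ℕ) : ℝ) := by exact_mod_cast this
        _ = _ := by push_cast; field_simp
    · simp only [hdl, false_and, Finset.filter_false, Finset.card_empty, Nat.cast_zero]
      positivity
  have hbad : (S.filter fun j => ¬ Nat.gcd (Nat.gcd j.1 j.2) l = 1) ⊆
      (Finset.Icc 2 l).biUnion fun d => S.filter fun j => d ∣ l ∧ d ∣ j.1 ∧ d ∣ j.2 := by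
    intro j hj
    rw [Finset.mem_filter] at hj
    have hg : 0 < Nat.gcd (Nat.gcd j.1 j.2) l := Nat.gcd_pos_of_pos_right _ hl
    refine Finset.mem_biUnion.2 ⟨Nat.gcd (Nat.gcd j.1 j.2) l, Finset.mem_Icc.2
      ⟨by omega, Nat.le_of_dvd hl (Nat.gcd_dvd_right _ _)⟩, Finset.mem_filter.2 ⟨hj.1,
      Nat.gcd_dvd_right _ _, (Nat.gcd_dvd_left _ _).trans (Nat.gcd_dvd_left _ _),
      (Nat.gcd_dvd_left _ _).trans (Nat.gcd_dvd_right _ _)⟩⟩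
  have hsq : ∑ d ∈ Finset.Icc 2 l, ((d : ℝ) ^ 2)⁻¹ ≤ 3 / 4 := by
    rcases Nat.lt_or_ge l 2 with h | h
    · rw [Finset.Icc_eq_empty (by omega)]; norm_num
    · rw [← Finset.add_sum_Ioc_eq_sum_Icc h]
      have h1 := sum_Ioc_inv_sq_le_sub (α := ℝ) two_ne_zero h
      have h2 : (0 : ℝ) ≤ (l : ℝ)⁻¹ := by positivity
      norm_num at h1 ⊢
      linarith
  have hle :
      ((S.filter fun j => ¬ Nat.gcd (Nat.gcd j.1 j.2) l = 1).card : ℝ) ≤ l ^ 2 * (3 / 4) := by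
    calc _ ≤ ((((Finset.Icc 2 l).biUnion fun d =>
            S.filter fun j => d ∣ l ∧ d ∣ j.1 ∧ d ∣ j.2).card : ℕ) : ℝ) := by
          exact_mod_cast Finset.card_le_card hbad
      _ ≤ ∑ d ∈ Finset.Icc 2 l, (((S.filter fun j => d ∣ l ∧ d ∣ j.1 ∧ d ∣ j.2).card : ℕ) : ℝ) := by
          exact_mod_cast Finset.card_biUnion_le
      _ ≤ ∑ d ∈ Finset.Icc 2 l, (l : ℝ) ^ 2 * ((d : ℝ) ^ 2)⁻¹ := Finset.sum_le_sum hdiv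
      _ ≤ _ := by rw [← Finset.mul_sum]; gcongr
  have htot := Finset.card_filter_add_card_filter_not (s := S)
    (fun j => Nat.gcd (Nat.gcd j.1 j.2) l = 1)
  have hS : S.card = l * l := by simp [S]
  rw [hS] at htot
  have : ((((S.filter fun j => Nat.gcd (Nat.gcd j.1 j.2) l = 1).card : ℕ) : ℝ) +
    ((S.filter fun j => ¬ Nat.gcd (Nat.gcd j.1 j.2) l = 1).card : ℕ)) = l * l := by
    exact_mod_cast htot
  nlinarith

/-! ### The circuit -/

namespace QCircuit

variable {m n a : ℕ} {U : Matrix (OracleWire m n → Bool) (OracleWire m n → Bool) ℂ}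
  {s : Finset (Fin n) → Finset (Fin n)}

/-- Sample once, and move the sample and the orbit element to the work qubits from `Y` and
from `Z` on. -/
def sampleStep (m n a Y Z : ℕ) : QCircuit m n a :=
  fourierSample m n a ++ (moveGates m n a 0 Y m ++ moveGates m n a 2 Z n)

theorem computes_moves {Y Z : ℕ} (hY : Y + m ≤ Z) (hZ : Z + n ≤ a) :
    Computes U (moveGates m n a 0 Y m ++ moveGates m n a 2 Z n)
      (moved 2 Z n ∘ moved 0 Y m) :=
  (computes_moveGates (by norm_num) (fun _ hi => isWire_first hi) (by omega)).append
    (computes_moveGates (by norm_num) (fun i hi => by simpa [IsWire] using hi) hZ)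

theorem moved_moved_first {Y Z i : ℕ} (hi : i < m) (f : ℕ × ℕ → Bool) :
    (moved 2 Z n ∘ moved 0 Y m) f (0, i) = f (3, Y + i) := by
  simp [moved, hi]

theorem moved_moved_second {Y Z i : ℕ} (f : ℕ × ℕ → Bool) :
    (moved 2 Z n ∘ moved 0 Y m) f (1, i) = f (1, i) := by
  simp [moved]

theorem moved_moved_third {Y Z i : ℕ} (hY : Y + m ≤ Z) (hi : i < n) (f : ℕ × ℕ → Bool) :
    (moved 2 Z n ∘ moved 0 Y m) f (2, i) = f (3, Z + i) := by
  have : ¬ (Z + i < Y + m) := by omega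
  simp [moved, hi, this]

theorem moved_moved_work {Y Z i : ℕ} (hY : Y + m ≤ Z) (f : ℕ × ℕ → Bool) :
    (moved 2 Z n ∘ moved 0 Y m) f (3, i) =
      if Y ≤ i ∧ i < Y + m then xor (f (3, i)) (f (0, i - Y))
      else if Z ≤ i ∧ i < Z + n then xor (f (3, i)) (f (2, i - Z)) else f (3, i) := by
  by_cases h1 : Y ≤ i ∧ i < Y + m
  · have : ¬ (Z ≤ i ∧ i < Z + n) := by omega
    simp [moved, h1, this]
  · simp [moved, h1]

theorem ket_eq_of_readWire {k k' : ℕ} (hk : k < 2 ^ m) (hk' : k' < 2 ^ m)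
    {u u' v v' : Finset (Fin n)} {r : Fin a → Bool}
    (h1 : ∀ i < m, readWire (ket m k' u' v' r) (0, i) = k.testBit i)
    (h2 : ∀ i (hi : i < n), readWire (ket m k' u' v' r) (1, i) = decide (⟨i, hi⟩ ∈ u))
    (h3 : ∀ i (hi : i < n), readWire (ket m k' u' v' r) (2, i) = decide (⟨i, hi⟩ ∈ v)) :
    k' = k ∧ u' = u ∧ v' = v := by
  refine ketBits_inj hk' hk (funext fun q => ?_)
  rcases q with i | i | i
  · have := h1 i i.2
    rw [readWire_ket_first i.2] at this
    simpa [ketBits] using this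
  · have := h2 i i.2
    rw [readWire_ket_second i.2] at this
    simpa [ketBits] using this
  · have := h3 i i.2
    rw [readWire_ket_third i.2] at this
    simpa [ketBits] using this

/-- The value of a work qubit, `false` beyond the last one. -/
def workBit (r : Fin a → Bool) (i : ℕ) : Bool := if h : i < a then r ⟨i, h⟩ else false

theorem readWire_work (k : ℕ) (u v : Finset (Fin n)) (r : Fin a → Bool) (i : ℕ) :
    readWire (ket m k u v r) (3, i) = workBit r i := by
  unfold workBit
  split_ifs with h
  · exact readWire_ket_work h _ _ _ _
  · exact readWire_of_not_isWire _ (by simpa [IsWire] using h)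

/-- One sampling step multiplies the amplitudes by those of the sample. -/
theorem applyTo_sampleStep (hU : CalculatesPowers U s) {Y Z : ℕ} (hY : Y + m ≤ Z)
    (hZ : Z + n ≤ a) {ψ : QState m n a} {r : Fin a → Bool}
    (hψ : ∀ k < 2 ^ m, ∀ v, (k, v) ≠ (0, ∅) → ψ (ket m k ∅ v r) = 0)
    (hrY : ∀ i < m, workBit r (Y + i) = false) (hrZ : ∀ i < n, workBit r (Z + i) = false)
    (k : ℕ) (v : Finset (Fin n)) :
    ∃ r' : Fin a → Bool, (∀ i < m, workBit r' (Y + i) = k.testBit i) ∧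
      (∀ i (hi : i < n), workBit r' (Z + i) = decide (⟨i, hi⟩ ∈ v)) ∧
      (∀ i, ¬ (Y ≤ i ∧ i < Y + m) → ¬ (Z ≤ i ∧ i < Z + n) → workBit r' i = workBit r i) ∧
      applyTo (sampleStep m n a Y Z) U ψ (ket m 0 ∅ ∅ r') =
        sampleAmp m s (revVal k.testBit m) v * ψ (ket m 0 ∅ ∅ r) := by
  obtain ⟨F, hF, hF'⟩ := computes_moves (U := U) (m := m) (n := n) hY hZ
  obtain ⟨k', hk', u', v', r', hr'⟩ := exists_ket (F (ket m k ∅ v r))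
  have hread := hF (ket m k ∅ v r)
  rw [hr'] at hread
  obtain ⟨rfl, rfl, rfl⟩ : k' = 0 ∧ u' = ∅ ∧ v' = ∅ := by
    refine ket_eq_of_readWire (r := r') (by positivity) hk' (fun i hi => ?_) (fun i hi => ?_)
      (fun i hi => ?_) <;> rw [hread]
    · rw [moved_moved_first hi, readWire_work, hrY i hi, Nat.zero_testBit]
    · rw [moved_moved_second, readWire_ket_second hi]
    · rw [moved_moved_third hY hi, readWire_work, hrZ i hi]; simp
  have hw : ∀ i, workBit r' i = _ := fun i => by
    rw [← readWire_work 0 ∅ ∅ r' i (m := m), hread, moved_moved_work hY, readWire_work]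
  refine ⟨r', fun i hi => ?_, fun i hi => ?_, fun i h1 h2 => ?_, ?_⟩
  · rw [hw, if_pos (by omega), hrY i hi, Nat.add_sub_cancel_left, readWire_ket_first hi,
      Bool.false_xor]
  · rw [hw, if_neg (by omega), if_pos (by omega), hrZ i hi, Nat.add_sub_cancel_left,
      readWire_ket_third hi, Bool.false_xor]
  · rw [hw, if_neg h1, if_neg h2]
  · rw [sampleStep, applyTo_append, ← hr', hF']
    exact applyTo_fourierSample_of_support hU hψ k v

/-- After one sampling step the first and the third register are zero, as the sample has been
moved to work qubits that were zero before. -/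
theorem applyTo_sampleStep_eq_zero (hU : CalculatesPowers U s) {Y Z : ℕ} (hY : Y + m ≤ Z)
    (hZ : Z + n ≤ a) {ψ : QState m n a}
    (hψ : ∀ k u v (r : Fin a → Bool), r ≠ (fun _ => false) → ψ (ket m k u v r) = 0)
    {k : ℕ} (hk : k < 2 ^ m) (u v : Finset (Fin n)) (r : Fin a → Bool)
    (h : (k, v) ≠ (0, ∅)) : applyTo (sampleStep m n a Y Z) U ψ (ket m k u v r) = 0 := by
  obtain ⟨F, hF, hF'⟩ := computes_moves (U := U) (m := m) (n := n) hY hZ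
  -- the amplitude of `x` determines that of `F x`, so `F` permutes the basis states
  have hinj : Function.Injective F := fun x y hxy => by
    by_contra hne
    have h1 := hF' (Pi.single x 1) x
    rw [hxy, hF', Pi.single_eq_same, Pi.single_eq_of_ne (Ne.symm hne)] at h1
    exact zero_ne_one h1
  obtain ⟨x, hx⟩ := Finite.surjective_of_injective hinj (ket m k u v r)
  obtain ⟨k', hk', u', v', r', rfl⟩ := exists_ket x
  rw [sampleStep, applyTo_append, ← hx, hF']
  refine applyTo_fourierSample_eq_zero hU (fun k₀ u₀ v₀ => hψ k₀ u₀ v₀ r' ?_) _ _ _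
  rintro rfl
  have hread := hF (ket m k' u' v' fun _ => false)
  rw [hx] at hread
  have hfalse : ∀ i, workBit (fun _ : Fin a => false) i = false := fun i => by simp [workBit]
  refine h (Prod.ext_iff.2 ?_)
  obtain ⟨h1, -, h3⟩ := ket_eq_of_readWire (k := 0) (k' := k) (u := u) (u' := u) (v := ∅) (v' := v)
    (r := r) (by positivity) hk
    (fun i hi => by rw [hread, moved_moved_first hi, readWire_work, hfalse, Nat.zero_testBit])
    (fun i hi => readWire_ket_second hi _ _ _ _)
    (fun i hi => by rw [hread, moved_moved_third hY hi, readWire_work, hfalse]; simp)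
  exact ⟨h1, h3⟩

end QCircuit

namespace PostProcess

open QCircuit

/-- The number of work qubits. -/
def work (m n : ℕ) : ℕ := base m n + size m

/-- The work qubit of the `i`-th bit of the result `l - 1`. -/
def resultCell (m n i : ℕ) : ℕ := cell m n (3 * phaseLen m) 20 (i + (width m - 1))

/-- The circuit: two samples, the classical computation of `l - 1`, and a final query at
`l - 1`. -/
def circuit (m n : ℕ) : QCircuit m n (work m n) :=
  sampleStep m n (work m n) 2 (2 + 2 * m) ++
    (sampleStep m n (work m n) (2 + m) (2 + 2 * m + n) ++
      ((notGate m n (work m n) (3, 1) ++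
        program m n (work m n) (base m n) (op m n) (size m) ++
        copyGates m n (work m n) (resultCell m n) m) ++ [QGate.oracle]))

variable {m n : ℕ} {U : Matrix (OracleWire m n → Bool) (OracleWire m n → Bool) ℂ}
  {s : Finset (Fin n) → Finset (Fin n)}

theorem resultCell_lt {i : ℕ} (hi : i < m) : resultCell m n i < work m n :=
  Nat.add_lt_add_left (cellIdx_lt_size (by unfold numBlocks; omega) (by norm_num)
    (by unfold cols width; omega)) _

/-- The classical part of the circuit keeps the second and the third register and the samples,
satisfies the equations of the program, and adds the result to the first register. -/
theorem computes_postprocess : ∃ g, Computes U (notGate m n (work m n) (3, 1) ++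
      program m n (work m n) (base m n) (op m n) (size m) ++
      copyGates m n (work m n) (resultCell m n) m) g ∧
    ∀ f, f (3, 0) = false → f (3, 1) = false → (∀ t, base m n ≤ t → f (3, t) = false) →
      (∀ i < n, g f (1, i) = f (1, i) ∧ g f (2, i) = f (2, i)) ∧
      (∀ t, 2 ≤ t → t < base m n → g f (3, t) = f (3, t)) ∧
      Solves m n (fun t => g f (3, t)) ∧
      ∀ i < m, g f (0, i) = xor (f (0, i)) (g f (3, resultCell m n i)) := by
  have hbase : base m n = 2 + 2 * m + 2 * n := rfl
  obtain ⟨g, hg, hg'⟩ := computes_program (U := U) (m := m) (n := n) (A := work m n)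
    (op := op m n) le_rfl op_lt
  have h1 : IsWire m n (work m n) (3, 1) := show 1 < work m n by unfold work; omega
  refine ⟨_, ((computes_notGate h1).append hg).append
    (computes_copyGates le_rfl fun i hi => resultCell_lt hi), fun f f0 f1 fb => ?_⟩
  have hsame : ∀ w : ℕ × ℕ, w ≠ (3, 1) → ¬ (w.1 = 3 ∧ base m n ≤ w.2) →
      g (Function.update f (3, 1) (!f (3, 1))) w = f w := fun w hw hw' => by
    rw [(hg' _ fun t ht => by
      rw [Function.update_of_ne (by simp; omega), fb t ht]).1 w (by tauto),
      Function.update_of_ne hw]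
  have heqn := (hg' (Function.update f (3, 1) (!f (3, 1))) fun t ht => by
      rw [Function.update_of_ne (by simp; omega), fb t ht])
  simp only [Function.comp_apply]
  refine ⟨fun i hi => ⟨?_, ?_⟩, fun t h2 ht => ?_, ⟨?_, ?_, fun b hb k hk p hp => ?_⟩,
    fun i hi => ?_⟩
  · rw [if_neg (by simp), hsame _ (by simp) (by simp)]
  · rw [if_neg (by simp), hsame _ (by simp) (by simp)]
  · rw [if_neg (by simp), hsame _ (by simp; omega) (by simp; omega)]
  · rw [if_neg (by simp), hsame _ (by simp) (by simp; omega), f0]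
  · rw [if_neg (by simp), heqn.1 _ (by simp; omega), Function.update_self, f1]; rfl
  · simp only [show ¬ ((3 : ℕ) = 0) by norm_num, false_and, if_false]
    have := heqn.2 _ (cellIdx_lt_size hb hk hp)
    rwa [op_cellIdx hk hp] at this
  · rw [if_pos (by simpa using hi), if_neg (by simp), hsame _ (by simp) (by simp)]

/-- The amplitude of a correct result together with two good samples: the classical part maps
basis states to basis states, so the amplitudes of the two samples are multiplied. -/
theorem exists_run_circuit_eq (hU : CalculatesPowers U s) {k₁ k₂ q₁ q₂ p₁ p₂ l : ℕ}
    (v₁ v₂ : Finset (Fin n)) (hl : 0 < l)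
    (hlM : l ^ 2 ≤ 2 ^ m)
    (hlcm : Nat.lcm q₁ q₂ = l) (hpq₁ : Nat.Coprime p₁ q₁) (hpq₂ : Nat.Coprime p₂ q₂)
    (happ₁ : 2 * |(q₁ : ℤ) * revVal k₁.testBit m - p₁ * (2 ^ m : ℕ)| ≤ q₁)
    (happ₂ : 2 * |(q₂ : ℤ) * revVal k₂.testBit m - p₂ * (2 ^ m : ℕ)| ≤ q₂) :
    ∃ r : Fin (work m n) → Bool, (∀ i < m, workBit r (2 + i) = k₁.testBit i) ∧
      (∀ i < m, workBit r (2 + m + i) = k₂.testBit i) ∧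
      (∀ i (hi : i < n), workBit r (2 + 2 * m + i) = decide (⟨i, hi⟩ ∈ v₁)) ∧
      (∀ i (hi : i < n), workBit r (2 + 2 * m + n + i) = decide (⟨i, hi⟩ ∈ v₂)) ∧
      QCircuit.run (circuit m n) U (ket m (l - 1) ∅ (s^[l - 1] ∅) r) =
        sampleAmp m s (revVal k₂.testBit m) v₂ * sampleAmp m s (revVal k₁.testBit m) v₁ := by
  have hbase : base m n = 2 + 2 * m + 2 * n := rfl
  have hwork : base m n ≤ work m n := Nat.le_add_right _ _
  have hfalse : ∀ i, workBit (fun _ : Fin (work m n) => false) i = false := fun i => by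
    simp [workBit]
  have hket0 : ket m 0 ∅ ∅ (fun _ : Fin (work m n) => false) =
      (fun _ => false : CircuitWire m n (work m n) → Bool) := by
    funext q; rcases q with (i | i | i) | i <;> simp [ket, ketBits]
  have hinit : ∀ k < 2 ^ m, ∀ (u v : Finset (Fin n)) (r : Fin (work m n) → Bool),
      (k, u, v, r) ≠ (0, ∅, ∅, fun _ => false) →
      (Pi.single (fun _ => false) 1 : QState m n (work m n)) (ket m k u v r) = 0 := by
    intro k hk u v r h
    rw [Pi.single_eq_of_ne]
    rw [← hket0]
    intro he
    obtain ⟨rfl, rfl, rfl, rfl⟩ := ket_inj hk (by positivity) he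
    exact h rfl
  have hinit' : ∀ k (u v : Finset (Fin n)) (r : Fin (work m n) → Bool), r ≠ (fun _ => false) →
      (Pi.single (fun _ => false) 1 : QState m n (work m n)) (ket m k u v r) = 0 := by
    intro k u v r h
    rw [Pi.single_eq_of_ne]
    intro he
    exact h (funext fun i => by simpa [ket] using congrFun he (Sum.inr i))
  -- the two sampling steps
  obtain ⟨r₁, a1, a2, a3, a4⟩ := applyTo_sampleStep (a := work m n) hU (Y := 2) (Z := 2 + 2 * m)
    (by omega) (by omega) (r := fun _ => false)
    (fun k hk v h => hinit k hk ∅ v _ fun h' => h (by simp_all)) (fun i _ => hfalse _)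
    (fun i _ => hfalse _) k₁ v₁
  obtain ⟨r₂, b1, b2, b3, b4⟩ := applyTo_sampleStep (a := work m n) hU (Y := 2 + m)
    (Z := 2 + 2 * m + n) (by omega) (by omega) (r := r₁)
    (fun k hk v h => applyTo_sampleStep_eq_zero hU (Y := 2) (Z := 2 + 2 * m) (by omega) (by omega)
      hinit' hk ∅ v r₁ h)
    (fun i hi => by rw [a3 _ (by omega) (by omega), hfalse])
    (fun i hi => by rw [a3 _ (by omega) (by omega), hfalse]) k₂ v₂
  -- the classical computation
  obtain ⟨g, ⟨F, hF, hF'⟩, hg⟩ := computes_postprocess (U := U) (m := m) (n := n)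
  have hrest : ∀ t, t < 2 ∨ base m n ≤ t → readWire (ket (n := n) m 0 ∅ ∅ r₂) (3, t) = false := by
    intro t ht
    rw [readWire_work, b3 _ (by omega) (by omega), a3 _ (by omega) (by omega), hfalse]
  obtain ⟨g1, g2, g3, g4⟩ := hg (readWire (ket (n := n) m 0 ∅ ∅ r₂)) (hrest 0 (by omega))
    (hrest 1 (by omega)) fun t ht => hrest t (Or.inr ht)
  have hw₁ : ∀ i < m, g (readWire (ket (n := n) m 0 ∅ ∅ r₂)) (3, 2 + i) = k₁.testBit i :=
    fun i hi => by
      rw [g2 _ (by omega) (by omega), readWire_work, b3 _ (by omega) (by omega), a1 i hi]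
  have hw₂ : ∀ i < m, g (readWire (ket (n := n) m 0 ∅ ∅ r₂)) (3, 2 + m + i) = k₂.testBit i :=
    fun i hi => by rw [g2 _ (by omega) (by omega), readWire_work, b1 i hi]
  have hres := g3.result hw₁ hw₂ hl hlM hlcm hpq₁ hpq₂ happ₁ happ₂
  have hlm : l - 1 < 2 ^ m := by
    have := (Nat.le_self_pow two_ne_zero l).trans hlM; omega
  obtain ⟨k, hk, u, v, r, hr⟩ := exists_ket (F (ket m 0 ∅ ∅ r₂))
  have hread := hF (ket m 0 ∅ ∅ r₂)
  rw [hr] at hread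
  obtain ⟨rfl, rfl, rfl⟩ : k = l - 1 ∧ u = ∅ ∧ v = ∅ := by
    refine ket_eq_of_readWire (r := r) hlm hk (fun i hi => ?_) (fun i hi => ?_)
      (fun i hi => ?_) <;> rw [hread]
    · rw [g4 i hi, readWire_ket_first hi, Nat.zero_testBit, Bool.false_xor]
      exact hres i hi
    · rw [(g1 i hi).1, readWire_ket_second hi]
    · rw [(g1 i hi).2, readWire_ket_third hi]
  have hw : ∀ t, workBit r t = g (readWire (ket (n := n) m 0 ∅ ∅ r₂)) (3, t) := fun t => by
    rw [← hread, readWire_work]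
  refine ⟨r, fun i hi => by rw [hw, hw₁ i hi], fun i hi => by rw [hw, hw₂ i hi],
    fun i hi => ?_, fun i hi => ?_, ?_⟩
  · rw [hw, g2 _ (by omega) (by omega), readWire_work, b3 _ (by omega) (by omega), a2 i hi]
  · rw [hw, g2 _ (by omega) (by omega), readWire_work, b2 i hi]
  · change applyTo (circuit m n) U (Pi.single (fun _ => false) 1) _ = _
    rw [circuit, applyTo_append, applyTo_append, applyTo_append, applyTo_oracle hU hk,
      symmDiff_self, Finset.bot_eq_empty, ← hr, hF', b4, a4, hket0, Pi.single_eq_same, mul_one]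

/-! ### The probability of success -/

/-- The denominators of the reduced fractions `j₁ / l` and `j₂ / l` determine `l` if `j₁`, `j₂` and
`l` have no common divisor. -/
theorem lcm_div_gcd {l j₁ j₂ : ℕ} (h : Nat.gcd (Nat.gcd j₁ j₂) l = 1) :
    Nat.lcm (l / Nat.gcd j₁ l) (l / Nat.gcd j₂ l) = l := by
  have d₁ := Nat.gcd_dvd_right j₁ l
  have d₂ := Nat.gcd_dvd_right j₂ l
  refine Nat.dvd_antisymm (Nat.lcm_dvd (Nat.div_dvd_of_dvd d₁) (Nat.div_dvd_of_dvd d₂)) ?_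
  set L := Nat.lcm (l / Nat.gcd j₁ l) (l / Nat.gcd j₂ l)
  have e₁ : l ∣ Nat.gcd j₁ l * L := by
    conv_lhs => rw [← Nat.mul_div_cancel' d₁]
    exact Nat.mul_dvd_mul_left _ (Nat.dvd_lcm_left _ _)
  have e₂ : l ∣ Nat.gcd j₂ l * L := by
    conv_lhs => rw [← Nat.mul_div_cancel' d₂]
    exact Nat.mul_dvd_mul_left _ (Nat.dvd_lcm_right _ _)
  have e₃ := Nat.dvd_gcd e₁ e₂
  rw [Nat.gcd_mul_right] at e₃
  have e₄ : Nat.gcd (Nat.gcd j₁ l) (Nat.gcd j₂ l) = 1 := by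
    rw [← Nat.dvd_one, ← h]
    exact Nat.dvd_gcd (Nat.dvd_gcd ((Nat.gcd_dvd_left _ _).trans (Nat.gcd_dvd_left _ _))
      ((Nat.gcd_dvd_right _ _).trans (Nat.gcd_dvd_left _ _)))
      ((Nat.gcd_dvd_left _ _).trans (Nat.gcd_dvd_right _ _))
  rwa [e₄, one_mul] at e₃

/-- The approximation of a sample by `j / l`, for the reduced fraction. -/
theorem reduced_approx {l j y M : ℕ} (hl : 0 < l)
    (h : 2 * |(l : ℤ) * y - j * M| ≤ l) :
    2 * |((l / Nat.gcd j l : ℕ) : ℤ) * y - (j / Nat.gcd j l : ℕ) * M| ≤ (l / Nat.gcd j l : ℕ) := by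
  have hg : 0 < Nat.gcd j l := Nat.gcd_pos_of_pos_right _ hl
  have e₁ := Nat.mul_div_cancel' (Nat.gcd_dvd_right j l)
  have e₂ := Nat.mul_div_cancel' (Nat.gcd_dvd_left j l)
  generalize l / Nat.gcd j l = q at *
  generalize j / Nat.gcd j l = p at *
  generalize Nat.gcd j l = g at *
  subst e₁ e₂
  have e : ((g * q : ℕ) : ℤ) * y - (g * p : ℕ) * M = g * (q * y - p * M) := by push_cast; ring
  rw [e, abs_mul, Nat.abs_cast] at h
  have hg' : (0 : ℤ) < g := by exact_mod_cast hg
  refine le_of_mul_le_mul_left ?_ hg'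
  push_cast at h
  linarith

/-- The circuit succeeds with constant probability. The good outcomes are the pairs of
frequencies next to `j₁ 2 ^ m / l` and `j₂ 2 ^ m / l` such that `j₁`, `j₂`, `l` have no common
divisor. There are at least `l² / 4` such pairs, and each has at least the probability
`(1 / (4 π² l))²`. -/
theorem outputProb_circuit_ge (hU : CalculatesPowers U s) {l : ℕ}
    (hl : l = Function.minimalPeriod s ∅) (hpos : 0 < l) (hlM : l ^ 2 ≤ 2 ^ m) :
    1 / (64 * Real.pi ^ 4) ≤ QCircuit.outputProb (circuit m n) U (l - 1) (s^[l - 1] ∅) := by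
  classical
  have hlM' : l ≤ 2 ^ m := (Nat.le_self_pow two_ne_zero l).trans hlM
  obtain ⟨y, hy⟩ : ∃ y, y = nearest (2 ^ m) l := ⟨_, rfl⟩
  have hylt : ∀ j < l, y j < 2 ^ m := fun j hj => hy ▸ nearest_lt hj hlM'
  obtain ⟨J, hJ⟩ : ∃ J, J = (Finset.range l ×ˢ Finset.range l).filter fun j =>
    Nat.gcd (Nat.gcd j.1 j.2) l = 1 := ⟨_, rfl⟩
  have hmem : ∀ j ∈ J, j.1 < l ∧ j.2 < l ∧ Nat.gcd (Nat.gcd j.1 j.2) l = 1 := fun j hj => by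
    simpa [hJ, and_assoc] using hj
  -- the basis states that record two good samples
  have hex : ∀ p : (ℕ × ℕ) × ℕ × ℕ, ∃ r : Fin (work m n) → Bool, p.1 ∈ J →
      (∀ i < m, workBit r (2 + i) = (revVal (y p.1.1).testBit m).testBit i) ∧
      (∀ i < m, workBit r (2 + m + i) = (revVal (y p.1.2).testBit m).testBit i) ∧
      (∀ i (hi : i < n), workBit r (2 + 2 * m + i) = decide (⟨i, hi⟩ ∈ s^[p.2.1] ∅)) ∧
      (∀ i (hi : i < n), workBit r (2 + 2 * m + n + i) = decide (⟨i, hi⟩ ∈ s^[p.2.2] ∅)) ∧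
      QCircuit.run (circuit m n) U (ket m (l - 1) ∅ (s^[l - 1] ∅) r) =
        sampleAmp m s (y p.1.2) (s^[p.2.2] ∅) * sampleAmp m s (y p.1.1) (s^[p.2.1] ∅) := by
    intro p
    by_cases hp : p.1 ∈ J
    · obtain ⟨h1, h2, h3⟩ := hmem _ hp
      have happ : ∀ j < l, 2 * |((l / Nat.gcd j l : ℕ) : ℤ) *
          revVal (revVal (y j).testBit m).testBit m - (j / Nat.gcd j l : ℕ) * (2 ^ m : ℕ)| ≤
          (l / Nat.gcd j l : ℕ) := fun j hj => by
        rw [revVal_revVal (hylt j hj)]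
        exact reduced_approx hpos (hy ▸ nearest_approx hpos j)
      have hcop : ∀ j, Nat.Coprime (j / Nat.gcd j l) (l / Nat.gcd j l) := fun j =>
        Nat.coprime_div_gcd_div_gcd (Nat.gcd_pos_of_pos_right _ hpos)
      have := exists_run_circuit_eq hU (k₁ := revVal (y p.1.1).testBit m)
        (k₂ := revVal (y p.1.2).testBit m) (s^[p.2.1] ∅) (s^[p.2.2] ∅) hpos hlM (lcm_div_gcd h3)
        (hcop _) (hcop _) (happ _ h1) (happ _ h2)
      rw [revVal_revVal (hylt _ h1), revVal_revVal (hylt _ h2)] at this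
      obtain ⟨r, hr⟩ := this
      exact ⟨r, fun _ => hr⟩
    · exact ⟨fun _ => false, fun h => absurd h hp⟩
  choose r hr using hex
  obtain ⟨P, hP⟩ : ∃ P, P = J ×ˢ (Finset.range l ×ˢ Finset.range l) := ⟨_, rfl⟩
  have hPm : ∀ p ∈ P, p.1 ∈ J ∧ p.2.1 < l ∧ p.2.2 < l := fun p hp => by
    simpa [hP] using hp
  have hrinj : ∀ p ∈ P, ∀ p' ∈ P, r p = r p' → p = p' := by
    intro p hp p' hp' he
    obtain ⟨hpJ, ht1, ht2⟩ := hPm p hp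
    obtain ⟨hpJ', ht1', ht2'⟩ := hPm p' hp'
    obtain ⟨e1, e2, e3, e4, -⟩ := hr p hpJ
    obtain ⟨f1, f2, f3, f4, -⟩ := hr p' hpJ'
    rw [← he] at f1 f2 f3 f4
    obtain ⟨h1, h2, -⟩ := hmem _ hpJ
    obtain ⟨h1', h2', -⟩ := hmem _ hpJ'
    have hj : ∀ j j', j < l → j' < l → (∀ i < m, (revVal (y j).testBit m).testBit i =
        (revVal (y j').testBit m).testBit i) → j = j' := by
      intro j j' hj hj' h
      have := revVal_congr h
      rw [revVal_revVal (hylt j hj), revVal_revVal (hylt j' hj'), hy] at this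
      exact (nearest_strictMono hpos hlM').injective this
    have hv : ∀ t t', t < l → t' < l → (∀ i : Fin n, i ∈ s^[t] ∅ ↔ i ∈ s^[t'] ∅) → t = t' := by
      intro t t' ht ht' h
      have := (iterate_eq_iterate_iff_mod hl hpos ht' t).1 (Finset.ext h)
      rwa [Nat.mod_eq_of_lt ht] at this
    refine Prod.ext (Prod.ext ?_ ?_) (Prod.ext ?_ ?_)
    · exact hj _ _ h1 h1' fun i hi => by rw [← e1 i hi, f1 i hi]
    · exact hj _ _ h2 h2' fun i hi => by rw [← e2 i hi, f2 i hi]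
    · exact hv _ _ ht1 ht1' fun i => by
        have := (e3 i i.2).symm.trans (f3 i i.2); simpa using this
    · exact hv _ _ ht2 ht2' fun i => by
        have := (e4 i i.2).symm.trans (f4 i i.2); simpa using this
  have hsingle : ∀ j < l, 1 / (4 * Real.pi ^ 2 * l) ≤
      ∑ t ∈ Finset.range l, ‖sampleAmp m s (y j) (s^[t] ∅)‖ ^ 2 := fun j hj =>
    hy ▸ sum_norm_sampleAmp_sq_ge hl hlM hj
  have hl0 : (0 : ℝ) < l := by exact_mod_cast hpos
  have hpi := Real.pi_pos
  calc 1 / (64 * Real.pi ^ 4) = (l : ℝ) ^ 2 / 4 * (1 / (4 * Real.pi ^ 2 * l)) ^ 2 := by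
        field_simp; norm_num
    _ ≤ J.card * (1 / (4 * Real.pi ^ 2 * l)) ^ 2 := by
        gcongr; rw [hJ]; exact card_coprime_pairs_ge hpos
    _ = ∑ j ∈ J, 1 / (4 * Real.pi ^ 2 * l) * (1 / (4 * Real.pi ^ 2 * l)) := by
        rw [Finset.sum_const, nsmul_eq_mul, sq]
    _ ≤ ∑ j ∈ J, (∑ t ∈ Finset.range l, ‖sampleAmp m s (y j.1) (s^[t] ∅)‖ ^ 2) *
          ∑ t ∈ Finset.range l, ‖sampleAmp m s (y j.2) (s^[t] ∅)‖ ^ 2 := by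
        refine Finset.sum_le_sum fun j hj => ?_
        exact mul_le_mul (hsingle _ (hmem j hj).1) (hsingle _ (hmem j hj).2.1) (by positivity)
          (Finset.sum_nonneg fun _ _ => by positivity)
    _ = ∑ p ∈ P, ‖QCircuit.run (circuit m n) U (ket m (l - 1) ∅ (s^[l - 1] ∅) (r p))‖ ^ 2 := by
        rw [hP, Finset.sum_product]
        refine Finset.sum_congr rfl fun j hj => ?_
        rw [Finset.sum_mul_sum, ← Finset.sum_product']
        refine Finset.sum_congr rfl fun t _ => ?_
        rw [(hr (j, t) hj).2.2.2.2, norm_mul, mul_pow, mul_comm]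
    _ = ∑ x ∈ P.image fun p => ket m (l - 1) ∅ (s^[l - 1] ∅) (r p),
          ‖QCircuit.run (circuit m n) U x‖ ^ 2 := by
        rw [Finset.sum_image]
        intro p hp p' hp' he
        exact hrinj p hp p' hp' (ket_inj (by omega) (by omega) he).2.2.2
    _ = ∑ x ∈ P.image fun p => ket m (l - 1) ∅ (s^[l - 1] ∅) (r p),
          if ∃ (u : Finset (Fin n)) (r : Fin (work m n) → Bool),
            x = Sum.elim (ketBits m (l - 1) u (s^[l - 1] ∅)) r
          then ‖QCircuit.run (circuit m n) U x‖ ^ 2 else 0 := by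
        refine Finset.sum_congr rfl fun x hx => ?_
        obtain ⟨p, -, rfl⟩ := Finset.mem_image.1 hx
        rw [if_pos ⟨∅, r p, rfl⟩]
    _ ≤ QCircuit.outputProb (circuit m n) U (l - 1) (s^[l - 1] ∅) := by
        unfold QCircuit.outputProb
        refine (Finset.sum_le_sum_of_subset_of_nonneg (Finset.subset_univ _)
          fun x _ _ => ?_).trans (le_of_eq (Finset.sum_congr rfl fun x _ => ?_))
        · split_ifs <;> positivity
        · congr

end PostProcess

/-! ### Computability of the family of circuits -/

-- With these rules `fun_prop` proves that functions are primitive recursive.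
attribute [fun_prop] Primrec Primrec.id Primrec.const Primrec.comp

namespace Primrec

variable {α β γ σ : Type*} [Primcodable α] [Primcodable β] [Primcodable γ] [Primcodable σ]

@[fun_prop]
theorem fst_comp {f : α → β × γ} (hf : Primrec f) : Primrec fun x => (f x).1 := fst.comp hf

@[fun_prop]
theorem snd_comp {f : α → β × γ} (hf : Primrec f) : Primrec fun x => (f x).2 := snd.comp hf

@[fun_prop]
theorem prod_mk {f : α → β} {g : α → γ} (hf : Primrec f) (hg : Primrec g) :
    Primrec fun x => (f x, g x) := hf.pair hg

@[fun_prop]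
theorem nat_add_comp {f g : α → ℕ} (hf : Primrec f) (hg : Primrec g) :
    Primrec fun x => f x + g x := nat_add.comp hf hg

@[fun_prop]
theorem nat_sub_comp {f g : α → ℕ} (hf : Primrec f) (hg : Primrec g) :
    Primrec fun x => f x - g x := nat_sub.comp hf hg

@[fun_prop]
theorem nat_mul_comp {f g : α → ℕ} (hf : Primrec f) (hg : Primrec g) :
    Primrec fun x => f x * g x := nat_mul.comp hf hg

@[fun_prop]
theorem nat_div_comp {f g : α → ℕ} (hf : Primrec f) (hg : Primrec g) :
    Primrec fun x => f x / g x := nat_div.comp hf hg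

@[fun_prop]
theorem nat_mod_comp {f g : α → ℕ} (hf : Primrec f) (hg : Primrec g) :
    Primrec fun x => f x % g x := nat_mod.comp hf hg

@[fun_prop]
theorem list_cons_comp {f : α → β} {g : α → List β} (hf : Primrec f) (hg : Primrec g) :
    Primrec fun x => f x :: g x := list_cons.comp hf hg

@[fun_prop]
theorem list_append_comp {f g : α → List β} (hf : Primrec f) (hg : Primrec g) :
    Primrec fun x => f x ++ g x := list_append.comp hf hg

@[fun_prop]
theorem list_getD_comp {f : α → List β} {g : α → ℕ} (hf : Primrec f) (hg : Primrec g) (d : β) :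
    Primrec fun x => (f x).getD (g x) d := (list_getD d).comp hf hg

@[fun_prop]
theorem list_range_comp {f : α → ℕ} (hf : Primrec f) :
    Primrec fun x => List.range (f x) := list_range.comp hf

@[fun_prop]
theorem list_reverse_comp {f : α → List β} (hf : Primrec f) :
    Primrec fun x => (f x).reverse := list_reverse.comp hf

@[fun_prop]
theorem list_flatMap_uncurried {f : α → List β} {g : α → β → List σ} (hf : Primrec f)
    (hg : Primrec fun x : α × β => g x.1 x.2) : Primrec fun x => (f x).flatMap (g x) :=
  list_flatMap hf hg

@[fun_prop]
theorem ite_lt {f g : α → ℕ} {h k : α → σ} (hf : Primrec f) (hg : Primrec g)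
    (hh : Primrec h) (hk : Primrec k) : Primrec fun x => if f x < g x then h x else k x :=
  Primrec.ite (nat_lt.comp hf hg) hh hk

@[fun_prop]
theorem ite_eq [DecidableEq β] {f g : α → β} {h k : α → σ} (hf : Primrec f) (hg : Primrec g)
    (hh : Primrec h) (hk : Primrec k) : Primrec fun x => if f x = g x then h x else k x :=
  Primrec.ite (Primrec.eq.comp hf hg) hh hk

@[fun_prop]
theorem ite_isWire {m n a : α → ℕ} {w : α → ℕ × ℕ} {h k : α → σ} (hm : Primrec m)
    (hn : Primrec n) (ha : Primrec a) (hw : Primrec w) (hh : Primrec h) (hk : Primrec k) :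
    Primrec fun x => if IsWire (m x) (n x) (a x) (w x) then h x else k x :=
  show Primrec fun x =>
    if (w x).2 < [m x, n x, n x, a x].getD (w x).1 0 then h x else k x by fun_prop

end Primrec

namespace QCircuit

theorem code_append {m n a : ℕ} (C D : QCircuit m n a) : code (C ++ D) = code C ++ code D :=
  List.map_append

theorem code_flatMap {m n a : ℕ} {β : Type*} (l : List β) (f : β → QCircuit m n a) :
    code (l.flatMap f) = l.flatMap fun i => code (f i) := List.map_flatMap

theorem code_oracle {m n a : ℕ} : code ([QGate.oracle] : QCircuit m n a) = [(5, 0, [])] := rfl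

theorem toWire_eq_none {m n a : ℕ} {w : ℕ × ℕ} (h : ¬ IsWire m n a w) : toWire m n a w = none := by
  rw [isWire_iff] at h
  exact Option.eq_none_iff_forall_ne_some.2 fun q hq => h ⟨q, hq⟩

theorem code_hGate (m n a : ℕ) (w : ℕ × ℕ) :
    code (hGate m n a w) = if IsWire m n a w then [(0, 0, [w])] else [] := by
  split_ifs with h
  · obtain ⟨q, hq⟩ := isWire_iff.1 h
    simp [hGate, hq, code, QGate.code, wireCode_of_toWire hq]
  · simp [hGate, toWire_eq_none h, code]

theorem code_phaseGate (m n a j : ℕ) (w : ℕ × ℕ) :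
    code (phaseGate m n a j w) = if IsWire m n a w then [(1, j, [w])] else [] := by
  split_ifs with h
  · obtain ⟨q, hq⟩ := isWire_iff.1 h
    simp [phaseGate, hq, code, QGate.code, wireCode_of_toWire hq]
  · simp [phaseGate, toWire_eq_none h, code]

theorem code_phaseInvGate (m n a j : ℕ) (w : ℕ × ℕ) :
    code (phaseInvGate m n a j w) = if IsWire m n a w then [(2, j, [w])] else [] := by
  split_ifs with h
  · obtain ⟨q, hq⟩ := isWire_iff.1 h
    simp [phaseInvGate, hq, code, QGate.code, wireCode_of_toWire hq]
  · simp [phaseInvGate, toWire_eq_none h, code]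

theorem code_cnotGate (m n a : ℕ) (c t : ℕ × ℕ) : code (cnotGate m n a c t) =
    if IsWire m n a c then if IsWire m n a t then if c = t then [] else [(3, 0, [c, t])]
    else [] else [] := by
  by_cases hc : IsWire m n a c
  · by_cases ht : IsWire m n a t
    · obtain ⟨c', hc'⟩ := isWire_iff.1 hc
      obtain ⟨t', ht'⟩ := isWire_iff.1 ht
      obtain rfl := wireCode_of_toWire hc'
      obtain rfl := wireCode_of_toWire ht'
      by_cases h : c' = t' <;>
        simp [cnotGate, toWire_wireCode, hc, ht, h, code, QGate.code, wireCode_injective.eq_iff]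
    · simp [cnotGate, toWire_eq_none ht, ht, code]
  · simp [cnotGate, toWire_eq_none hc, hc, code]

theorem code_toffoliGate (m n a : ℕ) (c d t : ℕ × ℕ) : code (toffoliGate m n a c d t) =
    if IsWire m n a c then if IsWire m n a d then if IsWire m n a t then
      if c = d then [] else if c = t then [] else if d = t then [] else [(4, 0, [c, d, t])]
    else [] else [] else [] := by
  by_cases hc : IsWire m n a c
  · by_cases hd : IsWire m n a d
    · by_cases ht : IsWire m n a t
      · obtain ⟨c', hc'⟩ := isWire_iff.1 hc
        obtain ⟨d', hd'⟩ := isWire_iff.1 hd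
        obtain ⟨t', ht'⟩ := isWire_iff.1 ht
        obtain rfl := wireCode_of_toWire hc'
        obtain rfl := wireCode_of_toWire hd'
        obtain rfl := wireCode_of_toWire ht'
        by_cases h1 : c' = d' <;> by_cases h2 : c' = t' <;> by_cases h3 : d' = t' <;>
          simp [toffoliGate, toWire_wireCode, hc, hd, ht, h1, h2, h3, code, QGate.code,
            wireCode_injective.eq_iff]
      · simp [toffoliGate, toWire_eq_none ht, ht, code]
    · simp [toffoliGate, toWire_eq_none hd, hd, code]
  · simp [toffoliGate, toWire_eq_none hc, hc, code]

theorem code_ite {m n a : ℕ} (p : Prop) [Decidable p] (C D : QCircuit m n a) :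
    code (if p then C else D) = if p then code C else code D := apply_ite _ _ _ _

section Primrec

variable {α : Type*} [Primcodable α] {m n a : α → ℕ}

theorem primrec_code_cphase {j : α → ℕ} {c t : α → ℕ × ℕ} (hm : Primrec m) (hn : Primrec n)
    (ha : Primrec a) (hj : Primrec j) (hc : Primrec c) (ht : Primrec t) :
    Primrec fun x => code (cphase (m x) (n x) (a x) (j x) (c x) (t x)) := by
  simp only [cphase, code_append, code_phaseGate, code_phaseInvGate, code_cnotGate]
  fun_prop

theorem primrec_code_qft {s : α → ℕ} (hm : Primrec m) (hn : Primrec n) (ha : Primrec a)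
    (hs : Primrec s) : Primrec fun x => code (qft (m x) (n x) (a x) (s x)) := by
  simp only [qft, qftPhases, code_append, code_flatMap, code_hGate]
  have := primrec_code_cphase (α := (α × ℕ) × ℕ) (m := fun x => m x.1.1) (n := fun x => n x.1.1)
    (a := fun x => a x.1.1) (j := fun x => x.1.2 + 1 - x.2) (c := fun x => (0, x.1.2))
    (t := fun x => (0, x.2)) (by fun_prop) (by fun_prop) (by fun_prop) (by fun_prop)
    (by fun_prop) (by fun_prop)
  refine Primrec.list_flatMap_uncurried (by fun_prop) (Primrec.list_append_comp (by fun_prop) ?_)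
  exact Primrec.list_flatMap_uncurried (by fun_prop) this

theorem primrec_code_sampleStep {Y Z : α → ℕ} (hm : Primrec m) (hn : Primrec n) (ha : Primrec a)
    (hY : Primrec Y) (hZ : Primrec Z) :
    Primrec fun x => code (sampleStep (m x) (n x) (a x) (Y x) (Z x)) := by
  have := primrec_code_qft hm hn ha hm
  simp only [sampleStep, fourierSample, moveGates, code_append, code_flatMap, code_oracle,
    code_cnotGate]
  fun_prop

theorem primrec_code_program {b N : α → ℕ} {o : α → ℕ → ℕ × ℕ × ℕ} (hm : Primrec m)
    (hn : Primrec n) (ha : Primrec a) (hb : Primrec b) (hN : Primrec N)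
    (ho : Primrec fun x : α × ℕ => o x.1 x.2) :
    Primrec fun x => code (program (m x) (n x) (a x) (b x) (o x) (N x)) := by
  simp only [program, opGates, code_append, code_flatMap, code_ite, code_cnotGate,
    code_toffoliGate]
  fun_prop

end Primrec

end QCircuit

namespace PostProcess

open QCircuit

section Primrec

variable {α : Type*} [Primcodable α] {m n b k p : α → ℕ}

@[fun_prop]
theorem primrec_width (hm : Primrec m) : Primrec fun x => width (m x) := by
  unfold width; fun_prop

@[fun_prop]
theorem primrec_cols (hm : Primrec m) : Primrec fun x => cols (m x) := by
  unfold cols; fun_prop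

@[fun_prop]
theorem primrec_phaseLen (hm : Primrec m) : Primrec fun x => phaseLen (m x) := by
  unfold phaseLen; fun_prop

@[fun_prop]
theorem primrec_base (hm : Primrec m) (hn : Primrec n) : Primrec fun x => base (m x) (n x) := by
  unfold base; fun_prop

@[fun_prop]
theorem primrec_size (hm : Primrec m) : Primrec fun x => size (m x) := by
  unfold size numBlocks; fun_prop

@[fun_prop]
theorem primrec_work (hm : Primrec m) (hn : Primrec n) : Primrec fun x => work (m x) (n x) := by
  unfold work; fun_prop

@[fun_prop]
theorem primrec_cell (hm : Primrec m) (hn : Primrec n) (hb : Primrec b) (hk : Primrec k)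
    (hp : Primrec p) : Primrec fun x => cell (m x) (n x) (b x) (k x) (p x) := by
  unfold cell cellIdx; fun_prop

@[fun_prop]
theorem primrec_initial (hm : Primrec m) (hn : Primrec n) (hb : Primrec b) (hk : Primrec k)
    (hp : Primrec p) : Primrec fun x => initial (m x) (n x) (b x) (k x) (p x) := by
  unfold initial up; fun_prop

@[fun_prop]
theorem primrec_stateCell (hm : Primrec m) (hn : Primrec n) (hb : Primrec b) (hk : Primrec k)
    (hp : Primrec p) : Primrec fun x => stateCell (m x) (n x) (b x) (k x) (p x) := by
  unfold stateCell; fun_prop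

@[fun_prop]
theorem primrec_shiftAt (hm : Primrec m) (hb : Primrec b) :
    Primrec fun x => shiftAt (m x) (b x) := by
  unfold shiftAt; fun_prop

@[fun_prop]
theorem primrec_blockOp (hm : Primrec m) (hn : Primrec n) (hb : Primrec b) (hk : Primrec k)
    (hp : Primrec p) : Primrec fun x => blockOp (m x) (n x) (b x) (k x) (p x) := by
  unfold blockOp up; fun_prop

@[fun_prop]
theorem primrec_op (hm : Primrec m) (hn : Primrec n) (hb : Primrec b) :
    Primrec fun x => op (m x) (n x) (b x) := by
  unfold op; fun_prop

end Primrec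

theorem computable_work : Computable fun q : ℕ × ℕ => work q.1 q.2 :=
  Primrec.to_comp (by fun_prop)

theorem computable_code_circuit :
    Computable fun q : ℕ × ℕ => QCircuit.code (circuit q.1 q.2) := by
  have hm : Primrec fun q : ℕ × ℕ => q.1 := by fun_prop
  have hn : Primrec fun q : ℕ × ℕ => q.2 := by fun_prop
  have ha := primrec_work hm hn
  have h1 := primrec_code_sampleStep hm hn ha (Y := fun _ => 2) (Z := fun q => 2 + 2 * q.1)
    (by fun_prop) (by fun_prop)
  have h2 := primrec_code_sampleStep hm hn ha (Y := fun q => 2 + q.1)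
    (Z := fun q => 2 + 2 * q.1 + q.2) (by fun_prop) (by fun_prop)
  have h3 := primrec_code_program hm hn ha (primrec_base hm hn) (primrec_size hm)
    (o := fun q => op q.1 q.2) (by fun_prop)
  refine Primrec.to_comp ?_
  simp only [circuit, notGate, copyGates, resultCell, code_append, code_flatMap, code_hGate,
    code_phaseGate, code_cnotGate, code_oracle]
  fun_prop

end PostProcess

/-! ### Numbers of gates and of queries -/

namespace QCircuit

variable {m n a : ℕ}

/-- The circuit has at most `N` gates, at most `q` of which are queries. -/
def HasSize (C : QCircuit m n a) (N q : ℕ) : Prop := C.length ≤ N ∧ queries C ≤ q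

theorem HasSize.append {C D : QCircuit m n a} {N N' q q' : ℕ} (hC : HasSize C N q)
    (hD : HasSize D N' q') : HasSize (C ++ D) (N + N') (q + q') := by
  refine ⟨by rw [List.length_append]; exact add_le_add hC.1 hD.1, ?_⟩
  unfold queries
  rw [List.countP_append]
  exact add_le_add hC.2 hD.2

theorem HasSize.flatMap_range {N B : ℕ} {f : ℕ → QCircuit m n a}
    (h : ∀ i < N, HasSize (f i) B 0) : HasSize ((List.range N).flatMap f) (N * B) 0 := by
  induction N with
  | zero => simp [HasSize, queries]
  | succ N ih =>
    rw [List.range_succ, List.flatMap_append, Nat.succ_mul]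
    rw [List.flatMap_singleton]
    exact (ih fun i hi => h i (by omega)).append (h N (by omega))

theorem HasSize.oracle : HasSize ([QGate.oracle] : QCircuit m n a) 1 1 :=
  ⟨le_rfl, le_rfl⟩

theorem hasSize_hGate (w : ℕ × ℕ) : HasSize (hGate m n a w) 1 0 := by
  unfold hGate HasSize queries
  cases toWire m n a w <;> simp [QGate.isQuery]

theorem hasSize_phaseGate (j : ℕ) (w : ℕ × ℕ) : HasSize (phaseGate m n a j w) 1 0 := by
  unfold phaseGate HasSize queries
  cases toWire m n a w <;> simp [QGate.isQuery]

theorem hasSize_phaseInvGate (j : ℕ) (w : ℕ × ℕ) : HasSize (phaseInvGate m n a j w) 1 0 := by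
  unfold phaseInvGate HasSize queries
  cases toWire m n a w <;> simp [QGate.isQuery]

theorem hasSize_cnotGate (c t : ℕ × ℕ) : HasSize (cnotGate m n a c t) 1 0 := by
  unfold cnotGate HasSize queries
  split
  · split_ifs <;> simp [QGate.isQuery]
  · simp

theorem hasSize_toffoliGate (c d t : ℕ × ℕ) : HasSize (toffoliGate m n a c d t) 1 0 := by
  unfold toffoliGate HasSize queries
  split
  · split_ifs
    · exact ⟨le_rfl, le_rfl⟩
    · simp
  · simp

theorem hasSize_qft (s : ℕ) : HasSize (qft m n a s) (s * (1 + s * 5)) 0 := by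
  have h : ∀ i < s, HasSize (hGate m n a (0, i) ++ qftPhases m n a i i) (1 + s * 5) 0 :=
    fun i hi => by
      obtain ⟨h1, h2⟩ := (hasSize_hGate (0, i)).append
        (HasSize.flatMap_range (m := m) (n := n) (a := a) (N := i) (B := 5) fun k _ =>
        ((((hasSize_phaseGate _ _).append (hasSize_phaseGate _ _)).append
          (hasSize_cnotGate _ _)).append (hasSize_phaseInvGate _ _)).append (hasSize_cnotGate _ _))
      exact ⟨h1.trans (by omega), h2⟩
  suffices ∀ r ≤ s, HasSize (qft m n a r) (r * (1 + s * 5)) 0 from this s le_rfl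
  intro r hr
  induction r with
  | zero => simp [HasSize, queries, qft]
  | succ r ih =>
    rw [qft_succ, Nat.succ_mul, add_comm]
    exact (h r (by omega)).append (ih (by omega))

theorem hasSize_sampleStep (Y Z : ℕ) : HasSize (sampleStep m n a Y Z)
    (m * (1 + m * 5) + 1 + m * (1 + m * 5) + (m * 2 + n * 2)) 1 :=
  (((hasSize_qft m).append HasSize.oracle).append (hasSize_qft m)).append
    ((HasSize.flatMap_range fun _ _ => (hasSize_cnotGate _ _).append (hasSize_cnotGate _ _)).append
      (HasSize.flatMap_range fun _ _ => (hasSize_cnotGate _ _).append (hasSize_cnotGate _ _)))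

theorem hasSize_opGates (t : ℕ) (o : ℕ × ℕ × ℕ) : HasSize (opGates m n a t o) 2 0 := by
  refine HasSize.append (N' := 1) (q' := 0) (hasSize_cnotGate (3, o.1) (3, t)) ?_
  split_ifs
  · exact hasSize_cnotGate _ _
  · exact hasSize_toffoliGate _ _ _

theorem hasSize_program (b N : ℕ) (o : ℕ → ℕ × ℕ × ℕ) :
    HasSize (program m n a b o N) (N * 2) 0 :=
  HasSize.flatMap_range fun _ _ => hasSize_opGates _ _

end QCircuit

namespace PostProcess

open QCircuit

theorem size_le (m n : ℕ) : size m ≤ 2400 * (m + n + 1) ^ 3 := by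
  have h : size m = 2304 * (m + 1) ^ 3 + 96 * (m + 1) := by
    unfold size numBlocks phaseLen cols width; ring
  have h1 : (m + 1) ^ 3 ≤ (m + n + 1) ^ 3 := Nat.pow_le_pow_left (by omega) 3
  have h2 : m + 1 ≤ (m + 1) ^ 3 := Nat.le_self_pow (by norm_num) _
  omega

theorem work_le (m n : ℕ) : work m n ≤ 5000 * (m + n + 1) ^ 3 := by
  have h1 := size_le m n
  have h2 : m + n + 1 ≤ (m + n + 1) ^ 3 := Nat.le_self_pow (by norm_num) _
  unfold work base; omega

theorem hasSize_circuit (m n : ℕ) : HasSize (circuit m n) (5000 * (m + n + 1) ^ 3) 3 := by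
  obtain ⟨h, h'⟩ := (hasSize_sampleStep (m := m) (n := n) (a := work m n) 2 (2 + 2 * m)).append
    ((hasSize_sampleStep (2 + m) (2 + 2 * m + n)).append
      (((((hasSize_hGate (3, 1)).append (hasSize_phaseGate 1 (3, 1))).append
        (hasSize_hGate (3, 1))).append (hasSize_program (base m n) (size m) (op m n))).append
        (HasSize.flatMap_range (N := m) fun i _ =>
          hasSize_cnotGate (3, resultCell m n i) (0, i)) |>.append HasSize.oracle))
  refine ⟨h.trans ?_, h'⟩
  have h1 := size_le m n
  have h2 : m + n + 1 ≤ (m + n + 1) ^ 3 := Nat.le_self_pow (by norm_num) _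
  have h3 : m * m + m ≤ (m + n + 1) ^ 2 := by nlinarith
  have h4 : (m + n + 1) ^ 2 ≤ (m + n + 1) ^ 3 := Nat.pow_le_pow_right (by omega) (by norm_num)
  have h5 : m * (1 + m * 5) = m + 5 * (m * m) := by ring
  omega

end PostProcess

theorem mainTheorem1 :
    ∃ (Q : ℕ) (δ : ℝ) (p : Polynomial ℕ) (work : ℕ → ℕ → ℕ)
      (C : (m n : ℕ) → QCircuit m n (work m n)),
      0 < δ ∧
      Computable (fun q : ℕ × ℕ => work q.1 q.2) ∧
      Computable (fun q : ℕ × ℕ => QCircuit.code (C q.1 q.2)) ∧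
      ∀ m n : ℕ,
        work m n ≤ p.eval (m + n) ∧
        (C m n).length ≤ p.eval (m + n) ∧
        QCircuit.queries (C m n) ≤ Q ∧
        ∀ φ : GraphOrientation (cubeGraph n), φ.IsUSO →
        ∀ l : ℕ, l = Function.minimalPeriod φ.outmap ∅ →
          0 < l ∧ l ≤ 2 ^ n ∧
          (∀ w, φ.IsSink w ↔ w = φ.outmap^[l - 1] ∅) ∧
          ∀ U ∈ Matrix.unitaryGroup (OracleWire m n → Bool) ℂ,
            CalculatesPowers U φ.outmap →
            (2 * n ≤ m ∨ l ^ 2 ≤ 2 ^ m) →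
            δ ≤ QCircuit.outputProb (C m n) U (l - 1) (φ.outmap^[l - 1] ∅) := by
  refine ⟨3, 1 / (64 * Real.pi ^ 4), Polynomial.C 5000 * (Polynomial.X + 1) ^ 3,
    PostProcess.work, PostProcess.circuit, by positivity, PostProcess.computable_work,
    PostProcess.computable_code_circuit, fun m n => ?_⟩
  have hp : (Polynomial.C 5000 * (Polynomial.X + 1) ^ 3 : Polynomial ℕ).eval (m + n) =
      5000 * (m + n + 1) ^ 3 := by simp
  obtain ⟨hlen, hquery⟩ := PostProcess.hasSize_circuit m n
  rw [hp]
  refine ⟨PostProcess.work_le m n, hlen, hquery, fun φ hφ l hl => ?_⟩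
  have hle : l ≤ 2 ^ n := hl ▸ GraphOrientation.minimalPeriod_outmap_le φ ∅
  have hpos : 0 < l := hl ▸ hφ.minimalPeriod_pos ∅
  refine ⟨hpos, hle, fun w => hl ▸ hφ.isSink_iff_eq_iterate w, fun U _ hU hm => ?_⟩
  refine PostProcess.outputProb_circuit_ge hU hl hpos (hm.elim (fun h => ?_) id)
  calc l ^ 2 ≤ (2 ^ n) ^ 2 := Nat.pow_le_pow_left hle 2
    _ = 2 ^ (2 * n) := by rw [← pow_mul, mul_comm]
    _ ≤ 2 ^ m := Nat.pow_le_pow_right two_pos h
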